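/- For a set $S\subseteq\mathbb{R}^2$, points $p,q\in S$ are *Manhattan-connected* in $S$ if there are points $p=x_0,x_1,\dots,x_k=q$ of $S$ such that $x_i$ and $x_{i+1}$ have a common $x$- or a common $y$-coordinate for all $0\le i<k$, and $\sum_{i=0}^{k-1}\|x_i-x_{i+1}\|_1=\|p-q\|_1$. An instance of the problem MinGMConn (Minimum Generalized Manhattan Connections) is a pair $(P,D)$ consisting of a finite set $P\subseteq\mathbb{Z}^2$ of input points, no two of which have the same $x$-coordinate or the same $y$-coordinate, and a set of demands $D\subseteq P\times P$. A finite set $Q\subseteq\mathbb{R}^2$ is feasible for $(P,D)$ if $p$ and $q$ are Manhattan-connected in $P\cup Q$ for every $(p,q)\in D$, and $\mathrm{OPT}(P,D)$ denotes the minimum cardinality of a feasible set. **Theorem.** MinGMConn admits an efficient $O(\sqrt{\log n})$-approximation: there are a constant $C$ and a deterministic algorithm that, given any instance $(P,D)$ of MinGMConn with $n=|P|$ input points (as lists of the points and of the demands, with coordinates in binary), computes, in time polynomial in the bit length of the input, a feasible set $Q\subseteq\mathbb{Z}^2$ for $(P,D)$ with $$|Q|\le C\,\sqrt{\log n}\cdot\mathrm{OPT}(P,D).$$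 Running time is measured on a random access machine with logarithmic cost. -/

import Mathlib

namespace MinGMConn

/-! ### Manhattan connections -/

/-- The `ℓ¹` distance of two points of the plane. -/
def l1Dist (a b : ℝ × ℝ) : ℝ := |a.1 - b.1| + |a.2 - b.2|

/-- Two points are horizontally or vertically aligned. -/
def Aligned (a b : ℝ × ℝ) : Prop := a.1 = b.1 ∨ a.2 = b.2

/-- `p` and `q` are Manhattan-connected in `S`: there are points `p = x 0, x 1, …, x k = q` of `S`,
consecutive ones aligned, of total length `‖p - q‖₁`. -/
def MConnected (S : Set (ℝ × ℝ)) (p q : ℝ × ℝ) : Prop :=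
  ∃ (k : ℕ) (x : ℕ → ℝ × ℝ), x 0 = p ∧ x k = q ∧ (∀ i ≤ k, x i ∈ S) ∧
    (∀ i < k, Aligned (x i) (x (i + 1))) ∧
    ∑ i ∈ Finset.range k, l1Dist (x i) (x (i + 1)) = l1Dist p q

/-- A point of the integer grid as a point of the plane. -/
def toPlane (p : ℤ × ℤ) : ℝ × ℝ := ((p.1 : ℝ), (p.2 : ℝ))

/-- An instance: a finite set `P` of input points of the integer grid, no two of them in the same
column or in the same row, and a set `D` of demands between input points. -/
structure Instance where
  P : Finset (ℤ × ℤ)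
  D : Finset ((ℤ × ℤ) × (ℤ × ℤ))
  demand_mem : ∀ d ∈ D, d.1 ∈ P ∧ d.2 ∈ P
  column_inj : ∀ p ∈ P, ∀ q ∈ P, p.1 = q.1 → p = q
  row_inj : ∀ p ∈ P, ∀ q ∈ P, p.2 = q.2 → p = q

/-- `Q` is a feasible set of auxiliary points: every demand is connected in `P ∪ Q`. -/
def Instance.Feasible (I : Instance) (Q : Set (ℝ × ℝ)) : Prop :=
  ∀ d ∈ I.D, MConnected (toPlane '' (I.P : Set (ℤ × ℤ)) ∪ Q) (toPlane d.1) (toPlane d.2)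

/-- The least cardinality of a feasible set of points of the plane. -/
noncomputable def Instance.opt (I : Instance) : ℕ :=
  sInf {k : ℕ | ∃ Q : Finset (ℝ × ℝ), I.Feasible (Q : Set (ℝ × ℝ)) ∧ Q.card = k}

/-! ### Random access machines with logarithmic cost

The memory consists of integer registers and of integer arrays; a program names only finitely many
of them. Programs are built from assignments, array writes, conditionals and loops. Every operation
is charged the bit length of all the integers that it handles, so that running times agree with
those of Turing machines up to a polynomial. -/

/-- The memory: registers `var 0, var 1, …` and arrays `arr 0, arr 1, …`. -/
structure Store where
  var : ℕ → ℤ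
  arr : ℕ → ℤ → ℤ

/-- Write a register. -/
def Store.setVar (s : Store) (x : ℕ) (v : ℤ) : Store :=
  { s with var := Function.update s.var x v }

/-- Write one cell of an array. -/
def Store.setArr (s : Store) (a : ℕ) (i v : ℤ) : Store :=
  { s with arr := Function.update s.arr a (Function.update (s.arr a) i v) }

/-- One (for the sign) plus the number of binary digits. -/
def bitLength (z : ℤ) : ℕ := 1 + Nat.size z.natAbs

/-- Arithmetic expressions; `read a e` is the cell of the array `a` with index `e`. -/
inductive Expr where
  | const (c : ℤ)
  | var (x : ℕ)
  | read (a : ℕ) (e : Expr)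
  | add (e f : Expr)
  | sub (e f : Expr)
  | mul (e f : Expr)
  | div (e f : Expr)

/-- The value of an expression (division is integer division, with value `0` for divisor `0`). -/
def Expr.eval (s : Store) : Expr → ℤ
  | .const c => c
  | .var x => s.var x
  | .read a e => s.arr a (e.eval s)
  | .add e f => e.eval s + f.eval s
  | .sub e f => e.eval s - f.eval s
  | .mul e f => e.eval s * f.eval s
  | .div e f => e.eval s / f.eval s

/-- The cost of evaluating an expression: the total bit length of the values of all its
subexpressions, itself included. -/
def Expr.cost (s : Store) : Expr → ℕ
  | .const c => bitLength c
  | .var x => bitLength (s.var x)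
  | .read a e => e.cost s + bitLength (s.arr a (e.eval s))
  | .add e f => e.cost s + f.cost s + bitLength (e.eval s + f.eval s)
  | .sub e f => e.cost s + f.cost s + bitLength (e.eval s - f.eval s)
  | .mul e f => e.cost s + f.cost s + bitLength (e.eval s * f.eval s)
  | .div e f => e.cost s + f.cost s + bitLength (e.eval s / f.eval s)

/-- Programs. The tests of `ite` and `loop` succeed if the value of the expression is positive. -/
inductive Program where
  | skip
  | assign (x : ℕ) (e : Expr)
  | write (a : ℕ) (i e : Expr)
  | seq (c d : Program)
  | ite (e : Expr) (c d : Program)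
  | loop (e : Expr) (c : Program)

/-- `Exec c s t s'`: started in the memory `s`, the program `c` halts, at cost `t`, in `s'`. -/
inductive Exec : Program → Store → ℕ → Store → Prop where
  | skip (s : Store) : Exec .skip s 1 s
  | assign (x : ℕ) (e : Expr) (s : Store) :
      Exec (.assign x e) s (1 + e.cost s) (s.setVar x (e.eval s))
  | write (a : ℕ) (i e : Expr) (s : Store) :
      Exec (.write a i e) s (1 + i.cost s + e.cost s) (s.setArr a (i.eval s) (e.eval s))
  | seq {c d : Program} {s s' s'' : Store} {t t' : ℕ} :
      Exec c s t s' → Exec d s' t' s'' → Exec (.seq c d) s (t + t') s''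
  | ite_true {e : Expr} {c d : Program} {s s' : Store} {t : ℕ} :
      0 < e.eval s → Exec c s t s' → Exec (.ite e c d) s (1 + e.cost s + t) s'
  | ite_false {e : Expr} {c d : Program} {s s' : Store} {t : ℕ} :
      ¬ 0 < e.eval s → Exec d s t s' → Exec (.ite e c d) s (1 + e.cost s + t) s'
  | loop_true {e : Expr} {c : Program} {s s' s'' : Store} {t t' : ℕ} :
      0 < e.eval s → Exec c s t s' → Exec (.loop e c) s' t' s'' →
      Exec (.loop e c) s (1 + e.cost s + t + t') s''
  | loop_false {e : Expr} {c : Program} {s : Store} :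
      ¬ 0 < e.eval s → Exec (.loop e c) s (1 + e.cost s) s

/-- Programs are deterministic: the final memory and the cost are determined by the input. -/
theorem Exec.deterministic {c : Program} {s s₁ s₂ : Store} {t₁ t₂ : ℕ}
    (h₁ : Exec c s t₁ s₁) (h₂ : Exec c s t₂ s₂) : t₁ = t₂ ∧ s₁ = s₂ := by
  induction h₁ generalizing t₂ s₂ with
  | skip | assign | write => cases h₂; exact ⟨rfl, rfl⟩
  | seq _ _ ih ih' =>
    cases h₂ with
    | seq a b => obtain ⟨rfl, rfl⟩ := ih a; obtain ⟨rfl, rfl⟩ := ih' b; exact ⟨rfl, rfl⟩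
  | ite_true h _ ih =>
    cases h₂ with
    | ite_true _ a => obtain ⟨rfl, rfl⟩ := ih a; exact ⟨rfl, rfl⟩
    | ite_false h' _ => exact absurd h h'
  | ite_false h _ ih =>
    cases h₂ with
    | ite_true h' _ => exact absurd h' h
    | ite_false _ a => obtain ⟨rfl, rfl⟩ := ih a; exact ⟨rfl, rfl⟩
  | loop_true h _ _ ih ih' =>
    cases h₂ with
    | loop_true _ a b => obtain ⟨rfl, rfl⟩ := ih a; obtain ⟨rfl, rfl⟩ := ih' b; exact ⟨rfl, rfl⟩
    | loop_false h' => exact absurd h h'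
  | loop_false h =>
    cases h₂ with
    | loop_true h' _ _ => exact absurd h' h
    | loop_false _ => exact ⟨rfl, rfl⟩

/-! ### Input, output and approximation algorithms -/

/-- `ps` and `ds` list the input points and the demands of `I`, in some order and without
repetition. -/
structure Instance.ListedBy (I : Instance) (ps : List (ℤ × ℤ))
    (ds : List ((ℤ × ℤ) × (ℤ × ℤ))) : Prop where
  nodup_points : ps.Nodup
  mem_points : ∀ p, p ∈ ps ↔ p ∈ I.P
  nodup_demands : ds.Nodup
  mem_demands : ∀ d, d ∈ ds ↔ d ∈ I.D

/-- The array that holds the list `l` in its cells `0, …, l.length - 1` and `0` elsewhere. -/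
def arrayOf (l : List ℤ) (i : ℤ) : ℤ := if 0 ≤ i then l.getD i.toNat 0 else 0

/-- The initial memory. Registers `0` and `1` hold the number of points and of demands. The arrays
`0`, `1` hold the coordinates of the points; `2`, `3` and `4`, `5` those of the first and of the
second points of the demands. Everything else is `0`. -/
def inputStore (ps : List (ℤ × ℤ)) (ds : List ((ℤ × ℤ) × (ℤ × ℤ))) : Store where
  var
    | 0 => ps.length
    | 1 => ds.length
    | _ => 0
  arr
    | 0 => arrayOf (ps.map fun p => p.1)
    | 1 => arrayOf (ps.map fun p => p.2)
    | 2 => arrayOf (ds.map fun d => d.1.1)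
    | 3 => arrayOf (ds.map fun d => d.1.2)
    | 4 => arrayOf (ds.map fun d => d.2.1)
    | 5 => arrayOf (ds.map fun d => d.2.2)
    | _ => fun _ => 0

/-- The total bit length of the input. -/
def inputSize (ps : List (ℤ × ℤ)) (ds : List ((ℤ × ℤ) × (ℤ × ℤ))) : ℕ :=
  bitLength ps.length + bitLength ds.length
    + (ps.map fun p => bitLength p.1 + bitLength p.2).sum
    + (ds.map fun d => bitLength d.1.1 + bitLength d.1.2 + bitLength d.2.1 + bitLength d.2.2).sum

/-- The output: register `2` holds a number `k`, and the arrays `6`, `7` hold in their cells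
`0, …, k - 1` the coordinates of the auxiliary points. -/
def outputPoints (s : Store) : Finset (ℤ × ℤ) :=
  (Finset.range (s.var 2).toNat).image fun i : ℕ => (s.arr 6 (i : ℤ), s.arr 7 (i : ℤ))

/-- `prog` is a polynomial-time algorithm that computes, for every instance with `n` input points,
a feasible solution of cardinality at most `ρ n` times the optimum. -/
def IsPolyTimeApproximation (prog : Program) (ρ : ℕ → ℝ) : Prop :=
  ∃ time : Polynomial ℕ,
    ∀ (I : Instance) (ps : List (ℤ × ℤ)) (ds : List ((ℤ × ℤ) × (ℤ × ℤ))), I.ListedBy ps ds →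
      ∃ (t : ℕ) (s : Store),
        Exec prog (inputStore ps ds) t s ∧
        t ≤ time.eval (inputSize ps ds) ∧
        I.Feasible (toPlane '' (outputPoints s : Set (ℤ × ℤ))) ∧
        ((outputPoints s).card : ℝ) ≤ ρ I.P.card * (I.opt : ℝ)

end MinGMConn

/-!
Arrange the columns of the input points, by rank, in a tree of degree `2 ^ k` and depth `k`,
where `k` is about `√(log n)`; its nodes of a level are the strips of that level. At one level
the two ends of a demand lie in different strips with the same parent, so that every connecting
path leaves the first strip in some row and enters the last strip in a later row. Charging such
rows to the last points in their strips shows that a feasible set `Q` yields a set of at most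
`8|Q|` rows of strips that serves all demands in this sense.

For two disjoint intervals of rows, there are `v ≤ v'` chosen in the first and in the second
interval if and only if every cut `h` has a chosen row below `h` in the first or from `h` on in
the second interval. So the rows form a hitting set for the cuts of the demands, and doubling the
weights of sets of small weight finds a fractional hitting set of value `O(|Q|)`. A weighted net
of `O(|Q|)` rows meets every heavy interval; at some cut both parts are heavy, so that the net
contains suitable `v ≤ v'` for every demand. Since two strips with the same parent are separated
by the boundary of a dyadic interval of strips, it suffices to put `k` points into each row of
the net, one for each size of such an interval, and `k` points next to each end of a demand.

Bounded sums, bounded products, tables and repetitions suffice for the algorithm, and programs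
made of them run in polynomial time whenever all their intermediate values have polynomial bit
length.
-/

namespace MinGMConn

/-! ### Bounds on costs -/

theorem bitLength_le {z : ℤ} {v : ℕ} (h : |z| ≤ 2 ^ v) : bitLength z ≤ v + 2 := by
  have hlt : z.natAbs < 2 ^ (v + 1) := by
    have h' : z.natAbs ≤ 2 ^ v := by zify; exact h
    exact h'.trans_lt (Nat.pow_lt_pow_right (by norm_num) (by omega))
  have := Nat.size_le.2 hlt
  unfold bitLength
  omega

theorem abs_le_two_pow {z : ℤ} {B : ℕ} (h : |z| ≤ B) : |z| ≤ 2 ^ B :=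
  h.trans (by exact_mod_cast (Nat.lt_two_pow_self (n := B)).le)

theorem bitLength_le_of_abs_le {z : ℤ} {B : ℕ} (h : |z| ≤ B) : bitLength z ≤ B + 2 :=
  bitLength_le (abs_le_two_pow h)

theorem bitLength_one : bitLength 1 = 2 := by simp [bitLength]

theorem bitLength_zero : bitLength 0 = 1 := by simp [bitLength]

/-- Hoare triples with a running time: started in `s`, the program halts at cost at most `T` in a
memory that satisfies `post`. -/
def Program.RunsWithin (c : Program) (s : Store) (T : ℕ) (post : Store → Prop) : Prop :=
  ∃ (t : ℕ) (s' : Store), Exec c s t s' ∧ t ≤ T ∧ post s'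

namespace Program.RunsWithin

variable {c d : Program} {e : Expr} {s : Store} {T T' k q n : ℕ} {post post' : Store → Prop}

theorem mono (h : c.RunsWithin s T post) (hT : T ≤ T') (hpost : ∀ s', post s' → post' s') :
    c.RunsWithin s T' post' := by
  obtain ⟨t, s', hexec, ht, hs'⟩ := h
  exact ⟨t, s', hexec, ht.trans hT, hpost s' hs'⟩

theorem of_le (hT : T ≤ T') (h : c.RunsWithin s T post) : c.RunsWithin s T' post :=
  h.mono hT fun _ => id

theorem assign {x : ℕ} (he : e.cost s ≤ k) (h : post (s.setVar x (e.eval s))) :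
    (Program.assign x e).RunsWithin s (k + 1) post :=
  ⟨_, _, .assign x e s, by omega, h⟩

theorem assign_eq {x : ℕ} (he : e.cost s ≤ k) :
    (Program.assign x e).RunsWithin s (k + 1) (· = s.setVar x (e.eval s)) :=
  assign he rfl

theorem seq (h : c.RunsWithin s T post) (h' : ∀ s', post s' → d.RunsWithin s' T' post') :
    (c.seq d).RunsWithin s (T + T') post' := by
  obtain ⟨t, s', hexec, ht, hs'⟩ := h
  obtain ⟨t', s'', hexec', ht', hs''⟩ := h' s' hs'
  exact ⟨_, s'', hexec.seq hexec', by omega, hs''⟩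

theorem ite (he : e.cost s ≤ k) (hc : 0 < e.eval s → c.RunsWithin s T post)
    (hd : ¬ 0 < e.eval s → d.RunsWithin s T post) :
    (Program.ite e c d).RunsWithin s (k + T + 1) post := by
  by_cases hpos : 0 < e.eval s
  · obtain ⟨t, s', hexec, ht, hs'⟩ := hc hpos
    exact ⟨_, s', .ite_true hpos hexec, by omega, hs'⟩
  · obtain ⟨t, s', hexec, ht, hs'⟩ := hd hpos
    exact ⟨_, s', .ite_false hpos hexec, by omega, hs'⟩

theorem loop (inv : ℕ → Store → Prop) (h₀ : inv 0 s)
    (hcost : ∀ i s', inv i s' → e.cost s' ≤ k)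
    (hpos : ∀ i s', inv i s' → (0 < e.eval s' ↔ i < n)) (hle : ∀ i s', inv i s' → i ≤ n)
    (hc : ∀ i < n, ∀ s', inv i s' → c.RunsWithin s' q (inv (i + 1))) :
    (Program.loop e c).RunsWithin s ((n + 1) * (k + q + 1)) (inv n) := by
  suffices H : ∀ m i, i + m = n → ∀ s', inv i s' →
      (Program.loop e c).RunsWithin s' ((m + 1) * (k + q + 1)) (inv n) from H n 0 (zero_add n) s h₀
  intro m
  induction m with
  | zero =>
    rintro i rfl s' hs'
    exact ⟨_, s', .loop_false (by rw [hpos i s' hs']; simp), by linarith [hcost i s' hs'], hs'⟩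
  | succ m ih =>
    intro i him s' hs'
    obtain ⟨t, s₁, hexec, ht, hs₁⟩ := hc i (by omega) s' hs'
    obtain ⟨t', s₂, hexec', ht', hs₂⟩ := ih (i + 1) (by omega) s₁ hs₁
    exact ⟨_, s₂, .loop_true ((hpos i s' hs').2 (by omega)) hexec hexec',
      by linarith [hcost i s' hs'], hs₂⟩

end Program.RunsWithin

@[simp] theorem Store.setVar_arr (s : Store) (x : ℕ) (v : ℤ) : (s.setVar x v).arr = s.arr := rfl

@[simp] theorem Store.setVar_var (s : Store) (x : ℕ) (v : ℤ) (y : ℕ) :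
    (s.setVar x v).var y = if y = x then v else s.var y := by
  simp [Store.setVar, Function.update_apply]

theorem Store.setVar_comm {x y : ℕ} (h : x ≠ y) (s : Store) (v w : ℤ) :
    (s.setVar x v).setVar y w = (s.setVar y w).setVar x v := by
  simp [Store.setVar, Function.update_comm h]

theorem Store.setVar_self (s : Store) (x : ℕ) : s.setVar x (s.var x) = s := by
  simp [Store.setVar]

@[simp] theorem Store.setArr_var (s : Store) (a : ℕ) (i v : ℤ) : (s.setArr a i v).var = s.var := rfl

theorem Expr.cost_sub_var_le {s : Store} {x r B : ℕ} (hr : |s.var r| ≤ B) (hx : |s.var x| ≤ B)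
    (hsub : |s.var r - s.var x| ≤ B) : (Expr.sub (.var r) (.var x)).cost s ≤ 3 * B + 6 := by
  have hcr := bitLength_le_of_abs_le hr
  have hcx := bitLength_le_of_abs_le hx
  have hcs := bitLength_le_of_abs_le hsub
  simp only [Expr.cost, Expr.eval]
  omega

theorem Program.RunsWithin.increment {s : Store} {x i B : ℕ} {post : Store → Prop}
    (hx : s.var x = i) (hi : i < B) (h : post (s.setVar x (i + 1 : ℕ))) :
    (Program.assign x (.add (.var x) (.const 1))).RunsWithin s (2 * B + 7) post := by
  have hi₀ : bitLength (i : ℤ) ≤ B + 2 := bitLength_le_of_abs_le (by rw [Nat.abs_cast]; omega)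
  have hi₁ : bitLength ((i : ℤ) + 1) ≤ B + 2 :=
    bitLength_le_of_abs_le (by rw [abs_of_nonneg (by positivity)]; omega)
  refine .assign (k := 2 * B + 6) ?_ ?_
  · simp only [Expr.cost, Expr.eval, hx, bitLength_one]
    omega
  · simpa [Expr.eval, hx] using h

/-- The loop that runs `c` with the register `x` set to `0, 1, …` below the value of the register
`r`. The register `d` keeps the old value of `x`, which is restored at the end. -/
def Program.forLoop (d x r : ℕ) (c : Program) : Program :=
  .seq (.assign d (.var x)) <| .seq (.assign x (.const 0)) <|
    .seq (.loop (.sub (.var r) (.var x)) (.seq c (.assign x (.add (.var x) (.const 1)))))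
      (.assign x (.var d))

theorem Program.RunsWithin.forLoop {c : Program} {s : Store} {d x r q B : ℕ} (hxr : x ≠ r)
    (hdx : d ≠ x) (hdr : d ≠ r) (hx : |s.var x| ≤ B) (hr : |s.var r| ≤ B) (inv : ℕ → Store → Prop)
    (h₀ : inv 0 ((s.setVar d (s.var x)).setVar x 0))
    (hc : ∀ i < (s.var r).toNat, ∀ s', inv i s' → s'.var x = i →
      c.RunsWithin s' q fun s'' => (∀ y ∈ [d, x, r], s''.var y = s'.var y) ∧
        inv (i + 1) (s''.setVar x (i + 1 : ℕ))) :
    (Program.forLoop d x r c).RunsWithin s ((B + 1) * (q + 5 * B + 22))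
      fun s' => ∃ s'', inv (s.var r).toNat s'' ∧ s' = s''.setVar x (s.var x) := by
  have hnB : (s.var r).toNat ≤ B := by rw [abs_le] at hr; omega
  have hcost {y : ℕ} {s' : Store} (hy : |s'.var y| ≤ B) : (Expr.var y).cost s' ≤ B + 2 :=
    bitLength_le_of_abs_le hy
  let inv' (i : ℕ) (s' : Store) : Prop := inv i s' ∧ i ≤ (s.var r).toNat ∧
    s'.var d = s.var x ∧ s'.var x = i ∧ s'.var r = s.var r
  have htest (i : ℕ) (s' : Store) (h : inv' i s') :
      (Expr.sub (.var r) (.var x)).cost s' ≤ 3 * B + 6 := by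
    obtain ⟨-, hi, -, hx', hr'⟩ := h
    exact Expr.cost_sub_var_le (by rwa [hr']) (by rw [hx', Nat.abs_cast]; omega)
      (by rw [hx', hr', abs_le] at *; omega)
  have hbody (i : ℕ) (hi : i < (s.var r).toNat) (s' : Store) (h : inv' i s') :
      (Program.seq c (.assign x (.add (.var x) (.const 1)))).RunsWithin s'
        (q + (2 * B + 7)) (inv' (i + 1)) := by
    obtain ⟨hinv, -, hd', hx', hr'⟩ := h
    refine (hc i hi s' hinv hx').seq fun s'' ⟨hsame, hinv''⟩ => ?_
    have hxi : s''.var x = i := by rw [hsame x (by simp), hx']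
    refine .increment hxi (by omega) ⟨hinv'', hi, ?_, ?_, ?_⟩
    · simp [hdx, hsame d (by simp), hd']
    · simp
    · simp [hxr.symm, hsame r (by simp), hr']
  refine .of_le ?_ (.seq (.assign_eq (hcost hx)) fun s₁ hs₁ =>
    .seq (.assign_eq (k := 1) (by simp [Expr.cost, bitLength_zero])) fun s₂ hs₂ =>
    .seq (.loop inv' (n := (s.var r).toNat) ?_ htest ?_ (fun i s' h => h.2.1) hbody)
    fun s₃ hs₃ => .assign (k := B + 2) ?_ ?_)
  · have : ((s.var r).toNat + 1) * (3 * B + 6 + (q + (2 * B + 7)) + 1) ≤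
        (B + 1) * (q + 5 * B + 14) := Nat.mul_le_mul (by omega) (by omega)
    linarith
  · subst hs₁ hs₂
    exact ⟨h₀, Nat.zero_le _, by simp [hdx, Expr.eval], by simp [Expr.eval],
      by simp [hxr.symm, hdr.symm]⟩
  · rintro i s' ⟨-, hi, -, hx', hr'⟩
    simp only [Expr.eval, hx', hr']
    omega
  · exact hcost (by rw [hs₃.2.2.1]; exact hx)
  · exact ⟨s₃, hs₃.1, by simp [Expr.eval, hs₃.2.2.1]⟩

/-! ### A language of bounded sums and tables -/

/-- The binary operations of expressions. -/
inductive BinOp where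
  | add | sub | mul | div

/-- The value of a binary operation. -/
def BinOp.eval : BinOp → ℤ → ℤ → ℤ
  | .add, a, b => a + b
  | .sub, a, b => a - b
  | .mul, a, b => a * b
  | .div, a, b => a / b

/-- A binary operation applied to two registers. -/
def BinOp.expr : BinOp → ℕ → ℕ → Expr
  | .add, x, y => .add (.var x) (.var y)
  | .sub, x, y => .sub (.var x) (.var y)
  | .mul, x, y => .mul (.var x) (.var y)
  | .div, x, y => .div (.var x) (.var y)

/-- The two ways to aggregate a sequence of integers. -/
inductive Aggregation where
  | sum | prod

/-- The operation that adds one more value to an aggregate. -/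
def Aggregation.op : Aggregation → BinOp
  | .sum => .add
  | .prod => .mul

/-- The aggregate of no values. -/
def Aggregation.unit : Aggregation → ℤ
  | .sum => 0
  | .prod => 1

/-- The aggregate of the first `n` values of a function. -/
def Aggregation.eval (b : Aggregation) (f : ℕ → ℤ) : ℕ → ℤ
  | 0 => b.unit
  | n + 1 => b.op.eval (b.eval f n) (f n)

/-- Terms with bounded sums and products: in `agg b x r t` the register `x` runs through all values
from `0` to the value of the register `r`, exclusive. -/
inductive Term where
  | const (c : ℤ)
  | var (x : ℕ)
  | read (a : ℕ) (t : Term)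
  | bin (op : BinOp) (t u : Term)
  | ite (c t u : Term)
  | agg (b : Aggregation) (x r : ℕ) (t : Term)

/-- The value of a term. As in programs, tests succeed if their value is positive. -/
def Term.eval : Term → Store → ℤ
  | .const c, _ => c
  | .var x, s => s.var x
  | .read a t, s => s.arr a (t.eval s)
  | .bin op t u, s => op.eval (t.eval s) (u.eval s)
  | .ite c t u, s => if 0 < c.eval s then t.eval s else u.eval s
  | .agg b x r t, s => b.eval (fun i => t.eval (s.setVar x i)) (s.var r).toNat

/-- All registers of the term are below `S`, and no loop counter is its own bound. -/
def Term.wf (S : ℕ) : Term → Bool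
  | .const _ => true
  | .var x => x < S
  | .read _ t => t.wf S
  | .bin _ t u => t.wf S && u.wf S
  | .ite c t u => c.wf S && t.wf S && u.wf S
  | .agg _ x r t => (x < S) && (r < S) && (x != r) && t.wf S

/-- The term does not read the array `a`. -/
def Term.avoids (a : ℕ) : Term → Bool
  | .const _ => true
  | .var _ => true
  | .read a' t => (a' != a) && t.avoids a
  | .bin _ t u => t.avoids a && u.avoids a
  | .ite c t u => c.avoids a && t.avoids a && u.avoids a
  | .agg _ _ _ t => t.avoids a

/-- Statements: assignments to registers, tables, and repetitions. The statement `tab a x r t` is a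
parallel assignment: the cells of the array `a` from `0` to the value of the register `r`,
exclusive, receive the values of the term `t`, in which the register `x` holds the index. -/
inductive Stm where
  | set (x : ℕ) (t : Term)
  | tab (a x r : ℕ) (t : Term)
  | seq (c d : Stm)
  | rep (r : ℕ) (c : Stm)

/-- Write the first `n` cells of an array. -/
def Store.setCells (s : Store) (a : ℕ) (n : ℤ) (f : ℤ → ℤ) : Store :=
  { s with arr := Function.update s.arr a (fun i => if 0 ≤ i ∧ i < n then f i else s.arr a i) }

/-- The effect of a statement. -/
def Stm.eval : Stm → Store → Store
  | .set x t, s => s.setVar x (t.eval s)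
  | .tab a x r t, s => s.setCells a (s.var r) (fun i => t.eval (s.setVar x i))
  | .seq c d, s => d.eval (c.eval s)
  | .rep r c, s => c.eval^[(s.var r).toNat] s

/-- All registers are below `S`, and no table reads the array that it defines. -/
def Stm.wf (S : ℕ) : Stm → Bool
  | .set x t => (x < S) && t.wf S
  | .tab a x r t => (x < S) && (r < S) && (x != r) && t.wf S && t.avoids a
  | .seq c d => c.wf S && d.wf S
  | .rep r c => (r < S) && c.wf S

/-- The registers below `S` are at most `B`, and the cells of the arrays at most `2 ^ B`. -/
structure Store.Bounded (S B : ℕ) (s : Store) : Prop where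
  var_le : ∀ x < S, |s.var x| ≤ B
  arr_le : ∀ a i, |s.arr a i| ≤ 2 ^ B

/-- All stores that occur between the steps of a statement are bounded. -/
def Stm.Safe (S B : ℕ) : Stm → Store → Prop
  | .set x t, s => s.Bounded S B ∧ ((Stm.set x t).eval s).Bounded S B
  | .tab a x r t, s => s.Bounded S B ∧ ((Stm.tab a x r t).eval s).Bounded S B
  | .seq c d, s => c.Safe S B s ∧ d.Safe S B (c.eval s)
  | .rep r c, s => s.Bounded S B ∧ ∀ i < (s.var r).toNat, c.Safe S B (c.eval^[i] s)

/-- Two stores with the same arrays and the same registers below `d`. -/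
structure Store.Agree (d : ℕ) (s s' : Store) : Prop where
  arr_eq : s'.arr = s.arr
  var_eq : ∀ x < d, s'.var x = s.var x

@[simp] theorem Store.setCells_var (s : Store) (a : ℕ) (n : ℤ) (f : ℤ → ℤ) :
    (s.setCells a n f).var = s.var := rfl

theorem Store.setCells_arr (s : Store) (a : ℕ) (n : ℤ) (f : ℤ → ℤ) (b : ℕ) (i : ℤ) :
    (s.setCells a n f).arr b i =
      if b = a then if 0 ≤ i ∧ i < n then f i else s.arr a i else s.arr b i := by
  by_cases h : b = a
  · subst h; simp [Store.setCells]
  · simp [Store.setCells, h]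

theorem Store.setCells_zero (s : Store) (a : ℕ) (f : ℤ → ℤ) : s.setCells a 0 f = s := by
  have hempty (i : ℤ) : ¬ (0 ≤ i ∧ i < 0) := by omega
  simp [Store.setCells, hempty]

theorem Store.setCells_succ (s : Store) (a n : ℕ) (f : ℤ → ℤ) :
    s.setCells a (n + 1 : ℕ) f = (s.setCells a n f).setArr a n (f n) := by
  have hcell (i : ℤ) : (if 0 ≤ i ∧ i < n + 1 then f i else s.arr a i) =
      if i = n then f n else if 0 ≤ i ∧ i < n then f i else s.arr a i := by
    by_cases hi : i = n
    · subst hi; rw [if_pos (by omega), if_pos rfl]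
    · have hiff : (0 ≤ i ∧ i < (n : ℤ) + 1) ↔ (0 ≤ i ∧ i < (n : ℤ)) := by omega
      simp only [hi, if_false, hiff]
  simp only [Store.setCells, Store.setArr, Nat.cast_add, Nat.cast_one, hcell, Function.update_self,
    Function.update_idem]
  congr 2
  funext i
  rw [Function.update_apply]

theorem Store.setCells_toNat (s : Store) (a : ℕ) (n : ℤ) (f : ℤ → ℤ) :
    s.setCells a n.toNat f = s.setCells a n f := by
  have hiff (i : ℤ) : (0 ≤ i ∧ i < (n.toNat : ℤ)) ↔ (0 ≤ i ∧ i < n) := by omega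
  simp only [Store.setCells, hiff]

namespace Store.Agree

variable {d e x : ℕ} {s s' s'' : Store}

theorem refl (d : ℕ) (s : Store) : s.Agree d s := ⟨rfl, fun _ _ => rfl⟩

theorem trans (h : Agree d s s') (h' : Agree d s' s'') : Agree d s s'' :=
  ⟨h'.1.trans h.1, fun x hx => (h'.2 x hx).trans (h.2 x hx)⟩

theorem mono (h : Agree d s s') (he : e ≤ d) : Agree e s s' :=
  ⟨h.1, fun x hx => h.2 x (hx.trans_le he)⟩

theorem setVar_right (h : Agree d s s') (hx : d ≤ x) (v : ℤ) : Agree d s (s'.setVar x v) :=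
  ⟨h.1, fun y hy => by rw [Store.setVar_var, if_neg (by omega)]; exact h.2 y hy⟩

theorem setVar (h : Agree d s s') (x : ℕ) (v : ℤ) : Agree d (s.setVar x v) (s'.setVar x v) :=
  ⟨h.1, fun y hy => by simp only [Store.setVar_var, h.2 y hy]⟩

theorem setVar_setVar {v : ℤ} (h : Agree d (s.setVar x v) s') (w : ℤ) :
    Agree d (s.setVar x w) (s'.setVar x w) :=
  ⟨h.1, fun y hy => by
    have := h.2 y hy
    simp only [Store.setVar_var] at this ⊢
    split_ifs with hyx
    exacts [rfl, by simpa [hyx] using this]⟩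

theorem setArr (h : Agree d s s') (a : ℕ) (i v : ℤ) : Agree d (s.setArr a i v) (s'.setArr a i v) :=
  ⟨by simp only [Store.setArr, h.1], h.2⟩

theorem bounded {S B : ℕ} (ha : Agree d s s') (hd : S ≤ d) (h : s.Bounded S B) : s'.Bounded S B :=
  ⟨fun x hx => by rw [ha.2 x (by omega)]; exact h.1 x hx, fun a i => by rw [ha.1]; exact h.2 a i⟩

end Store.Agree

namespace Store.Bounded

variable {S B r : ℕ} {s : Store}

theorem setVar (h : s.Bounded S B) (x : ℕ) {v : ℤ} (hv : |v| ≤ B) : (s.setVar x v).Bounded S B :=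
  ⟨fun y hy => by rw [Store.setVar_var]; split_ifs; exacts [hv, h.1 y hy], h.2⟩

theorem setCells (h : s.Bounded S B) (a : ℕ) {n : ℤ} {f : ℤ → ℤ}
    (hf : ∀ i, 0 ≤ i → i < n → |f i| ≤ 2 ^ B) : (s.setCells a n f).Bounded S B :=
  ⟨h.1, fun b i => by
    rw [Store.setCells_arr]
    split_ifs with _ hi
    exacts [hf i hi.1 hi.2, h.2 _ _, h.2 _ _]⟩

theorem of_setCells {a : ℕ} {m n : ℤ} {f : ℤ → ℤ} (h : s.Bounded S B)
    (h' : (s.setCells a n f).Bounded S B) (hm : m ≤ n) : (s.setCells a m f).Bounded S B :=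
  h.setCells a fun i hi him => by
    have := h'.2 a i
    rwa [Store.setCells_arr, if_pos rfl, if_pos ⟨hi, him.trans_le hm⟩] at this

theorem mono {B' : ℕ} (h : s.Bounded S B) (hB : B ≤ B') : s.Bounded S B' :=
  ⟨fun x hx => (h.1 x hx).trans (by exact_mod_cast hB),
    fun a i => (h.2 a i).trans (pow_le_pow_right₀ (by norm_num) hB)⟩

theorem toNat_le (h : s.Bounded S B) (hr : r < S) : (s.var r).toNat ≤ B := by
  have := h.1 r hr
  rw [abs_le] at this
  omega

theorem setVar_nat (h : s.Bounded S B) (hr : r < S) (x : ℕ) {i : ℕ} (hi : i ≤ (s.var r).toNat) :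
    (s.setVar x i).Bounded S B :=
  h.setVar x (by rw [Nat.abs_cast]; exact_mod_cast hi.trans (h.toNat_le hr))

end Store.Bounded

theorem Term.eval_congr {S : ℕ} (t : Term) (ht : t.wf S) {s s' : Store} (h : s.Agree S s') :
    t.eval s' = t.eval s := by
  induction t generalizing s s' with
  | const c => rfl
  | var x => exact h.2 x (by simpa [Term.wf] using ht)
  | read a t ih => simp only [Term.eval, h.1, ih ht h]
  | bin op t u iht ihu =>
    simp only [Term.wf, Bool.and_eq_true] at ht
    simp only [Term.eval, iht ht.1 h, ihu ht.2 h]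
  | ite c t u ihc iht ihu =>
    simp only [Term.wf, Bool.and_eq_true] at ht
    simp only [Term.eval, ihc ht.1.1 h, iht ht.1.2 h, ihu ht.2 h]
  | agg b x r t ih =>
    simp only [Term.wf, Bool.and_eq_true, decide_eq_true_eq] at ht
    simp only [Term.eval, h.2 r ht.1.1.2, fun i : ℕ => ih ht.2 (h.setVar x i)]

theorem Term.eval_of_avoids {a : ℕ} (t : Term) (ht : t.avoids a) {s s' : Store}
    (hv : s'.var = s.var) (ha : ∀ b ≠ a, s'.arr b = s.arr b) : t.eval s' = t.eval s := by
  induction t generalizing s s' with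
  | const c => rfl
  | var x => exact congrFun hv x
  | read b t ih =>
    simp only [Term.avoids, Bool.and_eq_true, bne_iff_ne, ne_eq] at ht
    simp only [Term.eval, ih ht.2 hv ha, ha b ht.1]
  | bin op t u iht ihu =>
    simp only [Term.avoids, Bool.and_eq_true] at ht
    simp only [Term.eval, iht ht.1 hv ha, ihu ht.2 hv ha]
  | ite c t u ihc iht ihu =>
    simp only [Term.avoids, Bool.and_eq_true] at ht
    simp only [Term.eval, ihc ht.1.1 hv ha, iht ht.1.2 hv ha, ihu ht.2 hv ha]
  | agg b x r t ih =>
    have hcongr (i : ℕ) : t.eval (s'.setVar x i) = t.eval (s.setVar x i) :=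
      ih ht (by funext y; simp [hv]) (by simpa using ha)
    simp only [Term.eval, hv, hcongr]

theorem Aggregation.eval_sum (f : ℕ → ℤ) (n : ℕ) :
    Aggregation.sum.eval f n = ∑ i ∈ Finset.range n, f i := by
  induction n with
  | zero => rfl
  | succ n ih => rw [Finset.sum_range_succ, ← ih]; rfl

theorem Aggregation.eval_prod (f : ℕ → ℤ) (n : ℕ) :
    Aggregation.prod.eval f n = ∏ i ∈ Finset.range n, f i := by
  induction n with
  | zero => rfl
  | succ n ih => rw [Finset.prod_range_succ, ← ih]; rfl

theorem BinOp.abs_eval_le (op : BinOp) {a b : ℤ} {v w : ℕ} (ha : |a| ≤ 2 ^ v) (hb : |b| ≤ 2 ^ w) :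
    |op.eval a b| ≤ 2 ^ (v + w + 1) := by
  have hv : (1 : ℤ) ≤ 2 ^ v := one_le_pow₀ (by norm_num)
  have hw : (1 : ℤ) ≤ 2 ^ w := one_le_pow₀ (by norm_num)
  have hsum : (2 : ℤ) ^ v + 2 ^ w ≤ 2 * (2 ^ v * 2 ^ w) := by nlinarith
  rw [show (2 : ℤ) ^ (v + w + 1) = 2 * (2 ^ v * 2 ^ w) by ring]
  cases op with
  | add => exact (abs_add_le a b).trans (by linarith)
  | sub => exact (abs_sub a b).trans (by linarith)
  | mul =>
    calc |a * b| = |a| * |b| := abs_mul a b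
      _ ≤ 2 ^ v * 2 ^ w := by gcongr
      _ ≤ 2 * (2 ^ v * 2 ^ w) := by nlinarith
  | div => exact (Int.abs_ediv_le_abs a b).trans (by nlinarith)

theorem Aggregation.abs_eval_le (b : Aggregation) {f : ℕ → ℤ} {n v : ℕ}
    (hf : ∀ i < n, |f i| ≤ 2 ^ v) : |b.eval f n| ≤ 2 ^ (n * (v + 1)) := by
  induction n with
  | zero => cases b <;> simp [Aggregation.eval, Aggregation.unit]
  | succ n ih =>
    refine (b.op.abs_eval_le (ih fun i hi => hf i (by omega)) (hf n (by omega))).trans_eq ?_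
    congr 1
    ring

theorem Aggregation.abs_eval_le_of_le (b : Aggregation) {f : ℕ → ℤ} {n v B : ℕ} (hn : n ≤ B)
    (hf : ∀ i < n, |f i| ≤ 2 ^ v) : |b.eval f n| ≤ 2 ^ (B * (v + 1)) :=
  (b.abs_eval_le hf).trans (pow_le_pow_right₀ (by norm_num) (Nat.mul_le_mul_right _ hn))

theorem Term.exists_abs_eval_le {S : ℕ} (t : Term) (ht : t.wf S) :
    ∃ v : Polynomial ℕ, ∀ B s, s.Bounded S B → |t.eval s| ≤ 2 ^ (v.eval B) := by
  induction t with
  | const c =>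
    refine ⟨Polynomial.C c.natAbs, fun B s _ => ?_⟩
    rw [Polynomial.eval_C]
    exact abs_le_two_pow (by simp [Term.eval])
  | var x =>
    refine ⟨Polynomial.X, fun B s h => ?_⟩
    rw [Polynomial.eval_X]
    exact abs_le_two_pow (h.1 x (by simpa [Term.wf] using ht))
  | read a t => exact ⟨Polynomial.X, fun B s h => by simpa [Term.eval] using h.2 a (t.eval s)⟩
  | bin op t u iht ihu =>
    simp only [Term.wf, Bool.and_eq_true] at ht
    obtain ⟨v, hv⟩ := iht ht.1
    obtain ⟨w, hw⟩ := ihu ht.2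
    exact ⟨v + w + 1, fun B s h => by
      simpa [Term.eval] using op.abs_eval_le (hv B s h) (hw B s h)⟩
  | ite c t u _ iht ihu =>
    simp only [Term.wf, Bool.and_eq_true] at ht
    obtain ⟨v, hv⟩ := iht ht.1.2
    obtain ⟨w, hw⟩ := ihu ht.2
    refine ⟨v + w, fun B s h => ?_⟩
    simp only [Term.eval, Polynomial.eval_add]
    split_ifs
    · exact (hv B s h).trans (pow_le_pow_right₀ (by norm_num) (by omega))
    · exact (hw B s h).trans (pow_le_pow_right₀ (by norm_num) (by omega))
  | agg b x r t ih =>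
    simp only [Term.wf, Bool.and_eq_true, decide_eq_true_eq] at ht
    obtain ⟨v, hv⟩ := ih ht.2
    refine ⟨Polynomial.X * (v + 1), fun B s h => ?_⟩
    simpa [Term.eval] using b.abs_eval_le_of_le (h.toNat_le ht.1.1.2)
      fun i hi => hv B _ (h.setVar_nat ht.1.1.2 x hi.le)

/-! ### Compilation to programs -/

/-- A program that writes the value of a term to the register `d` and that uses the registers from
`d` on as scratch space. -/
def Term.comp : Term → ℕ → Program
  | .const c, d => .assign d (.const c)
  | .var x, d => .assign d (.var x)
  | .read a t, d => .seq (t.comp d) (.assign d (.read a (.var d)))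
  | .bin op t u, d => .seq (t.comp d) (.seq (u.comp (d + 1)) (.assign d (op.expr d (d + 1))))
  | .ite c t u, d => .seq (c.comp d) (.ite (.var d) (t.comp d) (u.comp d))
  | .agg b x r t, d =>
      .seq (.assign (d + 1) (.const b.unit)) <|
        .seq (.forLoop d x r (.seq (t.comp (d + 2)) (.assign (d + 1) (b.op.expr (d + 1) (d + 2)))))
          (.assign d (.var (d + 1)))

/-- A program for the statement, with the registers from `d` on as scratch space. -/
def Stm.comp : Stm → ℕ → Program
  | .set x t, d => .seq (t.comp d) (.assign x (.var d))
  | .tab a x r t, d => .forLoop d x r (.seq (t.comp (d + 1)) (.write a (.var x) (.var (d + 1))))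
  | .seq c c', d => .seq (c.comp d) (c'.comp d)
  | .rep r c, d =>
      .seq (.assign d (.var r))
        (.loop (.var d) (.seq (c.comp (d + 1)) (.assign d (.sub (.var d) (.const 1)))))

theorem BinOp.expr_eval (op : BinOp) (s : Store) (x y : ℕ) :
    (op.expr x y).eval s = op.eval (s.var x) (s.var y) := by
  cases op <;> rfl

theorem BinOp.expr_cost (op : BinOp) (s : Store) (x y : ℕ) :
    (op.expr x y).cost s =
      bitLength (s.var x) + bitLength (s.var y) + bitLength (op.eval (s.var x) (s.var y)) := by
  cases op <;> rfl

theorem BinOp.expr_cost_le (op : BinOp) {s : Store} {x y v w : ℕ} (hx : |s.var x| ≤ 2 ^ v)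
    (hy : |s.var y| ≤ 2 ^ w) : (op.expr x y).cost s ≤ 2 * v + 2 * w + 7 := by
  have hvx := bitLength_le hx
  have hvy := bitLength_le hy
  have hop := bitLength_le (op.abs_eval_le hx hy)
  rw [op.expr_cost]
  omega

/-- In memories bounded by `B`, the program for the term takes time polynomial in `B`, and it only
changes its scratch space. -/
def Term.RunsInPolyTime (S : ℕ) (t : Term) : Prop :=
  ∃ p : Polynomial ℕ, ∀ B s d, S ≤ d → s.Bounded S B →
    (t.comp d).RunsWithin s (p.eval B) fun s' => s.Agree d s' ∧ s'.var d = t.eval s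

namespace Term.RunsInPolyTime

variable {S : ℕ} {c t u : Term}

theorem const (k : ℤ) : (Term.const k).RunsInPolyTime S := by
  refine ⟨Polynomial.C (bitLength k + 1), fun B s d _ _ => ?_⟩
  rw [Polynomial.eval_C]
  exact .assign le_rfl
    ⟨(Store.Agree.refl d s).setVar_right le_rfl _, by simp [Term.eval, Expr.eval]⟩

theorem var {x : ℕ} (hx : x < S) : (Term.var x).RunsInPolyTime S := by
  refine ⟨Polynomial.X + 3, fun B s d _ h => ?_⟩
  simp only [Polynomial.eval_add, Polynomial.eval_X, Polynomial.eval_ofNat]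
  exact .assign (bitLength_le_of_abs_le (h.1 x hx))
    ⟨(Store.Agree.refl d s).setVar_right le_rfl _, by simp [Term.eval, Expr.eval]⟩

theorem read (a : ℕ) (ht : t.wf S) (h : t.RunsInPolyTime S) :
    (Term.read a t).RunsInPolyTime S := by
  obtain ⟨p, hp⟩ := h
  obtain ⟨v, hv⟩ := t.exists_abs_eval_le ht
  refine ⟨p + v + Polynomial.X + 5, fun B s d hd hs => ?_⟩
  refine .of_le ?_ ((hp B s d hd hs).seq fun s' ⟨hagree, hval⟩ =>
    .assign (k := v.eval B + 2 + (B + 2)) ?_ ⟨hagree.setVar_right le_rfl _, ?_⟩)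
  · simp only [Polynomial.eval_add, Polynomial.eval_X, Polynomial.eval_ofNat]
    omega
  · simp only [Expr.cost, Expr.eval, hval, hagree.1]
    exact Nat.add_le_add (bitLength_le (hv B s hs)) (bitLength_le (hs.2 a _))
  · simp [Expr.eval, Term.eval, hval, hagree.1]

theorem bin (op : BinOp) (ht : t.wf S) (hu : u.wf S) (h : t.RunsInPolyTime S)
    (h' : u.RunsInPolyTime S) : (Term.bin op t u).RunsInPolyTime S := by
  obtain ⟨p, hp⟩ := h
  obtain ⟨p', hp'⟩ := h'
  obtain ⟨v, hv⟩ := t.exists_abs_eval_le ht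
  obtain ⟨w, hw⟩ := u.exists_abs_eval_le hu
  refine ⟨p + p' + 2 * v + 2 * w + 8, fun B s d hd hs => ?_⟩
  refine .of_le ?_ ((hp B s d hd hs).seq fun s' ⟨hagree, hval⟩ =>
    (hp' B s' (d + 1) (by omega) (hagree.bounded hd hs)).seq fun s'' ⟨hagree', hval'⟩ => ?_)
    (T := p.eval B + (p'.eval B + (2 * v.eval B + 2 * w.eval B + 7 + 1)))
  · simp only [Polynomial.eval_add, Polynomial.eval_mul, Polynomial.eval_ofNat]
    omega
  · have hvt : s''.var d = t.eval s := by rw [hagree'.2 d (by omega), hval]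
    have hvu : s''.var (d + 1) = u.eval s := by rw [hval', u.eval_congr hu (hagree.mono hd)]
    refine .assign ?_ ⟨(hagree.trans (hagree'.mono (by omega))).setVar_right le_rfl _, ?_⟩
    · exact op.expr_cost_le (by rw [hvt]; exact hv B s hs) (by rw [hvu]; exact hw B s hs)
    · simp [op.expr_eval, hvt, hvu, Term.eval]

theorem ite (hc : c.wf S) (ht : t.wf S) (hu : u.wf S) (h : c.RunsInPolyTime S)
    (h' : t.RunsInPolyTime S) (h'' : u.RunsInPolyTime S) :
    (Term.ite c t u).RunsInPolyTime S := by
  obtain ⟨p, hp⟩ := h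
  obtain ⟨p', hp'⟩ := h'
  obtain ⟨p'', hp''⟩ := h''
  obtain ⟨v, hv⟩ := c.exists_abs_eval_le hc
  refine ⟨p + p' + p'' + v + 3, fun B s d hd hs => ?_⟩
  refine .of_le ?_ ((hp B s d hd hs).seq fun s' ⟨hagree, hval⟩ =>
    .ite (k := v.eval B + 2) (T := p'.eval B + p''.eval B) ?_ (fun hpos => ?_) fun hneg => ?_)
  · simp only [Polynomial.eval_add, Polynomial.eval_ofNat]
    omega
  · simp only [Expr.cost, hval]
    exact bitLength_le (hv B s hs)
  · have hpos : 0 < c.eval s := by rwa [← hval]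
    refine (hp' B s' d hd (hagree.bounded hd hs)).mono (by omega) fun s'' ⟨hagree', hval'⟩ =>
      ⟨hagree.trans hagree', ?_⟩
    simp [Term.eval, hpos, hval', t.eval_congr ht (hagree.mono hd)]
  · have hneg : ¬ 0 < c.eval s := by rwa [← hval]
    refine (hp'' B s' d hd (hagree.bounded hd hs)).mono (by omega) fun s'' ⟨hagree', hval'⟩ =>
      ⟨hagree.trans hagree', ?_⟩
    simp only [Term.eval, if_neg hneg, hval', u.eval_congr hu (hagree.mono hd)]

/-- The invariant of the loop for an aggregate: the register `d + 1` holds the aggregate of the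
first `i` values. -/
def AggInv (b : Aggregation) (x : ℕ) (t : Term) (s : Store) (d i : ℕ) (s' : Store) : Prop :=
  (s.setVar x i).Agree d s' ∧ s'.var (d + 1) = b.eval (fun j => t.eval (s.setVar x j)) i

theorem agg_body {b : Aggregation} {x r d B T i : ℕ} {s s' : Store} {v : Polynomial ℕ}
    (hx : x < S) (hr : r < S) (hd : S ≤ d) (ht : t.wf S)
    (hT : ∀ s d, S ≤ d → s.Bounded S B →
      (t.comp d).RunsWithin s T fun s' => s.Agree d s' ∧ s'.var d = t.eval s)
    (hv : ∀ s, s.Bounded S B → |t.eval s| ≤ 2 ^ v.eval B) (hs : s.Bounded S B)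
    (hi : i < (s.var r).toNat) (hinv : AggInv b x t s d i s') :
    (Program.seq (t.comp (d + 2)) (.assign (d + 1) (b.op.expr (d + 1) (d + 2)))).RunsWithin s'
      (T + (2 * (B * (v.eval B + 1)) + 2 * v.eval B + 7 + 1)) fun s'' =>
      (∀ y ∈ [d, x, r], s''.var y = s'.var y) ∧
        AggInv b x t s d (i + 1) (s''.setVar x (i + 1 : ℕ)) := by
  obtain ⟨hagree, hacc⟩ := hinv
  have hf (j : ℕ) (hj : j ≤ i) : |t.eval (s.setVar x j)| ≤ 2 ^ v.eval B :=
    hv _ (hs.setVar_nat hr x (hj.trans hi.le))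
  have hbdd : s'.Bounded S B := hagree.bounded hd (hs.setVar_nat hr x hi.le)
  refine (hT s' (d + 2) (by omega) hbdd).seq fun s'' ⟨hagree', hval⟩ => ?_
  rw [← hagree'.2 (d + 1) (by omega)] at hacc
  rw [t.eval_congr ht (hagree.mono hd)] at hval
  refine .assign (b.op.expr_cost_le ?_ (by rw [hval]; exact hf i le_rfl)) ⟨?_, ?_, ?_⟩
  · rw [hacc]
    exact b.abs_eval_le_of_le (hi.le.trans (hs.toNat_le hr)) fun j hj => hf j hj.le
  · simp [hagree'.2 d, hagree'.2 x (by omega), hagree'.2 r (by omega), show x ≠ d + 1 by omega,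
      show r ≠ d + 1 by omega]
  · exact ((hagree.trans (hagree'.mono (by omega))).setVar_right (by omega) _).setVar_setVar _
  · simp [BinOp.expr_eval, hacc, hval, Aggregation.eval, show d + 1 ≠ x by omega]

theorem agg (b : Aggregation) {x r : ℕ} (hx : x < S) (hr : r < S) (hxr : x ≠ r) (ht : t.wf S)
    (h : t.RunsInPolyTime S) : (Term.agg b x r t).RunsInPolyTime S := by
  obtain ⟨p, hp⟩ := h
  obtain ⟨v, hv⟩ := t.exists_abs_eval_le ht
  refine ⟨(Polynomial.X + 1) * (p + 2 * (Polynomial.X * (v + 1)) + 2 * v + 5 * Polynomial.X + 30) +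
    Polynomial.X * (v + 1) + 6, fun B s d hd hs => ?_⟩
  have hunit : bitLength b.unit ≤ 2 := by cases b <;> simp [Aggregation.unit, bitLength]
  refine .of_le ?_ (.seq (.assign_eq (e := .const b.unit) hunit) fun s₁ hs₁ =>
    .seq (.forLoop hxr (by omega) (by omega) (B := B) ?_ ?_ (AggInv b x t s d) ?_
      fun i hi s' hs' _ => agg_body hx hr hd ht (hp B) (hv B) hs
        (by simpa [hs₁, show r ≠ d + 1 by omega] using hi) hs')
    fun s₃ ⟨s₂, ⟨hagree, hacc⟩, hs₃⟩ =>
      .assign (k := B * (v.eval B + 1) + 2) ?_ ⟨?_, ?_⟩)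
  · simp only [Polynomial.eval_add, Polynomial.eval_mul, Polynomial.eval_X, Polynomial.eval_one,
      Polynomial.eval_ofNat]
    ring_nf
    omega
  · simpa [hs₁, show x ≠ d + 1 by omega] using hs.1 x hx
  · simpa [hs₁, show r ≠ d + 1 by omega] using hs.1 r hr
  · have hagree : s.Agree d ((s.setVar (d + 1) b.unit).setVar d (s.var x)) :=
      ((Store.Agree.refl d s).setVar_right (by omega) _).setVar_right le_rfl _
    simpa [AggInv, hs₁, Aggregation.eval, Expr.eval, show x ≠ d + 1 by omega,
      show d + 1 ≠ x by omega] using hagree.setVar x 0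
  all_goals
    have hx₁ : s₁.var x = s.var x := by simp [hs₁, show x ≠ d + 1 by omega]
    have hr₁ : s₁.var r = s.var r := by simp [hs₁, show r ≠ d + 1 by omega]
    have hacc₃ : s₃.var (d + 1) = (Term.agg b x r t).eval s := by
      simp only [hs₃, Store.setVar_var, if_neg (show d + 1 ≠ x by omega), hacc, hr₁, Term.eval]
  · simp only [Expr.cost, hacc₃, Term.eval]
    exact bitLength_le (b.abs_eval_le_of_le (hs.toNat_le hr) fun i hi =>
      hv B _ (hs.setVar_nat hr x hi.le))
  · simpa [hs₃, hx₁, Store.setVar_self] using (hagree.setVar_setVar (s.var x)).setVar_right le_rfl _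
  · simp [Expr.eval, hacc₃]

end Term.RunsInPolyTime

theorem Term.runsInPolyTime {S : ℕ} (t : Term) (ht : t.wf S) : t.RunsInPolyTime S := by
  induction t with
  | const k => exact .const k
  | var x => exact .var (by simpa [Term.wf] using ht)
  | read a t ih => exact .read a ht (ih ht)
  | bin op t u iht ihu =>
    simp only [Term.wf, Bool.and_eq_true] at ht
    exact .bin op ht.1 ht.2 (iht ht.1) (ihu ht.2)
  | ite c t u ihc iht ihu =>
    simp only [Term.wf, Bool.and_eq_true] at ht
    exact .ite ht.1.1 ht.1.2 ht.2 (ihc ht.1.1) (iht ht.1.2) (ihu ht.2)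
  | agg b x r t ih =>
    simp only [Term.wf, Bool.and_eq_true, decide_eq_true_eq, bne_iff_ne] at ht
    exact .agg b ht.1.1.1 ht.1.1.2 ht.1.2 ht.2 (ih ht.2)

/-- In memories that agree with safe ones, the program for the statement takes time polynomial in
`B`, and outside the registers below `S` it only changes its scratch space. -/
def Stm.RunsInPolyTime (S : ℕ) (c : Stm) : Prop :=
  ∃ p : Polynomial ℕ, ∀ B s s' d, S ≤ d → c.Safe S B s → s.Agree S s' →
    (c.comp d).RunsWithin s' (p.eval B) fun s'' =>
      (c.eval s).Agree S s'' ∧ ∀ y, S ≤ y → y < d → s''.var y = s'.var y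

namespace Stm.RunsInPolyTime

variable {S : ℕ} {c c' : Stm} {t : Term}

theorem set {x : ℕ} (hx : x < S) (ht : t.wf S) : (Stm.set x t).RunsInPolyTime S := by
  obtain ⟨p, hp⟩ := t.runsInPolyTime ht
  obtain ⟨v, hv⟩ := t.exists_abs_eval_le ht
  refine ⟨p + v + 3, fun B s s' d hd hs hagree => ?_⟩
  have hbdd : s'.Bounded S B := hagree.bounded le_rfl hs.1
  refine .of_le ?_ ((hp B s' d hd hbdd).seq fun s'' ⟨hagree', hval⟩ =>
    .assign (k := v.eval B + 2) ?_ ⟨?_, fun y hy hyd => ?_⟩)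
  · simp only [Polynomial.eval_add, Polynomial.eval_ofNat]
    omega
  · simpa only [Expr.cost, hval] using bitLength_le (hv B s' hbdd)
  · rw [show (Expr.var d).eval s'' = t.eval s from hval.trans (t.eval_congr ht hagree)]
    exact (hagree.trans (hagree'.mono hd)).setVar x _
  · simp [show y ≠ x by omega, hagree'.2 y hyd]

theorem seq (h : c.RunsInPolyTime S) (h' : c'.RunsInPolyTime S) :
    (Stm.seq c c').RunsInPolyTime S := by
  obtain ⟨p, hp⟩ := h
  obtain ⟨p', hp'⟩ := h'
  refine ⟨p + p', fun B s s' d hd hs hagree => ?_⟩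
  rw [Polynomial.eval_add]
  exact (hp B s s' d hd hs.1 hagree).seq fun s₁ ⟨hagree₁, hsame⟩ =>
    (hp' B _ s₁ d hd hs.2 hagree₁).mono le_rfl fun s₂ ⟨hagree₂, hsame'⟩ =>
      ⟨hagree₂, fun y hy hyd => (hsame' y hy hyd).trans (hsame y hy hyd)⟩

/-- The invariant of the loop for a table: the first `i` cells are written. -/
def TabInv (S a x : ℕ) (t : Term) (s s' : Store) (d i : ℕ) (s'' : Store) : Prop :=
  ((s.setCells a i fun j => t.eval (s.setVar x j)).setVar x i).Agree S s'' ∧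
    ∀ y, S ≤ y → y < d → s''.var y = s'.var y

theorem tab_body {a x r d B T i : ℕ} {s s' s₁ : Store} (hx : x < S) (hr : r < S)
    (hd : S ≤ d) (ht : t.wf S) (hta : t.avoids a)
    (hT : ∀ s d, S ≤ d → s.Bounded S B →
      (t.comp d).RunsWithin s T fun s' => s.Agree d s' ∧ s'.var d = t.eval s)
    {v : Polynomial ℕ} (hv : ∀ s, s.Bounded S B → |t.eval s| ≤ 2 ^ v.eval B)
    (hs : (Stm.tab a x r t).Safe S B s) (hi : i < (s.var r).toNat)
    (hinv : TabInv S a x t s s' d i s₁) (hxi : s₁.var x = i) :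
    (Program.seq (t.comp (d + 1)) (.write a (.var x) (.var (d + 1)))).RunsWithin s₁
      (T + (v.eval B + B + 5)) fun s₂ =>
      (∀ y ∈ [d, x, r], s₂.var y = s₁.var y) ∧
        TabInv S a x t s s' d (i + 1) (s₂.setVar x (i + 1 : ℕ)) := by
  obtain ⟨hagree, hsame⟩ := hinv
  have hbdd : s₁.Bounded S B := hagree.bounded le_rfl <|
    (hs.1.of_setCells hs.2 (by omega)).setVar_nat hr x (by simpa using hi.le)
  refine (hT s₁ (d + 1) (by omega) hbdd).seq fun s₂ ⟨hagree', hval⟩ =>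
    ⟨_, _, .write a (.var x) (.var (d + 1)) s₂, ?_, ?_, ?_, ?_⟩
  all_goals
    have hxi' : (Expr.var x).eval s₂ = i := (hagree'.2 x (by omega)).trans hxi
    have hcell : (Expr.var (d + 1)).eval s₂ = t.eval (s.setVar x i) := by
      refine hval.trans ((t.eval_congr ht hagree).trans (t.eval_of_avoids hta rfl fun b hb => ?_))
      simp [Store.setCells_arr, hb, funext_iff]
  · have hcx : bitLength ((Expr.var x).eval s₂) ≤ B + 2 :=
      hxi' ▸ bitLength_le_of_abs_le (by have := hs.1.toNat_le hr; rw [Nat.abs_cast]; omega)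
    have hcv : bitLength ((Expr.var (d + 1)).eval s₂) ≤ v.eval B + 2 :=
      bitLength_le (by simpa only [Expr.eval, hval] using hv s₁ hbdd)
    simp only [Expr.cost, Expr.eval] at hcx hcv ⊢
    omega
  · simp [hagree'.2 d, hagree'.2 x (by omega), hagree'.2 r (by omega)]
  · rw [hxi', hcell, Store.setCells_succ]
    exact ((hagree.trans (hagree'.mono (by omega))).setArr a i _).setVar_setVar _
  · intro y hy hyd
    simp [show y ≠ x by omega, hagree'.2 y (by omega), hsame y hy hyd]

theorem tab (a : ℕ) {x r : ℕ} (hx : x < S) (hr : r < S) (hxr : x ≠ r) (ht : t.wf S)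
    (hta : t.avoids a) : (Stm.tab a x r t).RunsInPolyTime S := by
  obtain ⟨p, hp⟩ := t.runsInPolyTime ht
  obtain ⟨v, hv⟩ := t.exists_abs_eval_le ht
  refine ⟨(Polynomial.X + 1) * (p + v + 6 * Polynomial.X + 27), fun B s s' d hd hs hagree => ?_⟩
  have hbdd : s'.Bounded S B := hagree.bounded le_rfl hs.1
  have hx' : s'.var x = s.var x := hagree.2 x hx
  have hr' : s'.var r = s.var r := hagree.2 r hr
  refine .of_le ?_ ((Program.RunsWithin.forLoop hxr (by omega) (by omega) (hbdd.1 x hx)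
    (hbdd.1 r hr) (TabInv S a x t s s' d) ⟨?_, ?_⟩ fun i hi s₁ hs₁ =>
      tab_body hx hr hd ht hta (hp B) (hv B) hs (by rwa [hr'] at hi) hs₁).mono le_rfl
    fun s₂ ⟨s₁, ⟨hagree', hsame⟩, hs₂⟩ => ?_)
  · simp only [Polynomial.eval_add, Polynomial.eval_mul, Polynomial.eval_X, Polynomial.eval_one,
      Polynomial.eval_ofNat]
    ring_nf
    omega
  · simpa [Store.setCells_zero] using (hagree.setVar_right hd (s'.var x)).setVar x 0
  · intro y hy hyd
    simp [show y ≠ x by omega, show y ≠ d by omega]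
  · subst hs₂
    refine ⟨?_, fun y hy hyd => by simp [show y ≠ x by omega, hsame y hy hyd]⟩
    have h := hagree'.setVar_setVar (s'.var x)
    rw [hr', hx', Store.setCells_toNat] at h
    rw [hx']
    exact (Store.setVar_self ((Stm.tab a x r t).eval s) x) ▸ h

/-- The invariant of the loop for a repetition, which counts down in the register `d`. -/
def RepInv (S r : ℕ) (c : Stm) (s s' : Store) (d i : ℕ) (s'' : Store) : Prop :=
  (c.eval^[i] s).Agree S s'' ∧ (∀ y, S ≤ y → y < d → s''.var y = s'.var y) ∧
    s''.var d = s.var r - i ∧ i ≤ (s.var r).toNat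

theorem rep_body {r d B T i : ℕ} {s s' s₁ : Store} (hd : S ≤ d) (hrB : |s.var r| ≤ B)
    (hT : ∀ s s' d, S ≤ d → c.Safe S B s → s.Agree S s' →
      (c.comp d).RunsWithin s' T fun s'' =>
        (c.eval s).Agree S s'' ∧ ∀ y, S ≤ y → y < d → s''.var y = s'.var y)
    (hsafe : c.Safe S B (c.eval^[i] s)) (hi : i < (s.var r).toNat)
    (hinv : RepInv S r c s s' d i s₁) :
    (Program.seq (c.comp (d + 1)) (.assign d (.sub (.var d) (.const 1)))).RunsWithin s₁
      (T + (2 * B + 6 + 1)) (RepInv S r c s s' d (i + 1)) := by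
  obtain ⟨hagree₁, hsame₁, hd₁, -⟩ := hinv
  refine (hT _ s₁ (d + 1) (by omega) hsafe hagree₁).seq fun s₂ ⟨hagree₂, hsame₂⟩ => ?_
  have hd₂ : s₂.var d = s.var r - i := by rw [hsame₂ d hd (by omega), hd₁]
  refine .assign ?_ ⟨?_, fun y hy hyd => ?_, ?_, hi⟩
  · have hcost : bitLength (s.var r - i) ≤ B + 2 :=
      bitLength_le_of_abs_le (by rw [abs_le] at hrB ⊢; omega)
    have hcost' : bitLength (s.var r - i - 1) ≤ B + 2 :=
      bitLength_le_of_abs_le (by rw [abs_le] at hrB ⊢; omega)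
    simp only [Expr.cost, Expr.eval, hd₂, bitLength_one]
    omega
  · rw [Function.iterate_succ_apply']
    exact hagree₂.setVar_right hd _
  · simp [show y ≠ d by omega, hsame₂ y hy (by omega), hsame₁ y hy hyd]
  · simp [Expr.eval, hd₂, sub_sub]

theorem rep {r : ℕ} (hr : r < S) (h : c.RunsInPolyTime S) : (Stm.rep r c).RunsInPolyTime S := by
  obtain ⟨p, hp⟩ := h
  refine ⟨(Polynomial.X + 1) * (p + 3 * Polynomial.X + 13), fun B s s' d hd hs hagree => ?_⟩
  obtain ⟨hbdd, hsafe⟩ := hs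
  have hr' : s'.var r = s.var r := hagree.2 r hr
  have hrB : |s.var r| ≤ B := hbdd.1 r hr
  refine .of_le ?_ (.seq (.assign_eq (k := B + 2) ?_) fun s₁ hs₁ =>
    (Program.RunsWithin.loop (RepInv S r c s s' d) (n := (s.var r).toNat) (k := B + 2) ?_ ?_ ?_ ?_
      fun i hi s₁ hs₁ => rep_body hd hrB (hp B) (hsafe i hi) hi hs₁).mono le_rfl
        fun s₂ ⟨hagree₂, hsame₂, _⟩ => ⟨hagree₂, hsame₂⟩)
  · have : ((s.var r).toNat + 1) * (B + 2 + (p.eval B + (2 * B + 6 + 1)) + 1) ≤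
        (B + 1) * (p.eval B + 3 * B + 10) :=
      Nat.mul_le_mul (by have := hbdd.toNat_le hr; omega) (by omega)
    simp only [Polynomial.eval_add, Polynomial.eval_mul, Polynomial.eval_X, Polynomial.eval_one,
      Polynomial.eval_ofNat]
    linarith
  · simpa only [Expr.cost, hr'] using bitLength_le_of_abs_le hrB
  · subst hs₁
    exact ⟨hagree.setVar_right hd _, fun y _ hyd => by simp [show y ≠ d by omega],
      by simp [Expr.eval, hr'], Nat.zero_le _⟩
  · rintro i s₂ ⟨-, -, hd₂, hi⟩
    simpa only [Expr.cost, hd₂] using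
      bitLength_le_of_abs_le (B := B) (by rw [abs_le] at hrB ⊢; omega)
  · rintro i s₂ ⟨-, -, hd₂, hi⟩
    simp only [Expr.eval, hd₂]
    omega
  · exact fun i s₂ h => h.2.2.2

end Stm.RunsInPolyTime

theorem Stm.runsInPolyTime {S : ℕ} (c : Stm) (hc : c.wf S) : c.RunsInPolyTime S := by
  induction c with
  | set x t =>
    simp only [Stm.wf, Bool.and_eq_true, decide_eq_true_eq] at hc
    exact .set hc.1 hc.2
  | tab a x r t =>
    simp only [Stm.wf, Bool.and_eq_true, decide_eq_true_eq, bne_iff_ne] at hc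
    obtain ⟨⟨⟨⟨hx, hr⟩, hxr⟩, ht⟩, hta⟩ := hc
    exact .tab a hx hr hxr ht hta
  | seq c d ihc ihd =>
    simp only [Stm.wf, Bool.and_eq_true] at hc
    exact .seq (ihc hc.1) (ihd hc.2)
  | rep r c ih =>
    simp only [Stm.wf, Bool.and_eq_true, decide_eq_true_eq] at hc
    exact .rep hc.1 (ih hc.2)

/-! ### Fractional hitting sets by doubling weights -/

/-- A hitting set problem: sets with indices below `M` of elements below `N`; only the active sets
have to be hit. -/
structure HitProblem where
  N : ℕ
  M : ℕ
  act : ℕ → Prop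
  mem : ℕ → ℕ → Prop

namespace HitProblem

/-- A set of elements that hits all active sets. -/
structure IsHittingSet (X : HitProblem) (H : Finset ℕ) : Prop where
  subset : H ⊆ Finset.range X.N
  exists_mem : ∀ c < X.M, X.act c → ∃ u ∈ H, X.mem c u

open Classical in
/-- The weight of a set. -/
noncomputable def weight (X : HitProblem) (w : ℕ → ℤ) (c : ℕ) : ℤ :=
  ∑ u ∈ Finset.range X.N, if X.mem c u then w u else 0

/-- The total weight of all elements. -/
def total (X : HitProblem) (w : ℕ → ℤ) : ℤ := ∑ u ∈ Finset.range X.N, w u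

/-- An active set that has less than a `1 / (4 K)` fraction of the total weight. -/
def Light (X : HitProblem) (K : ℤ) (w : ℕ → ℤ) (c : ℕ) : Prop :=
  X.act c ∧ 4 * K * X.weight w c < X.total w

/-- No set is light: the weights, scaled to total `4 K`, are a fractional hitting set. -/
def Good (X : HitProblem) (K : ℤ) (w : ℕ → ℤ) : Prop := ∀ c < X.M, ¬ X.Light K w c

/-- The first light set. -/
def First (X : HitProblem) (K : ℤ) (w : ℕ → ℤ) (c : ℕ) : Prop :=
  X.Light K w c ∧ ∀ c' < c, ¬ X.Light K w c'

open Classical in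
/-- Double the weights of the elements of the first light set. The sum has at most one nonzero
summand; it is the form in which programs evaluate the new weights. -/
noncomputable def step (X : HitProblem) (K : ℤ) (w : ℕ → ℤ) (u : ℕ) : ℤ :=
  w u * (1 + ∑ c ∈ Finset.range X.M, if X.First K w c then if X.mem c u then 1 else 0 else 0)

/-- The weights after `i` doublings, from unit weights on. -/
noncomputable def weights (X : HitProblem) (K : ℤ) (i : ℕ) : ℕ → ℤ := (X.step K)^[i] fun _ => 1

/-- The number of doublings. -/
def rounds (X : HitProblem) : ℕ := 2 * X.N * X.N + 1

open Classical in
/-- Pass on to the next guess `K` of the size of a hitting set if there is a light set. -/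
noncomputable def advance (X : HitProblem) (z : ℤ × (ℕ → ℤ)) : ℤ × (ℕ → ℤ) :=
  if X.Good z.1 z.2 then z else (z.1 + 1, X.weights (z.1 + 1) X.rounds)

variable {X : HitProblem} {K : ℤ} {w : ℕ → ℤ} {H : Finset ℕ} {i j : ℕ}

theorem IsHittingSet.card_le (hH : X.IsHittingSet H) : H.card ≤ X.N := by
  simpa using Finset.card_le_card hH.subset

theorem step_of_good (h : X.Good K w) : X.step K w = w := by
  funext u
  have hnone : ∀ c ∈ Finset.range X.M, ¬ X.First K w c :=
    fun c hc hf => h c (Finset.mem_range.1 hc) hf.1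
  rw [step, Finset.sum_eq_zero fun c hc => if_neg (hnone c hc)]
  ring

open Classical in
theorem step_of_first {c : ℕ} (hc : c < X.M) (h : X.First K w c) (u : ℕ) :
    X.step K w u = if X.mem c u then 2 * w u else w u := by
  have hunique (c' : ℕ) : X.First K w c' ↔ c' = c := by
    refine ⟨fun h' => le_antisymm ?_ ?_, fun heq => heq ▸ h⟩
    · exact not_lt.1 fun hlt => h'.2 c hlt h.1
    · exact not_lt.1 fun hlt => h.2 c' hlt h'.1
  simp only [step, hunique, Finset.sum_ite_eq', if_pos (Finset.mem_range.2 hc)]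
  split_ifs <;> ring

theorem exists_first_of_not_good (h : ¬ X.Good K w) : ∃ c < X.M, X.First K w c := by
  classical
  have hex : ∃ c, c < X.M ∧ X.Light K w c := by simpa [Good] using h
  obtain ⟨hlt, hlight⟩ := Nat.find_spec hex
  exact ⟨Nat.find hex, hlt, hlight, fun c' hc' hl => Nat.find_min hex hc' ⟨hc'.trans hlt, hl⟩⟩

theorem step_bounds (hw : ∀ u, 1 ≤ w u) (u : ℕ) : w u ≤ X.step K w u ∧ X.step K w u ≤ 2 * w u := by
  have hu := hw u
  by_cases h : X.Good K w
  · rw [step_of_good h]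
    constructor <;> linarith
  · obtain ⟨c, hc, hfirst⟩ := exists_first_of_not_good h
    rw [step_of_first hc hfirst]
    split_ifs <;> constructor <;> linarith

theorem total_step_of_not_good (h : ¬ X.Good K w) :
    4 * K * X.total (X.step K w) ≤ (4 * K + 1) * X.total w := by
  obtain ⟨c, hc, hfirst⟩ := exists_first_of_not_good h
  have htotal : X.total (X.step K w) = X.total w + X.weight w c := by
    rw [total, total, weight, ← Finset.sum_add_distrib]
    refine Finset.sum_congr rfl fun u _ => ?_
    rw [step_of_first hc hfirst]
    split_ifs <;> ring
  rw [htotal]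
  linarith [hfirst.1.2]

theorem prod_step_of_not_good (hw : ∀ u, 1 ≤ w u) (hH : X.IsHittingSet H) (h : ¬ X.Good K w) :
    2 * ∏ u ∈ H, w u ≤ ∏ u ∈ H, X.step K w u := by
  classical
  obtain ⟨c, hc, hfirst⟩ := exists_first_of_not_good h
  obtain ⟨u, hu, hcu⟩ := hH.exists_mem c hc hfirst.1.1
  rw [← Finset.mul_prod_erase H _ hu, ← Finset.mul_prod_erase H _ hu, step_of_first hc hfirst u,
    if_pos hcu, ← mul_assoc]
  refine mul_le_mul_of_nonneg_left ?_ (by linarith [hw u])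
  exact Finset.prod_le_prod (fun v _ => by linarith [hw v]) fun v _ => (step_bounds hw v).1

theorem weights_succ (X : HitProblem) (K : ℤ) (i : ℕ) :
    X.weights K (i + 1) = X.step K (X.weights K i) :=
  Function.iterate_succ_apply' ..

theorem weights_bounds (i u : ℕ) : 1 ≤ X.weights K i u ∧ X.weights K i u ≤ 2 ^ i := by
  induction i generalizing u with
  | zero => simp [weights]
  | succ i ih =>
    have hstep := step_bounds (X := X) (K := K) (fun v => (ih v).1) u
    have hu := ih u
    rw [weights_succ, pow_succ]
    constructor <;> linarith

theorem Good.weights_of_le (h : X.Good K (X.weights K i)) (hij : i ≤ j) :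
    X.Good K (X.weights K j) := by
  induction j, hij using Nat.le_induction with
  | base => exact h
  | succ j _ ih => rwa [weights_succ, step_of_good ih]

theorem two_pow_le_prod_weights (hH : X.IsHittingSet H) (h : ∀ j < i, ¬ X.Good K (X.weights K j)) :
    2 ^ i ≤ ∏ u ∈ H, X.weights K i u := by
  induction i with
  | zero => simp [weights]
  | succ i ih =>
    have hstep := prod_step_of_not_good (fun u => (weights_bounds i u).1) hH (h i i.lt_succ_self)
    rw [weights_succ, pow_succ]
    linarith [ih fun j hj => h j (by omega)]

theorem pow_mul_total_weights_le (hK : 0 ≤ K) (h : ∀ j < i, ¬ X.Good K (X.weights K j)) :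
    (4 * K) ^ i * X.total (X.weights K i) ≤ (4 * K + 1) ^ i * X.N := by
  induction i with
  | zero => simp [weights, total]
  | succ i ih =>
    rw [weights_succ, pow_succ, pow_succ]
    calc (4 * K) ^ i * (4 * K) * X.total (X.step K (X.weights K i))
        = (4 * K) ^ i * (4 * K * X.total (X.step K (X.weights K i))) := by ring
      _ ≤ (4 * K) ^ i * ((4 * K + 1) * X.total (X.weights K i)) :=
        mul_le_mul_of_nonneg_left (total_step_of_not_good (h i i.lt_succ_self)) (by positivity)
      _ = (4 * K + 1) * ((4 * K) ^ i * X.total (X.weights K i)) := by ring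
      _ ≤ (4 * K + 1) * ((4 * K + 1) ^ i * X.N) :=
        mul_le_mul_of_nonneg_left (ih fun j hj => h j (by omega)) (by positivity)
      _ = (4 * K + 1) ^ i * (4 * K + 1) * X.N := by ring

theorem prod_le_total_pow (hw : ∀ u, 0 ≤ w u) (hH : H ⊆ Finset.range X.N) :
    ∏ u ∈ H, w u ≤ X.total w ^ H.card := by
  rw [← Finset.prod_const]
  exact Finset.prod_le_prod (fun u _ => hw u) fun u hu =>
    Finset.single_le_sum (fun v _ => hw v) (hH hu)

end HitProblem

theorem le_exp_pow_mul_of_pow_mul_le {K W N : ℝ} {T : ℕ} (hK : 0 < K) (hN : 0 ≤ N)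
    (h : K ^ T * W ≤ (K + 1) ^ T * N) : W ≤ Real.exp (1 / K) ^ T * N := by
  have hexp : K + 1 ≤ K * Real.exp (1 / K) := by
    calc K + 1 = K * (1 / K + 1) := by field_simp; ring
      _ ≤ K * Real.exp (1 / K) := by gcongr; exact Real.add_one_le_exp _
  refine le_of_mul_le_mul_left (a := K ^ T) ?_ (by positivity)
  calc K ^ T * W ≤ (K + 1) ^ T * N := h
    _ ≤ (K * Real.exp (1 / K)) ^ T * N := by gcongr
    _ = K ^ T * (Real.exp (1 / K) ^ T * N) := by rw [mul_pow, mul_assoc]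

/-- This uses `(1 + 1 / (4 K)) ^ (4 K) ≤ e ≤ 4`. -/
theorem two_pow_le_pow_of_le_pow {K N T : ℕ} {W : ℝ} (hK : 0 < K) (hW : 0 ≤ W)
    (h : 2 ^ T ≤ W ^ K) (h' : (4 * K) ^ T * W ≤ (4 * K + 1) ^ T * N) :
    2 ^ (2 * T) ≤ N ^ (4 * K) := by
  have hWN : W ≤ Real.exp (1 / (4 * K)) ^ T * N :=
    le_exp_pow_mul_of_pow_mul_le (by positivity) (by positivity) h'
  have hle : (4 : ℝ) ^ T * 2 ^ (2 * T) ≤ 4 ^ T * (N : ℝ) ^ (4 * K) := by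
    calc (4 : ℝ) ^ T * 2 ^ (2 * T) = (2 ^ T) ^ 4 := by
          rw [show (4 : ℝ) = 2 ^ 2 by norm_num, ← pow_mul, ← pow_mul, ← pow_add]
          congr 1
          ring
      _ ≤ (W ^ K) ^ 4 := by gcongr
      _ = W ^ (4 * K) := by rw [← pow_mul, mul_comm]
      _ ≤ (Real.exp (1 / (4 * K)) ^ T * N) ^ (4 * K) := by gcongr
      _ = (Real.exp (1 / (4 * K)) ^ (4 * K)) ^ T * (N : ℝ) ^ (4 * K) := by
        rw [mul_pow, ← pow_mul, ← pow_mul, mul_comm T]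
      _ = Real.exp 1 ^ T * (N : ℝ) ^ (4 * K) := by
        rw [← Real.exp_nat_mul]
        congr 3
        push_cast
        field_simp
      _ ≤ 4 ^ T * (N : ℝ) ^ (4 * K) := by
        gcongr
        linarith [Real.exp_one_lt_d9]
  exact_mod_cast le_of_mul_le_mul_left hle (by positivity)

namespace HitProblem

variable {X : HitProblem} {H : Finset ℕ}

/-- Each doubling multiplies the product of the weights over `H` by at least `2`, but the total
weight by at most `1 + 1 / (4 K)`. -/
theorem good_weights_card (hH : X.IsHittingSet H) :
    X.Good H.card (X.weights H.card X.rounds) := by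
  by_contra hbad
  have hall : ∀ i < X.rounds, ¬ X.Good H.card (X.weights H.card i) :=
    fun i hi hgood => hbad (hgood.weights_of_le hi.le)
  have hpos : 0 < H.card := by
    obtain ⟨c, hc, hfirst⟩ := exists_first_of_not_good hbad
    obtain ⟨u, hu, -⟩ := hH.exists_mem c hc hfirst.1.1
    exact Finset.card_pos.2 ⟨u, hu⟩
  have hnonneg (u : ℕ) : 0 ≤ X.weights H.card X.rounds u :=
    zero_le_one.trans (weights_bounds _ u).1
  have hprod := (two_pow_le_prod_weights hH hall).trans (prod_le_total_pow hnonneg hH.subset)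
  have htotal := pow_mul_total_weights_le (by positivity) hall
  have hpow : 2 ^ (2 * X.rounds) ≤ X.N ^ (4 * H.card) :=
    two_pow_le_pow_of_le_pow (W := X.total (X.weights H.card X.rounds)) hpos
      (by exact_mod_cast Finset.sum_nonneg fun u _ => hnonneg u) (by exact_mod_cast hprod)
      (by exact_mod_cast htotal)
  have hexp : 2 * X.rounds ≤ X.N * (4 * X.N) := by
    refine (Nat.pow_le_pow_iff_right one_lt_two).1 (hpow.trans ?_)
    calc X.N ^ (4 * H.card) ≤ (2 ^ X.N) ^ (4 * H.card) := by
          gcongr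
          exact Nat.lt_two_pow_self.le
      _ = 2 ^ (X.N * (4 * H.card)) := (pow_mul _ _ _).symm
      _ ≤ 2 ^ (X.N * (4 * X.N)) := by
        gcongr
        exacts [one_le_two, hH.card_le]
  rw [rounds] at hexp
  nlinarith

theorem good_advance_or (hH : X.IsHittingSet H) (i : ℕ) :
    let z := X.advance^[i] (0, fun _ => 1)
    (0 ≤ z.1 ∧ z.1 ≤ H.card) ∧ (X.Good z.1 z.2 ∨ (z.1 = i ∧ i < H.card)) := by
  induction i with
  | zero =>
    refine ⟨by simp, ?_⟩
    rcases H.card.eq_zero_or_pos with h | h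
    · refine Or.inl fun c hc hlight => ?_
      obtain ⟨u, hu, -⟩ := hH.exists_mem c hc hlight.1
      simp [Finset.card_eq_zero.1 h] at hu
    · exact Or.inr ⟨rfl, h⟩
  | succ i ih =>
    rw [Function.iterate_succ_apply']
    generalize X.advance^[i] (0, fun _ => 1) = z at ih
    obtain ⟨hz, hgood⟩ := ih
    by_cases hg : X.Good z.1 z.2
    · simp only [advance, if_pos hg]
      exact ⟨hz, Or.inl hg⟩
    · obtain ⟨hzi, hi⟩ := hgood.resolve_left hg
      simp only [advance, if_neg hg, hzi]
      refine ⟨⟨by positivity, by exact_mod_cast hi⟩, ?_⟩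
      rcases (show i + 1 ≤ H.card from hi).lt_or_eq with hlt | heq
      · exact Or.inr ⟨by simp, hlt⟩
      · left
        rw [show (i : ℤ) + 1 = H.card by exact_mod_cast heq]
        exact good_weights_card hH

theorem good_iterate_advance (hH : X.IsHittingSet H) :
    let z := X.advance^[X.N + 1] (0, fun _ => 1)
    X.Good z.1 z.2 ∧ 0 ≤ z.1 ∧ z.1 ≤ H.card := by
  obtain ⟨hz, hgood⟩ := good_advance_or hH (X.N + 1)
  refine ⟨hgood.resolve_right ?_, hz⟩
  rintro ⟨-, hlt⟩
  have := hH.card_le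
  omega

theorem iterate_advance_bounds (i : ℕ) :
    let z := X.advance^[i] (0, fun _ => 1)
    0 ≤ z.1 ∧ z.1 ≤ i ∧ ∀ u, 1 ≤ z.2 u ∧ z.2 u ≤ 2 ^ X.rounds := by
  induction i with
  | zero => simp [one_le_pow₀]
  | succ i ih =>
    rw [Function.iterate_succ_apply']
    obtain ⟨h₀, h₁, hw⟩ := ih
    simp only [advance]
    split_ifs
    · exact ⟨h₀, by push_cast; linarith, hw⟩
    · exact ⟨by simp only; linarith, by push_cast; linarith, fun u => weights_bounds _ u⟩

end HitProblem

/-! ### Nets for intervals -/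

theorem card_filter_lt_succ_le {f : ℕ → ℤ} (hf : Monotone f) (m : ℕ) :
    (((Finset.range m).filter fun u => f u < f (u + 1)).card : ℤ) ≤ f m - f 0 := by
  rw [Finset.card_filter, ← Finset.sum_range_sub]
  push_cast
  refine Finset.sum_le_sum fun u _ => ?_
  have : f u ≤ f (u + 1) := hf u.le_succ
  split_ifs <;> omega

theorem exists_lt_succ_of_lt {f : ℕ → ℤ} {l r : ℕ} (hlr : l ≤ r) (h : f l < f r) :
    ∃ u, l ≤ u ∧ u < r ∧ f u < f (u + 1) := by
  by_contra! hno
  suffices ∀ m, l ≤ m → m ≤ r → f m ≤ f l from (this r hlr le_rfl).not_gt h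
  intro m hlm
  induction m, hlm using Nat.le_induction with
  | base => exact fun _ => le_rfl
  | succ m hlm ih => exact fun hm => (hno m hlm hm).trans (ih (by omega))

/-- The weight of the first `u` of `N` elements, scaled to total weight `8 K` and rounded. -/
def scaledWeight (N : ℕ) (K : ℤ) (w : ℕ → ℤ) (u : ℕ) : ℤ :=
  8 * K * (∑ v ∈ Finset.range u, w v) / (∑ v ∈ Finset.range N, w v)

/-- The scaled weight grows at `u`. The elements with this property form a net: they meet every
interval with at least a `1 / (8 K)` fraction of the total weight. -/
def Jump (N : ℕ) (K : ℤ) (w : ℕ → ℤ) (u : ℕ) : Prop :=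
  scaledWeight N K w u < scaledWeight N K w (u + 1)

variable {N : ℕ} {K : ℤ} {w : ℕ → ℤ}

theorem scaledWeight_mono (hK : 0 ≤ K) (hw : ∀ u, 0 ≤ w u) : Monotone (scaledWeight N K w) := by
  refine monotone_nat_of_le_succ fun u => ?_
  rcases (Finset.sum_nonneg fun v _ => hw v : 0 ≤ ∑ v ∈ Finset.range N, w v).eq_or_lt with h | h
  · simp [scaledWeight, ← h]
  · refine Int.ediv_le_ediv h (mul_le_mul_of_nonneg_left ?_ (by positivity))
    rw [Finset.sum_range_succ]
    linarith [hw u]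

open Classical in
theorem card_jumps_le (hK : 0 ≤ K) (hw : ∀ u, 0 ≤ w u) :
    (((Finset.range N).filter (Jump N K w)).card : ℤ) ≤ 8 * K := by
  have hcard : (((Finset.range N).filter (Jump N K w)).card : ℤ)
      ≤ scaledWeight N K w N - scaledWeight N K w 0 := by
    convert card_filter_lt_succ_le (scaledWeight_mono hK hw) N
    rfl
  refine hcard.trans ?_
  by_cases h : ∑ v ∈ Finset.range N, w v = 0
  · simpa [scaledWeight, h] using hK
  · simp [scaledWeight, h]

theorem exists_jump {l r : ℕ} (hW : 0 < ∑ v ∈ Finset.range N, w v)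
    (h : ∑ v ∈ Finset.range N, w v ≤ 8 * K * ∑ v ∈ Finset.Ico l r, w v) :
    ∃ u, l ≤ u ∧ u < r ∧ Jump N K w u := by
  have hlr : l ≤ r := by
    by_contra! hlt
    simp [Finset.Ico_eq_empty_of_le hlt.le, hW.not_ge] at h
  refine exists_lt_succ_of_lt hlr ?_
  rw [Finset.sum_Ico_eq_sub _ hlr] at h
  calc scaledWeight N K w l < scaledWeight N K w l + 1 := lt_add_one _
    _ = (8 * K * ∑ v ∈ Finset.range l, w v + ∑ v ∈ Finset.range N, w v)
          / ∑ v ∈ Finset.range N, w v := by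
      rw [scaledWeight, Int.add_ediv_of_dvd_right dvd_rfl, Int.ediv_self hW.ne']
    _ ≤ scaledWeight N K w r := Int.ediv_le_ediv hW (by linarith)

theorem exists_threshold {f g : ℕ → ℤ} {W : ℤ} {b : ℕ} (h : ∀ h₀ ≤ b + 1, 2 * W ≤ f h₀ + g h₀)
    (hW : 0 < W) (hf : f 0 = 0) (hg : g (b + 1) = 0) : ∃ h₀ ≤ b, W ≤ f (h₀ + 1) ∧ W ≤ g h₀ := by
  classical
  have hlast : W ≤ f (b + 1) := by linarith [h (b + 1) le_rfl]
  have hex : ∃ h₀, W ≤ f (h₀ + 1) := ⟨b, hlast⟩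
  have hle : Nat.find hex ≤ b := Nat.find_min' hex hlast
  have hlight : f (Nat.find hex) < W := by
    rcases Nat.eq_zero_or_pos (Nat.find hex) with hzero | hpos
    · rwa [hzero, hf]
    · have := Nat.find_min hex (Nat.sub_lt hpos one_pos)
      rwa [show Nat.find hex - 1 + 1 = Nat.find hex by omega, not_le] at this
  exact ⟨_, hle, Nat.find_spec hex, by linarith [h _ (hle.trans b.le_succ)]⟩

theorem sum_range_two_parts_le (hw : ∀ u, 0 ≤ w u) (a b c d : ℕ) :
    ∑ u ∈ Finset.range N, (if (a ≤ u ∧ u < b) ∨ (c ≤ u ∧ u ≤ d) then w u else 0)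
      ≤ ∑ u ∈ Finset.Ico a b, w u + ∑ u ∈ Finset.Ico c (d + 1), w u := by
  rw [← Finset.sum_filter, ← Finset.sum_union_inter]
  refine le_add_of_le_of_nonneg ?_ (Finset.sum_nonneg fun u _ => hw u)
  refine Finset.sum_le_sum_of_subset_of_nonneg (fun u hu => ?_) fun u _ _ => hw u
  simp only [Finset.mem_filter, Finset.mem_union, Finset.mem_Ico] at hu ⊢
  omega

/-- At some threshold `h₀` both parts are heavy, so that both contain a jump. -/
theorem exists_jump_pair {n A B a b : ℕ} (hw : ∀ u, 1 ≤ w u) (hK : 0 ≤ K) (hN : 0 < N) (hb : b < n)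
    (h : ∀ h₀ ≤ n, ∑ v ∈ Finset.range N, w v ≤ 4 * K * ∑ u ∈ Finset.range N,
      if (A + a ≤ u ∧ u < A + h₀) ∨ (B + h₀ ≤ u ∧ u ≤ B + b) then w u else 0) :
    ∃ v v', a ≤ v ∧ v ≤ v' ∧ v' ≤ b ∧ Jump N K w (A + v) ∧ Jump N K w (B + v') := by
  have hw₀ (u : ℕ) : 0 ≤ w u := zero_le_one.trans (hw u)
  have hW : 0 < ∑ v ∈ Finset.range N, w v :=
    Finset.sum_pos (fun u _ => hw u) ⟨0, Finset.mem_range.2 hN⟩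
  obtain ⟨h₀, -, hleft, hright⟩ := exists_threshold (b := b)
    (f := fun h₀ => 8 * K * ∑ u ∈ Finset.Ico (A + a) (A + h₀), w u)
    (g := fun h₀ => 8 * K * ∑ u ∈ Finset.Ico (B + h₀) (B + b + 1), w u)
    (fun h₀ hh => by
      have := mul_le_mul_of_nonneg_left
        (sum_range_two_parts_le (N := N) hw₀ (A + a) (A + h₀) (B + h₀) (B + b)) hK
      linarith [h h₀ (by omega)]) hW (by simp) (by simp [add_assoc])
  obtain ⟨u, hau, huh, hu⟩ := exists_jump hW hleft
  obtain ⟨u', hhu', hub', hu'⟩ := exists_jump hW hright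
  refine ⟨u - A, u' - B, by omega, by omega, by omega, ?_, ?_⟩
  · rwa [Nat.add_sub_cancel' (by omega)]
  · rwa [Nat.add_sub_cancel' (by omega)]

/-! ### Monotone paths -/

theorem monotoneOn_of_sum_abs_le {f : ℕ → ℝ} {K : ℕ}
    (h : ∑ i ∈ Finset.range K, |f i - f (i + 1)| ≤ |f 0 - f K|) (h₀ : f 0 ≤ f K) :
    MonotoneOn f (Set.Iic K) := by
  have hsum : ∑ i ∈ Finset.range K, (|f i - f (i + 1)| - (f (i + 1) - f i)) ≤ 0 := by
    rw [Finset.sum_sub_distrib, Finset.sum_range_sub]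
    rw [abs_of_nonpos (sub_nonpos.2 h₀)] at h
    linarith
  have hnonneg : ∀ i ∈ Finset.range K, 0 ≤ |f i - f (i + 1)| - (f (i + 1) - f i) :=
    fun i _ => by linarith [neg_abs_le (f i - f (i + 1))]
  have hzero :=
    (Finset.sum_eq_zero_iff_of_nonneg hnonneg).1 (hsum.antisymm (Finset.sum_nonneg hnonneg))
  have hsucc : ∀ i < K, f i ≤ f (i + 1) := fun i hi => by
    linarith [hzero i (Finset.mem_range.2 hi), abs_nonneg (f i - f (i + 1))]
  intro i _ j hj hij
  induction j, hij using Nat.le_induction with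
  | base => exact le_rfl
  | succ j _ ih => exact (ih (Nat.le_of_succ_le hj)).trans (hsucc j hj)

theorem antitoneOn_of_sum_abs_le {f : ℕ → ℝ} {K : ℕ}
    (h : ∑ i ∈ Finset.range K, |f i - f (i + 1)| ≤ |f 0 - f K|) (h₀ : f K ≤ f 0) :
    AntitoneOn f (Set.Iic K) := by
  have hneg : MonotoneOn (fun i => -f i) (Set.Iic K) :=
    monotoneOn_of_sum_abs_le (by simpa only [neg_sub_neg, abs_sub_comm] using h) (neg_le_neg h₀)
  exact fun i hi j hj hij => neg_le_neg_iff.1 (hneg hi hj hij)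

theorem le_le_le_of_sum_abs_le {f : ℕ → ℝ} {K i j : ℕ}
    (h : ∑ i ∈ Finset.range K, |f i - f (i + 1)| ≤ |f 0 - f K|) (hij : i ≤ j) (hj : j ≤ K) :
    (f 0 ≤ f K ∧ f 0 ≤ f i ∧ f i ≤ f j ∧ f j ≤ f K) ∨
      (f K ≤ f 0 ∧ f K ≤ f j ∧ f j ≤ f i ∧ f i ≤ f 0) := by
  have h₀ : 0 ∈ Set.Iic K := Nat.zero_le K
  have hK : K ∈ Set.Iic K := le_refl K
  rcases le_total (f 0) (f K) with hle | hle
  · have hmono := monotoneOn_of_sum_abs_le h hle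
    exact Or.inl ⟨hle, hmono h₀ (hij.trans hj) i.zero_le, hmono (hij.trans hj) hj hij,
      hmono hj hK hj⟩
  · have hanti := antitoneOn_of_sum_abs_le h hle
    exact Or.inr ⟨hle, hanti hj hK hj, hanti (hij.trans hj) hj hij,
      hanti h₀ (hij.trans hj) i.zero_le⟩

theorem sum_abs_sub_le_of_l1Dist {x : ℕ → ℝ × ℝ} {K : ℕ}
    (h : ∑ i ∈ Finset.range K, l1Dist (x i) (x (i + 1)) = l1Dist (x 0) (x K)) :
    ∑ i ∈ Finset.range K, |(x i).1 - (x (i + 1)).1| ≤ |(x 0).1 - (x K).1| ∧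
      ∑ i ∈ Finset.range K, |(x i).2 - (x (i + 1)).2| ≤ |(x 0).2 - (x K).2| := by
  have hfst := dist_le_range_sum_dist (fun i => (x i).1) K
  have hsnd := dist_le_range_sum_dist (fun i => (x i).2) K
  simp only [Real.dist_eq] at hfst hsnd
  simp only [l1Dist, Finset.sum_add_distrib] at h
  constructor <;> linarith

theorem l1Dist_comm (a b : ℝ × ℝ) : l1Dist a b = l1Dist b a := by
  simp only [l1Dist, abs_sub_comm]

theorem MConnected.symm {S : Set (ℝ × ℝ)} {p q : ℝ × ℝ} (h : MConnected S p q) :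
    MConnected S q p := by
  obtain ⟨k, x, hp, hq, hS, haligned, hlength⟩ := h
  refine ⟨k, fun i => x (k - i), by simpa using hq, by simpa using hp,
    fun i _ => hS _ (Nat.sub_le _ _), fun i hi => ?_, ?_⟩
  · have := haligned (k - (i + 1)) (by omega)
    rw [show k - (i + 1) + 1 = k - i by omega] at this
    exact this.imp Eq.symm Eq.symm
  · rw [l1Dist_comm q p, ← hlength, ← Finset.sum_range_reflect]
    refine Finset.sum_congr rfl fun i hi => ?_
    rw [Finset.mem_range] at hi
    beta_reduce
    rw [l1Dist_comm, show k - (k - 1 - i) = i + 1 by omega, show k - (k - 1 - i + 1) = i by omega]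

/-! ### Strips of the levels of a tree -/

/-- The strip of level `l` of the rank `r`, in the tree of degree `2 ^ k` over the ranks. -/
def strip (k l r : ℕ) : ℕ := r / 2 ^ (k * l)

theorem strip_mono (k l : ℕ) : Monotone (strip k l) := fun _ _ h => Nat.div_le_div_right h

theorem strip_le (k l r : ℕ) : strip k l r ≤ r := Nat.div_le_self _ _

theorem strip_eq_of_le {k l l' r r' : ℕ} (hl : l ≤ l') (h : strip k l r = strip k l r') :
    strip k l' r = strip k l' r' := by
  obtain ⟨m, rfl⟩ := Nat.exists_eq_add_of_le hl
  unfold strip at *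
  rw [mul_add, pow_add, ← Nat.div_div_eq_div_mul, ← Nat.div_div_eq_div_mul, h]

theorem strip_eq_of_between {ρ : ℝ → ℕ} (hρ : Monotone ρ) {k l : ℕ} {ε a b c : ℝ} (hε : ε ≠ 0)
    (hab : ε * a ≤ ε * b) (hbc : ε * b ≤ ε * c) (h : strip k l (ρ a) = strip k l (ρ c)) :
    strip k l (ρ b) = strip k l (ρ a) := by
  have hmono : Monotone fun x => strip k l (ρ x) := (strip_mono k l).comp hρ
  rcases hε.lt_or_gt with hneg | hpos
  · exact le_antisymm (hmono ((mul_le_mul_left_of_neg hneg).1 hab))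
      (h.trans_le (hmono ((mul_le_mul_left_of_neg hneg).1 hbc)))
  · exact le_antisymm ((hmono (le_of_mul_le_mul_left hbc hpos)).trans_eq h.symm)
      (hmono (le_of_mul_le_mul_left hab hpos))

/-- The triples of a level, a strip and a row of points of `S` such that the row leaves the strip,
but not its parent, in the direction `ε`. -/
noncomputable def crossings (S : Finset (ℝ × ℝ)) (ρ : ℝ → ℕ) (k n : ℕ) (ε : ℝ) :
    Finset (ℕ × ℕ × ℝ) :=
  open Classical in
  (Finset.range k ×ˢ Finset.range n ×ˢ S.image Prod.snd).filter fun c =>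
    ∃ x ∈ S, ∃ x' ∈ S, x.2 = c.2.2 ∧ x'.2 = c.2.2 ∧ ε * x.1 < ε * x'.1 ∧
      strip k c.1 (ρ x.1) = c.2.1 ∧ strip k c.1 (ρ x'.1) ≠ c.2.1 ∧
      strip k (c.1 + 1) (ρ x.1) = strip k (c.1 + 1) (ρ x'.1)

/-- The last point of the row in the strip of a crossing, if the row goes on to another point under
the same parent. -/
structure IsLastInStrip (S : Finset (ℝ × ℝ)) (ρ : ℝ → ℕ) (k : ℕ) (ε : ℝ) (c : ℕ × ℕ × ℝ)
    (x : ℝ × ℝ) : Prop where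
  row : x.2 = c.2.2
  strip_eq : strip k c.1 (ρ x.1) = c.2.1
  le : ∀ y ∈ S, y.2 = c.2.2 → strip k c.1 (ρ y.1) = c.2.1 → ε * y.1 ≤ ε * x.1
  exists_lt : ∃ x' ∈ S, x'.2 = c.2.2 ∧ ε * x.1 < ε * x'.1 ∧
    strip k (c.1 + 1) (ρ x.1) = strip k (c.1 + 1) (ρ x'.1)

open Classical in
/-- The points that are not the last ones of their rows in the direction `ε`. -/
noncomputable def nonLast (S : Finset (ℝ × ℝ)) (ε : ℝ) : Finset (ℝ × ℝ) :=
  S.filter fun x => ∃ x' ∈ S, x'.2 = x.2 ∧ ε * x.1 < ε * x'.1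

variable {S R Q : Finset (ℝ × ℝ)} {ρ : ℝ → ℕ} {k n : ℕ} {ε : ℝ}

theorem exists_isLastInStrip (hρ : Monotone ρ) (hε : ε ≠ 0) {c : ℕ × ℕ × ℝ}
    (hc : c ∈ crossings S ρ k n ε) : ∃ z ∈ nonLast S ε, IsLastInStrip S ρ k ε c z := by
  classical
  simp only [crossings, Finset.mem_filter] at hc
  obtain ⟨-, x, hx, x', hx', hrow, hrow', hlt, hstrip, hstrip', hparent⟩ := hc
  obtain ⟨z, hz, hmax⟩ := Finset.exists_max_image
    (S.filter fun y => y.2 = c.2.2 ∧ strip k c.1 (ρ y.1) = c.2.1) (fun y => ε * y.1)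
    ⟨x, Finset.mem_filter.2 ⟨hx, hrow, hstrip⟩⟩
  simp only [Finset.mem_filter] at hz hmax
  obtain ⟨hzS, hzrow, hzstrip⟩ := hz
  have hzx' : ε * z.1 < ε * x'.1 := by
    by_contra! hle
    exact hstrip' ((strip_eq_of_between hρ hε hlt.le hle (hstrip.trans hzstrip.symm)).trans hstrip)
  refine ⟨z, Finset.mem_filter.2 ⟨hzS, x', hx', hrow'.trans hzrow.symm, hzx'⟩, hzrow, hzstrip,
    fun y hy hyrow hystrip => hmax y ⟨hy, hyrow, hystrip⟩, x', hx', hrow', hzx', ?_⟩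
  exact (strip_eq_of_le c.1.le_succ (hzstrip.trans hstrip.symm)).trans hparent

theorem IsLastInStrip.level_le {c c' : ℕ × ℕ × ℝ} {x : ℝ × ℝ} (h : IsLastInStrip S ρ k ε c x)
    (h' : IsLastInStrip S ρ k ε c' x) : c'.1 ≤ c.1 := by
  by_contra! hlt
  obtain ⟨x', hx', hrow, hltx, hparent⟩ := h.exists_lt
  refine hltx.not_ge (h'.le x' hx' (by rw [hrow, ← h.row, h'.row]) ?_)
  rw [← strip_eq_of_le hlt hparent, h'.strip_eq]

theorem card_crossings_le_card_nonLast (hρ : Monotone ρ) (hε : ε ≠ 0) :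
    (crossings S ρ k n ε).card ≤ (nonLast S ε).card := by
  refine Finset.card_le_card_of_forall_subsingleton (IsLastInStrip S ρ k ε)
    (fun c hc => exists_isLastInStrip hρ hε hc) ?_
  rintro x - ⟨l, i, y⟩ ⟨-, h⟩ ⟨l', i', y'⟩ ⟨-, h'⟩
  obtain rfl : l = l' := le_antisymm (h'.level_le h) (h.level_le h')
  exact Prod.ext rfl (Prod.ext (h.strip_eq.symm.trans h'.strip_eq) (h.row.symm.trans h'.row))

/-- Charge a point of `Q` to itself, and a point of `R` to a later one in its row, which lies in
`Q`. -/
theorem card_nonLast_le (hR : Set.InjOn Prod.snd (R : Set (ℝ × ℝ))) :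
    (nonLast (R ∪ Q) ε).card ≤ 2 * Q.card := by
  classical
  have hQ : ((nonLast (R ∪ Q) ε).filter fun x => x ∈ Q).card ≤ Q.card :=
    Finset.card_le_card fun x hx => (Finset.mem_filter.1 hx).2
  have hnotQ : ((nonLast (R ∪ Q) ε).filter fun x => x ∉ Q).card ≤ Q.card := by
    refine Finset.card_le_card_of_forall_subsingleton (fun x y => x.2 = y.2) ?_ ?_
    · intro x hx
      simp only [nonLast, Finset.mem_filter, Finset.mem_union] at hx
      obtain ⟨⟨hxS, x', hx' | hx', hrow, hlt⟩, hxQ⟩ := hx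
      · rw [hR hx' (hxS.resolve_right hxQ) hrow] at hlt
        exact absurd hlt (lt_irrefl _)
      · exact ⟨x', hx', hrow.symm⟩
    · rintro y - x ⟨hx, hxy⟩ x' ⟨hx', hxy'⟩
      simp only [nonLast, Finset.mem_filter, Finset.mem_union] at hx hx'
      exact hR (hx.1.1.resolve_right hx.2) (hx'.1.1.resolve_right hx'.2) (hxy.trans hxy'.symm)
  have := Finset.card_filter_add_card_filter_not (s := nonLast (R ∪ Q) ε) fun x => x ∈ Q
  omega

theorem card_crossings_le (hρ : Monotone ρ) (hε : ε ≠ 0)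
    (hR : Set.InjOn Prod.snd (R : Set (ℝ × ℝ))) :
    (crossings (R ∪ Q) ρ k n ε).card ≤ 2 * Q.card :=
  (card_crossings_le_card_nonLast hρ hε).trans (card_nonLast_le hR)

theorem mem_crossings {l : ℕ} {x x' : ℝ × ℝ} (hn : ρ x.1 < n) (hl : l < k) (hx : x ∈ S)
    (hx' : x' ∈ S) (hrow : x'.2 = x.2) (hlt : ε * x.1 < ε * x'.1)
    (hstrip : strip k l (ρ x'.1) ≠ strip k l (ρ x.1))
    (hparent : strip k (l + 1) (ρ x.1) = strip k (l + 1) (ρ x'.1)) :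
    (l, strip k l (ρ x.1), x.2) ∈ crossings S ρ k n ε := by
  classical
  refine Finset.mem_filter.2 ⟨?_, x, hx, x', hx', rfl, hrow, hlt, rfl, hstrip, hparent⟩
  simp only [Finset.mem_product, Finset.mem_range]
  exact ⟨hl, (strip_le _ _ _).trans_lt hn, Finset.mem_image_of_mem _ hx⟩

theorem exists_first_change_and_arrival {α : Type*} {g : ℕ → α} {K : ℕ} (h : g 0 ≠ g K) :
    ∃ e f, e ≤ f ∧ f < K ∧ g e = g 0 ∧ g (e + 1) ≠ g 0 ∧ g f ≠ g K ∧ g (f + 1) = g K := by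
  classical
  have hexit : ∃ t, g t ≠ g 0 := ⟨K, h.symm⟩
  have hentry : ∃ t, g t = g K := ⟨K, rfl⟩
  obtain ⟨e, he⟩ := Nat.exists_eq_succ_of_ne_zero
    (show Nat.find hexit ≠ 0 from fun h₀ => Nat.find_spec hexit (by rw [h₀]))
  obtain ⟨f, hf⟩ := Nat.exists_eq_succ_of_ne_zero
    (show Nat.find hentry ≠ 0 from fun h₀ => h (by simpa [h₀] using Nat.find_spec hentry))
  have hle : Nat.find hexit ≤ Nat.find hentry :=
    Nat.find_min' hexit (by rw [Nat.find_spec hentry]; exact h.symm)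
  have hfK : Nat.find hentry ≤ K := Nat.find_min' hentry rfl
  refine ⟨e, f, by omega, by omega, not_not.1 (Nat.find_min hexit (by omega)), ?_,
    Nat.find_min hentry (by omega), ?_⟩
  · exact Nat.succ_eq_add_one e ▸ he ▸ Nat.find_spec hexit
  · exact Nat.succ_eq_add_one f ▸ hf ▸ Nat.find_spec hentry

/-- In the row `y` the path leaves the first strip, and in the row `y'` it enters the last one. -/
theorem exists_crossings (hρ : Monotone ρ) {l : ℕ} (hn : ∀ x, ρ x < n) (hl : l < k) {p q : ℝ × ℝ}
    (hpq : p.1 < q.1) (hstrip : strip k l (ρ p.1) ≠ strip k l (ρ q.1))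
    (hparent : strip k (l + 1) (ρ p.1) = strip k (l + 1) (ρ q.1))
    (h : MConnected (S : Set (ℝ × ℝ)) p q) :
    ∃ y y', (l, strip k l (ρ p.1), y) ∈ crossings S ρ k n 1 ∧
      (l, strip k l (ρ q.1), y') ∈ crossings S ρ k n (-1) ∧
      ((p.2 ≤ q.2 ∧ p.2 ≤ y ∧ y ≤ y' ∧ y' ≤ q.2) ∨ (q.2 ≤ p.2 ∧ q.2 ≤ y' ∧ y' ≤ y ∧ y ≤ p.2)) := by
  obtain ⟨K, x, rfl, rfl, hS, haligned, hlength⟩ := h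
  obtain ⟨hsum₁, hsum₂⟩ := sum_abs_sub_le_of_l1Dist hlength
  have hx : MonotoneOn (fun i => (x i).1) (Set.Iic K) := monotoneOn_of_sum_abs_le hsum₁ hpq.le
  have hparents (i : ℕ) (hi : i ≤ K) :
      strip k (l + 1) (ρ (x i).1) = strip k (l + 1) (ρ (x 0).1) :=
    strip_eq_of_between hρ one_ne_zero (by simpa using hx (Nat.zero_le K) hi i.zero_le)
      (by simpa using hx hi (le_refl K) hi) hparent
  obtain ⟨e, f, hef, hfK, he, he', hf, hf'⟩ :=
    exists_first_change_and_arrival (g := fun t => strip k l (ρ (x t).1)) hstrip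
  have hstep (i : ℕ) (hi : i < K) (hne : strip k l (ρ (x i).1) ≠ strip k l (ρ (x (i + 1)).1)) :
      (x i).2 = (x (i + 1)).2 ∧ (x i).1 < (x (i + 1)).1 :=
    have hne₁ : (x i).1 ≠ (x (i + 1)).1 := fun heq => hne (by rw [heq])
    ⟨(haligned i hi).resolve_left hne₁, (hx hi.le (show i + 1 ≤ K from hi) i.le_succ).lt_of_ne hne₁⟩
  obtain ⟨hrow, hlt⟩ := hstep e (by omega) (he.trans_ne he'.symm)
  obtain ⟨hrow', hlt'⟩ := hstep f hfK (hf.trans_eq hf'.symm)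
  refine ⟨(x e).2, (x (f + 1)).2, ?_, ?_, ?_⟩
  · rw [← he]
    exact mem_crossings (hn _) hl (hS _ (by omega)) (hS (e + 1) (by omega)) hrow.symm
      (by simpa using hlt) (he'.trans_eq he.symm)
      ((hparents _ (by omega)).trans (hparents _ (by omega)).symm)
  · rw [← hf']
    exact mem_crossings (hn _) hl (hS _ (by omega)) (hS f (by omega)) hrow'
      (by linarith) (hf.trans_eq hf'.symm)
      ((hparents _ (by omega)).trans (hparents _ (by omega)).symm)
  · exact le_le_le_of_sum_abs_le hsum₂ (by omega) hfK

theorem card_filter_not_eq_find {p : ℕ → Prop} [DecidablePred p] (hp : Monotone p)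
    (h : ∃ i, p i) {n : ℕ} (hn : Nat.find h ≤ n) :
    ((Finset.range n).filter fun i => ¬ p i).card = Nat.find h := by
  have hfilter : ((Finset.range n).filter fun i => ¬ p i) = Finset.range (Nat.find h) := by
    ext i
    simp only [Finset.mem_filter, Finset.mem_range, Nat.lt_find_iff]
    refine ⟨fun ⟨_, hi⟩ m hm hpm => hi (hp hm hpm), fun hi => ⟨?_, hi i le_rfl⟩⟩
    exact ((Nat.lt_find_iff h i).2 hi).trans_le hn
  rw [hfilter, Finset.card_range]

/-- A pair of points that have to be connected. -/
abbrev Demand := (ℤ × ℤ) × (ℤ × ℤ)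

/-- The left point of a demand. -/
def leftEnd (d : Demand) : ℤ × ℤ := if d.1.1 < d.2.1 then d.1 else d.2

/-- The right point of a demand. -/
def rightEnd (d : Demand) : ℤ × ℤ := if d.1.1 < d.2.1 then d.2 else d.1

theorem mconnected_iff_leftEnd_rightEnd {S : Set (ℝ × ℝ)} {d : Demand} :
    MConnected S (toPlane d.1) (toPlane d.2) ↔
      MConnected S (toPlane (leftEnd d)) (toPlane (rightEnd d)) := by
  unfold leftEnd rightEnd
  split_ifs
  · rfl
  · exact ⟨MConnected.symm, MConnected.symm⟩

theorem toPlane_injective : Function.Injective toPlane := fun p q h => by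
  simp only [toPlane, Prod.mk.injEq, Int.cast_inj] at h
  exact Prod.ext h.1 h.2

namespace Instance

/-! ### Ranks -/

variable (I : Instance)

/-- The number of points whose coordinate is less than `z`. -/
def rank (f : ℤ × ℤ → ℤ) (z : ℤ) : ℕ := (I.P.filter fun p => f p < z).card

/-- The coordinate of rank `m`. The sum has at most one nonzero summand; it is the form in which
programs evaluate the coordinate. -/
def coord (f : ℤ × ℤ → ℤ) (m : ℕ) : ℤ := ∑ p ∈ I.P, if I.rank f (f p) = m then f p else 0

/-- The rank of the last coordinate up to `x`, and `0` if there is none. -/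
noncomputable def floorRank (f : ℤ × ℤ → ℤ) (x : ℝ) : ℕ :=
  (I.P.filter fun p => ((f p : ℤ) : ℝ) ≤ x).card - 1

variable {I} {f : ℤ × ℤ → ℤ} {p q : ℤ × ℤ}

theorem injOn_fst : Set.InjOn (Prod.fst : ℤ × ℤ → ℤ) (I.P : Set (ℤ × ℤ)) :=
  fun p hp q hq h => I.column_inj p hp q hq h

theorem injOn_snd : Set.InjOn (Prod.snd : ℤ × ℤ → ℤ) (I.P : Set (ℤ × ℤ)) :=
  fun p hp q hq h => I.row_inj p hp q hq h

theorem rank_lt_rank (hp : p ∈ I.P) {z : ℤ} (h : f p < z) : I.rank f (f p) < I.rank f z := by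
  refine Finset.card_lt_card (Finset.ssubset_iff_of_subset ?_ |>.2 ⟨p, by simp [hp, h], by simp⟩)
  exact Finset.monotone_filter_right _ fun _ _ hq => lt_trans hq h

theorem rank_lt_card (hp : p ∈ I.P) : I.rank f (f p) < I.P.card :=
  Finset.card_lt_card
    (Finset.ssubset_iff_of_subset (Finset.filter_subset _ _) |>.2 ⟨p, hp, by simp⟩)

theorem rank_injOn (hf : Set.InjOn f (I.P : Set (ℤ × ℤ))) :
    Set.InjOn (fun p => I.rank f (f p)) (I.P : Set (ℤ × ℤ)) := by
  intro p hp q hq h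
  rcases lt_trichotomy (f p) (f q) with hlt | heq | hgt
  · exact absurd h (rank_lt_rank hp hlt).ne
  · exact hf hp hq heq
  · exact absurd h (rank_lt_rank hq hgt).ne'

theorem exists_rank_eq (hf : Set.InjOn f (I.P : Set (ℤ × ℤ))) {m : ℕ} (hm : m < I.P.card) :
    ∃ p ∈ I.P, I.rank f (f p) = m :=
  Finset.surjOn_of_injOn_of_card_le (fun p => I.rank f (f p))
    (fun _ hp => Finset.mem_coe.2 (Finset.mem_range.2 (rank_lt_card hp))) (rank_injOn hf)
    (Finset.card_range _).le (Finset.mem_coe.2 (Finset.mem_range.2 hm))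

theorem coord_rank (hf : Set.InjOn f (I.P : Set (ℤ × ℤ))) (hp : p ∈ I.P) :
    I.coord f (I.rank f (f p)) = f p := by
  rw [coord, Finset.sum_eq_single_of_mem p hp fun q hq hne =>
    if_neg fun h => hne (rank_injOn hf hq hp h), if_pos rfl]

theorem coord_mono (hf : Set.InjOn f (I.P : Set (ℤ × ℤ))) {m m' : ℕ} (h : m ≤ m')
    (hm' : m' < I.P.card) : I.coord f m ≤ I.coord f m' := by
  obtain ⟨p, hp, rfl⟩ := exists_rank_eq hf (h.trans_lt hm')
  obtain ⟨q, hq, rfl⟩ := exists_rank_eq hf hm'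
  rw [coord_rank hf hp, coord_rank hf hq]
  by_contra! hlt
  exact (rank_lt_rank hq hlt).not_ge h

theorem floorRank_mono : Monotone (I.floorRank f) := fun _ _ h =>
  Nat.sub_le_sub_right
    (Finset.card_le_card (Finset.monotone_filter_right _ fun _ _ hp => le_trans hp h)) 1

theorem floorRank_lt (h : 0 < I.P.card) (x : ℝ) : I.floorRank f x < I.P.card := by
  have := Finset.card_filter_le I.P fun p => ((f p : ℤ) : ℝ) ≤ x
  rw [floorRank]
  omega

theorem floorRank_coe (hf : Set.InjOn f (I.P : Set (ℤ × ℤ))) (hp : p ∈ I.P) :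
    I.floorRank f (f p : ℝ) = I.rank f (f p) := by
  have hfilter : (I.P.filter fun q => ((f q : ℤ) : ℝ) ≤ (f p : ℝ))
      = insert p (I.P.filter fun q => f q < f p) := by
    ext q
    simp only [Finset.mem_filter, Finset.mem_insert, Int.cast_le]
    rw [le_iff_eq_or_lt]
    refine ⟨fun ⟨hq, h⟩ => h.imp (hf hq hp) fun hlt => ⟨hq, hlt⟩, ?_⟩
    rintro (rfl | ⟨hq, hlt⟩)
    exacts [⟨hp, Or.inl rfl⟩, ⟨hq, Or.inr hlt⟩]
  rw [floorRank, hfilter, Finset.card_insert_of_notMem (by simp), rank, Nat.add_sub_cancel]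

/-! ### The tree -/

variable (I)

/-- The depth of the tree, which is also the logarithm of its degree: about the square root of the
logarithm of the number of points. -/
def depth : ℕ := ((Finset.range I.P.card).filter fun i => 2 ^ (i * i) < I.P.card).card

theorem depth_spec : I.P.card ≤ 2 ^ (I.depth * I.depth) ∧
    ∀ i < I.depth, 2 ^ (i * i) < I.P.card := by
  have hcard : I.P.card ≤ 2 ^ (I.P.card * I.P.card) :=
    Nat.lt_two_pow_self.le.trans (Nat.pow_le_pow_right two_pos (Nat.le_mul_self _))
  have hex : ∃ i, I.P.card ≤ 2 ^ (i * i) := ⟨_, hcard⟩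
  have hmono : Monotone fun i => I.P.card ≤ 2 ^ (i * i) := fun i j hij hi =>
    hi.trans (Nat.pow_le_pow_right two_pos (Nat.mul_le_mul hij hij))
  have hdepth : I.depth = Nat.find hex := by
    rw [← card_filter_not_eq_find hmono hex (Nat.find_min' hex hcard)]
    simp only [depth, not_le]
  rw [hdepth]
  exact ⟨Nat.find_spec hex, fun i hi => not_le.1 (Nat.find_min hex hi)⟩

/-- The level of the tree at which two ranks are in different strips with the same parent. -/
def level (r r' : ℕ) : ℕ :=
  ((Finset.range I.depth).filter fun l =>
    ¬ strip I.depth (l + 1) r = strip I.depth (l + 1) r').card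

theorem level_spec {r r' : ℕ} (hr : r < I.P.card) (hr' : r' < I.P.card) (hne : r ≠ r') :
    I.level r r' < I.depth ∧ strip I.depth (I.level r r') r ≠ strip I.depth (I.level r r') r' ∧
      strip I.depth (I.level r r' + 1) r = strip I.depth (I.level r r' + 1) r' := by
  have hcard := I.depth_spec.1
  have hpos : 0 < I.depth := by
    by_contra! hzero
    rw [Nat.le_zero.1 hzero, mul_zero, pow_zero] at hcard
    omega
  have hroot : strip I.depth (I.depth - 1 + 1) r = strip I.depth (I.depth - 1 + 1) r' := by
    rw [Nat.sub_add_cancel hpos, strip, strip, Nat.div_eq_of_lt (hr.trans_le hcard),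
      Nat.div_eq_of_lt (hr'.trans_le hcard)]
  have hex : ∃ l, strip I.depth (l + 1) r = strip I.depth (l + 1) r' := ⟨_, hroot⟩
  have hle : Nat.find hex ≤ I.depth - 1 := Nat.find_min' hex hroot
  have hlevel : I.level r r' = Nat.find hex :=
    card_filter_not_eq_find (p := fun l => strip I.depth (l + 1) r = strip I.depth (l + 1) r')
      (fun l l' hl => strip_eq_of_le (Nat.succ_le_succ hl)) hex (by omega)
  rw [hlevel]
  refine ⟨by omega, ?_, Nat.find_spec hex⟩
  rcases Nat.eq_zero_or_pos (Nat.find hex) with hzero | hfind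
  · rw [hzero]
    simpa [strip] using hne
  · have := Nat.find_min hex (m := Nat.find hex - 1) (by omega)
    rwa [show Nat.find hex - 1 + 1 = Nat.find hex by omega] at this

/-! ### Demands -/

/-- The orientation of a demand: `1` if it descends. -/
def orientation (d : Demand) : ℕ :=
  if I.rank Prod.snd (rightEnd d).2 < I.rank Prod.snd (leftEnd d).2 then 1 else 0

/-- Reverse the order of the ranks for the orientation `1`. -/
def orientRow (o v : ℕ) : ℕ := if o = 1 then I.P.card - 1 - v else v

/-- The rank of the left point. -/
def leftRank (d : Demand) : ℕ := I.rank Prod.fst (leftEnd d).1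

/-- The rank of the right point. -/
def rightRank (d : Demand) : ℕ := I.rank Prod.fst (rightEnd d).1

/-- The level of a demand. -/
def demandLevel (d : Demand) : ℕ := I.level (I.leftRank d) (I.rightRank d)

/-- The first row of a demand, in its orientation. -/
def firstRow (d : Demand) : ℕ := I.orientRow (I.orientation d) (I.rank Prod.snd (leftEnd d).2)

/-- The last row of a demand, in its orientation. -/
def lastRow (d : Demand) : ℕ := I.orientRow (I.orientation d) (I.rank Prod.snd (rightEnd d).2)

/-- The first index that belongs to an orientation, a side, a level and a strip; the rows follow.
Side `0` is for leaving the strip to the right, side `1` for entering it from the left. -/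
def offset (o side l i : ℕ) : ℕ := (((o * 2 + side) * I.depth + l) * I.P.card + i) * I.P.card

/-- The offset of the strip that a demand leaves. -/
def outOffset (d : Demand) : ℕ :=
  I.offset (I.orientation d) 0 (I.demandLevel d) (strip I.depth (I.demandLevel d) (I.leftRank d))

/-- The offset of the strip that a demand enters. -/
def inOffset (d : Demand) : ℕ :=
  I.offset (I.orientation d) 1 (I.demandLevel d) (strip I.depth (I.demandLevel d) (I.rightRank d))

/-- The number of indices. -/
def size : ℕ := 4 * I.depth * I.P.card * I.P.card

variable {I} {d : Demand}

theorem offset_add_lt {o side l i v : ℕ} (ho : o < 2) (hs : side < 2) (hl : l < I.depth)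
    (hi : i < I.P.card) (hv : v < I.P.card) : I.offset o side l i + v < I.size := by
  unfold offset size
  have hlevel : (o * 2 + side) * I.depth + l + 1 ≤ 4 * I.depth := by
    have : o * 2 + side ≤ 3 := by omega
    nlinarith
  have hstrip : ((o * 2 + side) * I.depth + l) * I.P.card + i + 1 ≤ 4 * I.depth * I.P.card := by
    nlinarith
  nlinarith

theorem orientation_lt (d : Demand) : I.orientation d < 2 := by
  unfold orientation; split_ifs <;> omega

theorem orientRow_lt {o v : ℕ} (hv : v < I.P.card) : I.orientRow o v < I.P.card := by
  unfold orientRow; split_ifs <;> omega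

theorem leftEnd_mem (hd : d ∈ I.D) : leftEnd d ∈ I.P := by
  unfold leftEnd; split_ifs; exacts [(I.demand_mem d hd).1, (I.demand_mem d hd).2]

theorem rightEnd_mem (hd : d ∈ I.D) : rightEnd d ∈ I.P := by
  unfold rightEnd; split_ifs; exacts [(I.demand_mem d hd).2, (I.demand_mem d hd).1]

theorem leftEnd_lt_rightEnd (hd : d ∈ I.D) (hne : d.1 ≠ d.2) : (leftEnd d).1 < (rightEnd d).1 := by
  obtain ⟨hmem₁, hmem₂⟩ := I.demand_mem d hd
  have hcolumn : d.1.1 ≠ d.2.1 := fun h => hne (I.column_inj _ hmem₁ _ hmem₂ h)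
  unfold leftEnd rightEnd
  split_ifs with h
  exacts [h, lt_of_le_of_ne (not_lt.1 h) hcolumn.symm]

theorem leftEnd_ne_rightEnd (hd : d ∈ I.D) (hne : d.1 ≠ d.2) : leftEnd d ≠ rightEnd d :=
  fun h => (leftEnd_lt_rightEnd hd hne).ne (congrArg Prod.fst h)

theorem leftRank_lt_rightRank (hd : d ∈ I.D) (hne : d.1 ≠ d.2) : I.leftRank d < I.rightRank d :=
  rank_lt_rank (f := Prod.fst) (leftEnd_mem hd) (leftEnd_lt_rightEnd hd hne)

theorem rightRank_lt (hd : d ∈ I.D) : I.rightRank d < I.P.card :=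
  rank_lt_card (f := Prod.fst) (rightEnd_mem hd)

theorem leftRank_lt (hd : d ∈ I.D) : I.leftRank d < I.P.card :=
  rank_lt_card (f := Prod.fst) (leftEnd_mem hd)

theorem demandLevel_spec (hd : d ∈ I.D) (hne : d.1 ≠ d.2) :
    I.demandLevel d < I.depth ∧
      strip I.depth (I.demandLevel d) (I.leftRank d)
        < strip I.depth (I.demandLevel d) (I.rightRank d) ∧
      strip I.depth (I.demandLevel d + 1) (I.leftRank d)
        = strip I.depth (I.demandLevel d + 1) (I.rightRank d) := by
  have hlt := leftRank_lt_rightRank hd hne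
  obtain ⟨hlevel, hstrip, hparent⟩ := I.level_spec (leftRank_lt hd) (rightRank_lt hd) hlt.ne
  exact ⟨hlevel, lt_of_le_of_ne (strip_mono _ _ hlt.le) hstrip, hparent⟩

/-! ### The indices hit by a feasible solution -/

variable {I : Instance} {S Q : Finset (ℝ × ℝ)} {d : Demand}

/-- The index of a crossing in a given orientation and on a given side. -/
noncomputable def crossingIndex (I : Instance) (side o : ℕ) (c : ℕ × ℕ × ℝ) : ℕ :=
  I.offset o side c.1 c.2.1 + I.orientRow o (I.floorRank Prod.snd c.2.2)

/-- The indices of the crossings in the direction `ε`, in both orientations. -/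
noncomputable def crossingIndices (I : Instance) (S : Finset (ℝ × ℝ)) (side : ℕ) (ε : ℝ) :
    Finset ℕ :=
  (Finset.range 2 ×ˢ crossings S (I.floorRank Prod.fst) I.depth I.P.card ε).image fun z =>
    I.crossingIndex side z.1 z.2

theorem crossingIndex_mem {side o : ℕ} {ε : ℝ} {c : ℕ × ℕ × ℝ} (ho : o < 2)
    (hc : c ∈ crossings S (I.floorRank Prod.fst) I.depth I.P.card ε) :
    I.crossingIndex side o c ∈ I.crossingIndices S side ε :=
  Finset.mem_image.2 ⟨(o, c), Finset.mem_product.2 ⟨Finset.mem_range.2 ho, hc⟩, rfl⟩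

theorem crossingIndices_subset (hP : 0 < I.P.card) {side : ℕ} (hside : side < 2) (ε : ℝ) :
    I.crossingIndices S side ε ⊆ Finset.range I.size := by
  intro u hu
  obtain ⟨⟨o, c⟩, hoc, rfl⟩ := Finset.mem_image.1 hu
  obtain ⟨ho, hc⟩ := Finset.mem_product.1 hoc
  simp only [crossings, Finset.mem_filter, Finset.mem_product, Finset.mem_range] at ho hc
  exact Finset.mem_range.2
    (offset_add_lt ho hside hc.1.1 hc.1.2.1 (orientRow_lt (floorRank_lt hP _)))

open Classical in
theorem card_crossingIndices_le {side : ℕ} {ε : ℝ} (hε : ε ≠ 0) :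
    (I.crossingIndices (I.P.image toPlane ∪ Q) side ε).card ≤ 4 * Q.card := by
  have hrow : Set.InjOn Prod.snd ((I.P.image toPlane : Finset (ℝ × ℝ)) : Set (ℝ × ℝ)) := by
    rw [Finset.coe_image]
    refine Set.InjOn.image_of_comp fun p hp q hq h => ?_
    exact injOn_snd hp hq (by simpa [toPlane] using h)
  have himage := Finset.card_image_le
    (s := Finset.range 2 ×ˢ
      crossings (I.P.image toPlane ∪ Q) (I.floorRank Prod.fst) I.depth I.P.card ε)
    (f := fun z => I.crossingIndex side z.1 z.2)
  have hcrossings : (crossings (I.P.image toPlane ∪ Q) (I.floorRank Prod.fst) I.depth I.P.card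
      ε).card ≤ 2 * Q.card := card_crossings_le floorRank_mono hε hrow
  rw [Finset.card_product, Finset.card_range] at himage
  rw [crossingIndices]
  omega

theorem firstRow_le_orientRow_le_lastRow (hd : d ∈ I.D) (hne : d.1 ≠ d.2) {v v' : ℕ}
    (h : (I.rank Prod.snd (leftEnd d).2 ≤ v ∧ v ≤ v' ∧ v' ≤ I.rank Prod.snd (rightEnd d).2) ∨
      (I.rank Prod.snd (rightEnd d).2 ≤ v' ∧ v' ≤ v ∧ v ≤ I.rank Prod.snd (leftEnd d).2)) :
    I.firstRow d ≤ I.orientRow (I.orientation d) v ∧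
      I.orientRow (I.orientation d) v ≤ I.orientRow (I.orientation d) v' ∧
      I.orientRow (I.orientation d) v' ≤ I.lastRow d := by
  have hranks : I.rank Prod.snd (rightEnd d).2 ≠ I.rank Prod.snd (leftEnd d).2 := fun h =>
    leftEnd_ne_rightEnd hd hne (rank_injOn injOn_snd (rightEnd_mem hd) (leftEnd_mem hd) h).symm
  unfold firstRow lastRow
  rcases h with ⟨h₁, h₂, h₃⟩ | ⟨h₁, h₂, h₃⟩
  · have ho : I.orientation d = 0 := if_neg (by omega)
    simp only [ho, orientRow, if_neg zero_ne_one]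
    exact ⟨h₁, h₂, h₃⟩
  · have ho : I.orientation d = 1 := if_pos (by omega)
    simp only [ho, orientRow, if_true]
    omega

open Classical in
theorem exists_crossingIndex (hd : d ∈ I.D) (hne : d.1 ≠ d.2)
    (h : MConnected ((I.P.image toPlane ∪ Q : Finset (ℝ × ℝ)) : Set (ℝ × ℝ))
      (toPlane (leftEnd d)) (toPlane (rightEnd d))) :
    ∃ v v', I.firstRow d ≤ v ∧ v ≤ v' ∧ v' ≤ I.lastRow d ∧
      I.outOffset d + v ∈ I.crossingIndices (I.P.image toPlane ∪ Q) 0 1 ∧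
      I.inOffset d + v' ∈ I.crossingIndices (I.P.image toPlane ∪ Q) 1 (-1) := by
  have hL := leftEnd_mem hd
  have hR := rightEnd_mem hd
  have hleft : I.floorRank Prod.fst (toPlane (leftEnd d)).1 = I.leftRank d :=
    floorRank_coe (f := Prod.fst) injOn_fst hL
  have hright : I.floorRank Prod.fst (toPlane (rightEnd d)).1 = I.rightRank d :=
    floorRank_coe (f := Prod.fst) injOn_fst hR
  have hleft₂ : I.floorRank Prod.snd (toPlane (leftEnd d)).2 = I.rank Prod.snd (leftEnd d).2 :=
    floorRank_coe (f := Prod.snd) injOn_snd hL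
  have hright₂ : I.floorRank Prod.snd (toPlane (rightEnd d)).2 = I.rank Prod.snd (rightEnd d).2 :=
    floorRank_coe (f := Prod.snd) injOn_snd hR
  obtain ⟨hlevel, hstrip, hparent⟩ := demandLevel_spec hd hne
  have hlt : (toPlane (leftEnd d)).1 < (toPlane (rightEnd d)).1 := by
    simpa [toPlane] using leftEnd_lt_rightEnd hd hne
  obtain ⟨y, y', hy, hy', hrows⟩ := exists_crossings (ρ := I.floorRank Prod.fst)
    floorRank_mono (floorRank_lt (Finset.card_pos.2 ⟨_, hL⟩)) hlevel hlt
    (by rw [hleft, hright]; exact hstrip.ne) (by rw [hleft, hright]; exact hparent) h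
  rw [hleft] at hy
  rw [hright] at hy'
  have hmono : Monotone (I.floorRank Prod.snd) := floorRank_mono
  obtain ⟨h₁, h₂, h₃⟩ := firstRow_le_orientRow_le_lastRow hd hne
    (v := I.floorRank Prod.snd y) (v' := I.floorRank Prod.snd y') (by
      rw [← hleft₂, ← hright₂]
      exact hrows.imp
        (fun h => ⟨hmono h.2.1, hmono h.2.2.1, hmono h.2.2.2⟩)
        (fun h => ⟨hmono h.2.1, hmono h.2.2.1, hmono h.2.2.2⟩))
  have ho : I.orientation d < 2 := orientation_lt d
  have hout := crossingIndex_mem (side := 0) ho hy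
  have hin := crossingIndex_mem (side := 1) ho hy'
  simp only [crossingIndex] at hout hin
  exact ⟨_, _, h₁, h₂, h₃, hout, hin⟩

/-- In the row `v` the demand leaves its first strip, and in the later row `v'` it enters its last
one. -/
theorem exists_hitting (hQ : I.Feasible (Q : Set (ℝ × ℝ))) :
    ∃ H ⊆ Finset.range I.size, H.card ≤ 8 * Q.card ∧ ∀ d ∈ I.D, d.1 ≠ d.2 →
      ∃ v v', I.firstRow d ≤ v ∧ v ≤ v' ∧ v' ≤ I.lastRow d ∧
        I.outOffset d + v ∈ H ∧ I.inOffset d + v' ∈ H := by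
  classical
  rcases I.P.eq_empty_or_nonempty with hP | hP
  · refine ⟨∅, Finset.empty_subset _, by simp, fun d hd => ?_⟩
    simpa [hP] using (I.demand_mem d hd).1
  · refine ⟨I.crossingIndices (I.P.image toPlane ∪ Q) 0 1 ∪
      I.crossingIndices (I.P.image toPlane ∪ Q) 1 (-1), ?_, ?_, fun d hd hne => ?_⟩
    · exact Finset.union_subset (crossingIndices_subset hP.card_pos two_pos _)
        (crossingIndices_subset hP.card_pos one_lt_two _)
    · have hout := card_crossingIndices_le (I := I) (Q := Q) (side := 0) one_ne_zero
      have hin := card_crossingIndices_le (I := I) (Q := Q) (side := 1) (neg_ne_zero.2 one_ne_zero)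
      exact (Finset.card_union_le _ _).trans (by omega)
    · have hconnected := mconnected_iff_leftEnd_rightEnd.1 (hQ d hd)
      obtain ⟨v, v', h₁, h₂, h₃, hv, hv'⟩ :=
        exists_crossingIndex (Q := Q) hd hne (by push_cast; exact hconnected)
      exact ⟨v, v', h₁, h₂, h₃, Finset.mem_union_left _ hv, Finset.mem_union_right _ hv'⟩

/-- The end points of the nontrivial demands. -/
def ends (I : Instance) : Finset (ℤ × ℤ) :=
  (I.D.filter fun d => d.1 ≠ d.2).image leftEnd ∪ (I.D.filter fun d => d.1 ≠ d.2).image rightEnd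

theorem exists_aligned {p q : ℤ × ℤ} (hp : p ∈ I.P) (hne : p ≠ q)
    (h : MConnected (toPlane '' (I.P : Set (ℤ × ℤ)) ∪ Q) (toPlane p) (toPlane q)) :
    ∃ x ∈ Q, Aligned (toPlane p) x := by
  obtain ⟨k, x, h₀, hk, hS, haligned, -⟩ := h
  obtain ⟨e, f, hef, hfk, he, he', -⟩ := exists_first_change_and_arrival (g := x) (K := k)
    (by rw [h₀, hk]; exact toPlane_injective.ne hne)
  have hnext := haligned e (by omega)
  rw [he, h₀] at hnext
  rw [h₀] at he'
  refine ⟨x (e + 1), (hS (e + 1) (by omega)).resolve_left ?_, hnext⟩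
  rintro ⟨r, hr, heq⟩
  rw [← heq] at hnext he'
  simp only [Aligned, toPlane, Int.cast_inj] at hnext
  rcases hnext with hnext | hnext
  · exact he' (congrArg toPlane (I.column_inj p hp r hr hnext)).symm
  · exact he' (congrArg toPlane (I.row_inj p hp r hr hnext)).symm

theorem card_le_of_aligned {T : Finset (ℤ × ℤ)} (hT : T ⊆ I.P)
    (h : ∀ p ∈ T, ∃ x ∈ Q, Aligned (toPlane p) x) : T.card ≤ 2 * Q.card := by
  classical
  have hcolumn : (T.filter fun p => ∃ x ∈ Q, (toPlane p).1 = x.1).card ≤ Q.card := by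
    refine Finset.card_le_card_of_forall_subsingleton (fun p x => (toPlane p).1 = x.1)
      (fun p hp => (Finset.mem_filter.1 hp).2) ?_
    rintro x - p ⟨hp, hpx⟩ q ⟨hq, hqx⟩
    exact injOn_fst (hT (Finset.mem_filter.1 hp).1) (hT (Finset.mem_filter.1 hq).1)
      (by simpa [toPlane] using hpx.trans hqx.symm)
  have hrow : (T.filter fun p => ¬ ∃ x ∈ Q, (toPlane p).1 = x.1).card ≤ Q.card := by
    refine Finset.card_le_card_of_forall_subsingleton (fun p x => (toPlane p).2 = x.2)
      (fun p hp => ?_) ?_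
    · obtain ⟨hpT, hnot⟩ := Finset.mem_filter.1 hp
      obtain ⟨x, hx, haligned⟩ := h p hpT
      exact ⟨x, hx, haligned.resolve_left fun h => hnot ⟨x, hx, h⟩⟩
    · rintro x - p ⟨hp, hpx⟩ q ⟨hq, hqx⟩
      exact injOn_snd (hT (Finset.mem_filter.1 hp).1) (hT (Finset.mem_filter.1 hq).1)
        (by simpa [toPlane] using hpx.trans hqx.symm)
  have := Finset.card_filter_add_card_filter_not (s := T) fun p => ∃ x ∈ Q, (toPlane p).1 = x.1
  omega

theorem card_ends_le (hQ : I.Feasible (Q : Set (ℝ × ℝ))) : I.ends.card ≤ 2 * Q.card := by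
  suffices h : ∀ p ∈ I.ends, p ∈ I.P ∧ ∃ x ∈ Q, Aligned (toPlane p) x from
    card_le_of_aligned (fun p hp => (h p hp).1) fun p hp => (h p hp).2
  intro p hp
  simp only [ends, Finset.mem_union, Finset.mem_image, Finset.mem_filter] at hp
  rcases hp with ⟨d, ⟨hd, hne⟩, rfl⟩ | ⟨d, ⟨hd, hne⟩, rfl⟩
  · exact ⟨leftEnd_mem hd, exists_aligned (leftEnd_mem hd) (leftEnd_ne_rightEnd hd hne)
      (mconnected_iff_leftEnd_rightEnd.1 (hQ d hd))⟩
  · exact ⟨rightEnd_mem hd, exists_aligned (rightEnd_mem hd) (leftEnd_ne_rightEnd hd hne).symm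
      (mconnected_iff_leftEnd_rightEnd.1 (hQ d hd)).symm⟩

end Instance

theorem mconnected_staircase {S : Set (ℝ × ℝ)} {x₀ x₁ x₂ x₃ x₄ y₀ y₁ y₂ y₃ : ℝ}
    (hx : x₀ ≤ x₁ ∧ x₁ ≤ x₂ ∧ x₂ ≤ x₃ ∧ x₃ ≤ x₄)
    (hy : (y₀ ≤ y₁ ∧ y₁ ≤ y₂ ∧ y₂ ≤ y₃) ∨ (y₃ ≤ y₂ ∧ y₂ ≤ y₁ ∧ y₁ ≤ y₀))
    (h₀ : (x₀, y₀) ∈ S) (h₁ : (x₁, y₀) ∈ S) (h₂ : (x₁, y₁) ∈ S) (h₃ : (x₂, y₁) ∈ S)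
    (h₄ : (x₂, y₂) ∈ S) (h₅ : (x₃, y₂) ∈ S) (h₆ : (x₃, y₃) ∈ S) (h₇ : (x₄, y₃) ∈ S) :
    MConnected S (x₀, y₀) (x₄, y₃) := by
  refine ⟨7, fun i => [(x₀, y₀), (x₁, y₀), (x₁, y₁), (x₂, y₁), (x₂, y₂), (x₃, y₂), (x₃, y₃),
    (x₄, y₃)].getD i (x₄, y₃), rfl, rfl, ?_, ?_, ?_⟩
  · intro i hi
    interval_cases i <;> simpa
  · intro i hi
    interval_cases i <;> simp [Aligned]
  · obtain ⟨hx₁, hx₂, hx₃, hx₄⟩ := hx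
    simp only [Finset.sum_range_succ, Finset.sum_range_zero, l1Dist, List.getD_cons_zero,
      List.getD_cons_succ, sub_self, abs_zero]
    rw [abs_of_nonpos (by linarith : x₀ - x₁ ≤ 0), abs_of_nonpos (by linarith : x₁ - x₂ ≤ 0),
      abs_of_nonpos (by linarith : x₂ - x₃ ≤ 0), abs_of_nonpos (by linarith : x₃ - x₄ ≤ 0),
      abs_of_nonpos (by linarith : x₀ - x₄ ≤ 0)]
    rcases hy with ⟨hy₁, hy₂, hy₃⟩ | ⟨hy₃, hy₂, hy₁⟩
    · rw [abs_of_nonpos (by linarith : y₀ - y₁ ≤ 0), abs_of_nonpos (by linarith : y₁ - y₂ ≤ 0),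
        abs_of_nonpos (by linarith : y₂ - y₃ ≤ 0), abs_of_nonpos (by linarith : y₀ - y₃ ≤ 0)]
      ring
    · rw [abs_of_nonneg (by linarith : 0 ≤ y₀ - y₁), abs_of_nonneg (by linarith : 0 ≤ y₁ - y₂),
        abs_of_nonneg (by linarith : 0 ≤ y₂ - y₃), abs_of_nonneg (by linarith : 0 ≤ y₀ - y₃)]
      ring

theorem exists_separating_bit {k i j : ℕ} (hij : i < j) (h : i / 2 ^ k = j / 2 ^ k) :
    ∃ t < k, j / 2 ^ t = i / 2 ^ t + 1 := by
  induction k with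
  | zero => simp [hij.ne] at h
  | succ k ih =>
    by_cases heq : i / 2 ^ k = j / 2 ^ k
    · obtain ⟨t, ht, hbit⟩ := ih heq
      exact ⟨t, ht.trans k.lt_succ_self, hbit⟩
    · have hle : i / 2 ^ k ≤ j / 2 ^ k := Nat.div_le_div_right hij.le
      rw [pow_succ, ← Nat.div_div_eq_div_mul, ← Nat.div_div_eq_div_mul] at h
      exact ⟨k, k.lt_succ_self, by omega⟩

/-- The boundaries at which a staircase from `a` to `b` turns, when the two strips are different
and have the same parent. The middle one is the only boundary that belongs to both strips. -/
theorem exists_boundaries {k l a b : ℕ} (hstrip : strip k l a < strip k l b)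
    (hparent : strip k (l + 1) a = strip k (l + 1) b) :
    ∃ t < k, strip k l b / 2 ^ t = strip k l a / 2 ^ t + 1 ∧
      a ≤ (strip k l a + 1) * 2 ^ (k * l) ∧
      (strip k l a + 1) * 2 ^ (k * l) ≤ (strip k l a / 2 ^ t + 1) * 2 ^ (k * l + t) ∧
      (strip k l a / 2 ^ t + 1) * 2 ^ (k * l + t) ≤ strip k l b * 2 ^ (k * l) ∧
      strip k l b * 2 ^ (k * l) ≤ b := by
  have hcarry : strip k l a / 2 ^ k = strip k l b / 2 ^ k := by
    simpa only [strip, mul_add, mul_one, pow_add, ← Nat.div_div_eq_div_mul] using hparent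
  obtain ⟨t, ht, hbit⟩ := exists_separating_bit hstrip hcarry
  refine ⟨t, ht, hbit, ?_, ?_, ?_, Nat.div_mul_le_self _ _⟩
  · rw [mul_comm]
    exact (Nat.lt_mul_div_succ _ (by positivity)).le
  · have hup : strip k l a + 1 ≤ (strip k l a / 2 ^ t + 1) * 2 ^ t := by
      rw [mul_comm]
      exact Nat.lt_mul_div_succ _ (by positivity)
    calc (strip k l a + 1) * 2 ^ (k * l)
        ≤ (strip k l a / 2 ^ t + 1) * 2 ^ t * 2 ^ (k * l) := by gcongr
      _ = (strip k l a / 2 ^ t + 1) * 2 ^ (k * l + t) := by ring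
  · calc (strip k l a / 2 ^ t + 1) * 2 ^ (k * l + t)
        = strip k l b / 2 ^ t * 2 ^ t * 2 ^ (k * l) := by rw [hbit]; ring
      _ ≤ strip k l b * 2 ^ (k * l) := by gcongr; exact Nat.div_mul_le_self _ _

namespace Instance

/-! ### The hitting set problem of an instance -/

variable (I : Instance)

/-- The demand of the cut `c`. A cut is a demand together with a row. -/
def cutDemand (ds : List Demand) (c : ℕ) : Demand := ds.getD (c / (I.P.card + 1)) 0

/-- The row of the cut `c`. -/
def cutRow (c : ℕ) : ℕ := c % (I.P.card + 1)

/-- The hitting set problem of an instance: the set of a cut consists of the rows below the cut of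
the strip that its demand leaves, and of the rows from the cut on of the strip that it enters. -/
def problem (ds : List Demand) : HitProblem where
  N := I.size
  M := ds.length * (I.P.card + 1)
  act c := (I.cutDemand ds c).1 ≠ (I.cutDemand ds c).2
  mem c u :=
    (I.outOffset (I.cutDemand ds c) + I.firstRow (I.cutDemand ds c) ≤ u ∧
      u < I.outOffset (I.cutDemand ds c) + I.cutRow c) ∨
    (I.inOffset (I.cutDemand ds c) + I.cutRow c ≤ u ∧
      u ≤ I.inOffset (I.cutDemand ds c) + I.lastRow (I.cutDemand ds c))

/-- The level of an index. -/
def indexLevel (u : ℕ) : ℕ := u / I.P.card / I.P.card % I.depth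

/-- The strip of an index. -/
def indexStrip (u : ℕ) : ℕ := u / I.P.card % I.P.card

/-- The side of an index. -/
def indexSide (u : ℕ) : ℕ := u / I.P.card / I.P.card / I.depth % 2

/-- The orientation of an index. -/
def indexOrientation (u : ℕ) : ℕ := u / I.P.card / I.P.card / I.depth / 2

/-- The rank of the `j`-th boundary for an index: the end, on the side of the index, of the dyadic
interval of `2 ^ j` strips that contains the strip of the index. -/
def boundary (u j : ℕ) : ℕ :=
  (I.indexStrip u / 2 ^ j + (1 - I.indexSide u)) * 2 ^ (I.depth * I.indexLevel u + j)

/-- The row of an index, as a coordinate. -/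
def indexRow (u : ℕ) : ℤ := I.coord Prod.snd (I.orientRow (I.indexOrientation u) (u % I.P.card))

/-- The rank of the right boundary of the strip of the left end of a demand. -/
def exitRank (d : Demand) : ℕ :=
  (strip I.depth (I.demandLevel d) (I.leftRank d) + 1) * 2 ^ (I.depth * I.demandLevel d)

/-- The rank of the left boundary of the strip of the right end of a demand. -/
def entryRank (d : Demand) : ℕ :=
  strip I.depth (I.demandLevel d) (I.rightRank d) * 2 ^ (I.depth * I.demandLevel d)

/-- The point in the row of the left end of a demand where it leaves the strip of that end. -/
def leftExit (d : Demand) : ℤ × ℤ := (I.coord Prod.fst (I.exitRank d), (leftEnd d).2)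

/-- The point in the row of the right end of a demand where it enters the strip of that end. -/
def rightEntry (d : Demand) : ℤ × ℤ := (I.coord Prod.fst (I.entryRank d), (rightEnd d).2)

/-- The points at which the rows of the net for `K` and `w` meet the boundaries. -/
def netPoints (K : ℤ) (w : ℕ → ℤ) : Set (ℤ × ℤ) :=
  {z | ∃ u < I.size, Jump I.size K w u ∧ ∃ j < I.depth, I.boundary u j < I.P.card ∧
    z = (I.coord Prod.fst (I.boundary u j), I.indexRow u)}

/-- The points that connect the ends of the demands to the boundaries of their strips. -/
def endPoints : Set (ℤ × ℤ) :=
  {z | ∃ d ∈ I.D, d.1 ≠ d.2 ∧ (z = I.leftExit d ∨ z = I.rightEntry d)}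

variable {I} {d : Demand} {ds : List Demand} {K : ℤ} {w : ℕ → ℤ}

theorem exists_cut (hd : d ∈ ds) {h₀ : ℕ} (hh₀ : h₀ ≤ I.P.card) :
    ∃ c < ds.length * (I.P.card + 1), I.cutDemand ds c = d ∧ I.cutRow c = h₀ := by
  obtain ⟨e, he, rfl⟩ := List.getElem_of_mem hd
  refine ⟨e * (I.P.card + 1) + h₀, by nlinarith, ?_, ?_⟩
  · rw [cutDemand, mul_comm, Nat.mul_add_div (Nat.succ_pos _), Nat.div_eq_of_lt (by omega),
      add_zero, List.getD_eq_getElem _ _ he]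
  · rw [cutRow, mul_comm, Nat.mul_add_mod, Nat.mod_eq_of_lt (by omega)]

theorem cutDemand_mem {c : ℕ} (hc : c < ds.length * (I.P.card + 1)) : I.cutDemand ds c ∈ ds := by
  rw [cutDemand, List.getD_eq_getElem _ _ (Nat.div_lt_of_lt_mul (by rwa [mul_comm]))]
  exact List.getElem_mem _

theorem exists_isHittingSet (hds : ∀ d ∈ ds, d ∈ I.D) {Q : Finset (ℝ × ℝ)}
    (hQ : I.Feasible (Q : Set (ℝ × ℝ))) :
    ∃ H, (I.problem ds).IsHittingSet H ∧ H.card ≤ 8 * Q.card := by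
  obtain ⟨H, hH, hcard, hhit⟩ := exists_hitting hQ
  refine ⟨H, ⟨hH, fun c hc hact => ?_⟩, hcard⟩
  obtain ⟨v, v', h₁, h₂, h₃, hout, hin⟩ := hhit _ (hds _ (cutDemand_mem hc)) hact
  rcases Nat.lt_or_ge v (I.cutRow c) with h | h
  · exact ⟨_, hout, Or.inl ⟨by omega, by omega⟩⟩
  · exact ⟨_, hin, Or.inr ⟨by omega, by omega⟩⟩

theorem netPoint_offset {o side l i v : ℕ} (hs : side < 2) (hl : l < I.depth)
    (hi : i < I.P.card) (hv : v < I.P.card) (j : ℕ) :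
    I.boundary (I.offset o side l i + v) j = (i / 2 ^ j + (1 - side)) * 2 ^ (I.depth * l + j) ∧
      I.indexRow (I.offset o side l i + v) = I.coord Prod.snd (I.orientRow o v) := by
  have hP : 0 < I.P.card := by omega
  have hrow : (I.offset o side l i + v) % I.P.card = v := by
    rw [offset, mul_comm, Nat.mul_add_mod, Nat.mod_eq_of_lt hv]
  have hdiv : (I.offset o side l i + v) / I.P.card
      = ((o * 2 + side) * I.depth + l) * I.P.card + i := by
    rw [offset, mul_comm, Nat.mul_add_div hP, Nat.div_eq_of_lt hv, add_zero]
  have hdiv₂ : (((o * 2 + side) * I.depth + l) * I.P.card + i) / I.P.card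
      = (o * 2 + side) * I.depth + l := by
    rw [mul_comm, Nat.mul_add_div hP, Nat.div_eq_of_lt hi, add_zero]
  have hdiv₃ : ((o * 2 + side) * I.depth + l) / I.depth = o * 2 + side := by
    rw [mul_comm, Nat.mul_add_div (by omega), Nat.div_eq_of_lt hl, add_zero]
  have hlevel : I.indexLevel (I.offset o side l i + v) = l := by
    rw [indexLevel, hdiv, hdiv₂, mul_comm, Nat.mul_add_mod, Nat.mod_eq_of_lt hl]
  have hstrip : I.indexStrip (I.offset o side l i + v) = i := by
    rw [indexStrip, hdiv, mul_comm, Nat.mul_add_mod, Nat.mod_eq_of_lt hi]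
  have hside : I.indexSide (I.offset o side l i + v) = side := by
    rw [indexSide, hdiv, hdiv₂, hdiv₃]
    omega
  have horientation : I.indexOrientation (I.offset o side l i + v) = o := by
    rw [indexOrientation, hdiv, hdiv₂, hdiv₃]
    omega
  exact ⟨by rw [boundary, hlevel, hstrip, hside], by rw [indexRow, horientation, hrow]⟩

theorem mem_netPoints {o side l i v j : ℕ} (ho : o < 2) (hs : side < 2) (hl : l < I.depth)
    (hi : i < I.P.card) (hv : v < I.P.card) (hJ : Jump I.size K w (I.offset o side l i + v))
    (hj : j < I.depth) (hb : (i / 2 ^ j + (1 - side)) * 2 ^ (I.depth * l + j) < I.P.card) :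
    (I.coord Prod.fst ((i / 2 ^ j + (1 - side)) * 2 ^ (I.depth * l + j)),
      I.coord Prod.snd (I.orientRow o v)) ∈ I.netPoints K w := by
  obtain ⟨hboundary, hrow⟩ := netPoint_offset (I := I) (o := o) hs hl hi hv j
  exact ⟨_, offset_add_lt ho hs hl hi hv, hJ, j, hj, by rwa [hboundary], by rw [hboundary, hrow]⟩

theorem firstRow_lt (hd : d ∈ I.D) : I.firstRow d < I.P.card :=
  orientRow_lt (rank_lt_card (f := Prod.snd) (leftEnd_mem hd))

theorem lastRow_lt (hd : d ∈ I.D) : I.lastRow d < I.P.card :=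
  orientRow_lt (rank_lt_card (f := Prod.snd) (rightEnd_mem hd))

theorem exists_jump_pair_of_good (hds : d ∈ ds) (hd : d ∈ I.D) (hne : d.1 ≠ d.2) (hK : 0 ≤ K)
    (hw : ∀ u, 1 ≤ w u) (hgood : (I.problem ds).Good K w) :
    ∃ v v', I.firstRow d ≤ v ∧ v ≤ v' ∧ v' ≤ I.lastRow d ∧
      Jump I.size K w (I.outOffset d + v) ∧ Jump I.size K w (I.inOffset d + v') := by
  have hsize : 0 < I.size :=
    (Nat.zero_le _).trans_lt (offset_add_lt (side := 0) two_pos two_pos (demandLevel_spec hd hne).1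
      ((Nat.zero_le _).trans_lt (leftRank_lt hd)) (firstRow_lt hd))
  refine exists_jump_pair hw hK hsize (lastRow_lt hd) fun h₀ hh₀ => ?_
  obtain ⟨c, hc, rfl, rfl⟩ := exists_cut (I := I) hds hh₀
  have hheavy := hgood c hc
  rw [HitProblem.Light, not_and, not_lt] at hheavy
  classical
  exact (hheavy hne).trans_eq
    (congrArg _ (Finset.sum_congr rfl fun _ _ => if_congr Iff.rfl rfl rfl))

theorem row_between {v v' : ℕ} (hd : d ∈ I.D) (h₁ : I.firstRow d ≤ v) (h₂ : v ≤ v')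
    (h₃ : v' ≤ I.lastRow d) :
    ((leftEnd d).2 ≤ I.coord Prod.snd (I.orientRow (I.orientation d) v) ∧
      I.coord Prod.snd (I.orientRow (I.orientation d) v) ≤
        I.coord Prod.snd (I.orientRow (I.orientation d) v') ∧
      I.coord Prod.snd (I.orientRow (I.orientation d) v') ≤ (rightEnd d).2) ∨
    ((rightEnd d).2 ≤ I.coord Prod.snd (I.orientRow (I.orientation d) v') ∧
      I.coord Prod.snd (I.orientRow (I.orientation d) v') ≤
        I.coord Prod.snd (I.orientRow (I.orientation d) v) ∧
      I.coord Prod.snd (I.orientRow (I.orientation d) v) ≤ (leftEnd d).2) := by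
  have hleft : I.coord Prod.snd (I.rank Prod.snd (leftEnd d).2) = (leftEnd d).2 :=
    coord_rank (f := Prod.snd) injOn_snd (leftEnd_mem hd)
  have hright : I.coord Prod.snd (I.rank Prod.snd (rightEnd d).2) = (rightEnd d).2 :=
    coord_rank (f := Prod.snd) injOn_snd (rightEnd_mem hd)
  have hleftRank : I.rank Prod.snd (leftEnd d).2 < I.P.card :=
    rank_lt_card (f := Prod.snd) (leftEnd_mem hd)
  have hrightRank : I.rank Prod.snd (rightEnd d).2 < I.P.card :=
    rank_lt_card (f := Prod.snd) (rightEnd_mem hd)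
  rw [← hleft, ← hright]
  unfold firstRow at h₁
  unfold lastRow at h₃
  rcases Nat.lt_or_ge (I.rank Prod.snd (rightEnd d).2) (I.rank Prod.snd (leftEnd d).2) with h | h
  · simp only [show I.orientation d = 1 from if_pos h, orientRow, if_true] at h₁ h₃ ⊢
    right
    refine ⟨coord_mono injOn_snd ?_ ?_, coord_mono injOn_snd ?_ ?_, coord_mono injOn_snd ?_ ?_⟩
      <;> omega
  · simp only [show I.orientation d = 0 from if_neg h.not_gt, orientRow, zero_ne_one,
      if_false] at h₁ h₃ ⊢
    left
    refine ⟨coord_mono injOn_snd ?_ ?_, coord_mono injOn_snd ?_ ?_, coord_mono injOn_snd ?_ ?_⟩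
      <;> omega

/-- A demand is satisfied by the staircase that leaves its first strip in a row of the net, crosses
the common boundary of the two strips, and enters the last strip in a later row of the net. -/
theorem mconnected_of_good {Z : Set (ℤ × ℤ)} (hds : d ∈ ds) (hd : d ∈ I.D) (hne : d.1 ≠ d.2)
    (hK : 0 ≤ K) (hw : ∀ u, 1 ≤ w u) (hgood : (I.problem ds).Good K w)
    (hZ : I.netPoints K w ∪ I.endPoints ⊆ Z) :
    MConnected (toPlane '' (I.P : Set (ℤ × ℤ)) ∪ toPlane '' Z)
      (toPlane (leftEnd d)) (toPlane (rightEnd d)) := by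
  obtain ⟨v, v', h₁, h₂, h₃, hJ, hJ'⟩ := exists_jump_pair_of_good hds hd hne hK hw hgood
  obtain ⟨hl, hstrip, hparent⟩ := demandLevel_spec hd hne
  obtain ⟨t, ht, hbit, hx₁, hx₂, hx₃, hx₄⟩ := exists_boundaries hstrip hparent
  have ho : I.orientation d < 2 := orientation_lt d
  have hb₃ := hx₄.trans_lt (rightRank_lt hd)
  have hb₂ := hx₃.trans_lt hb₃
  have hlast := lastRow_lt hd
  have hi := (strip_le I.depth (I.demandLevel d) (I.leftRank d)).trans_lt (leftRank_lt hd)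
  have hj := (strip_le I.depth (I.demandLevel d) (I.rightRank d)).trans_lt (rightRank_lt hd)
  have hmem {x y : ℤ} (h : (x, y) ∈ I.netPoints K w ∪ I.endPoints) :
      ((x : ℝ), (y : ℝ)) ∈ toPlane '' (I.P : Set (ℤ × ℤ)) ∪ toPlane '' Z := Or.inr ⟨_, hZ h, rfl⟩
  have hout {j : ℕ} := mem_netPoints (j := j) ho two_pos hl hi (by omega) hJ
  have hin {j : ℕ} := mem_netPoints (j := j) ho one_lt_two hl hj (by omega) hJ'
  have hexit := hout (j := 0) (by omega) (by simpa using hx₂.trans_lt hb₂)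
  have hcross := hout ht hb₂
  have hcross' := hin ht (by simpa [hbit] using hb₂)
  have hentry := hin (j := 0) (by omega) (by simpa using hb₃)
  simp only [pow_zero, Nat.div_one, Nat.sub_zero, Nat.sub_self, add_zero, hbit]
    at hexit hcross hcross' hentry
  refine mconnected_staircase ?_ (by simpa only [Int.cast_le] using row_between hd h₁ h₂ h₃)
    (Or.inl ⟨_, leftEnd_mem hd, rfl⟩) (hmem (Or.inr ⟨d, hd, hne, Or.inl rfl⟩))
    (hmem (Or.inl hexit)) (hmem (Or.inl hcross)) (hmem (Or.inl hcross')) (hmem (Or.inl hentry))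
    (hmem (Or.inr ⟨d, hd, hne, Or.inr rfl⟩)) (Or.inl ⟨_, rightEnd_mem hd, rfl⟩)
  have hleft : I.coord Prod.fst (I.leftRank d) = (leftEnd d).1 :=
    coord_rank (f := Prod.fst) injOn_fst (leftEnd_mem hd)
  have hright : I.coord Prod.fst (I.rightRank d) = (rightEnd d).1 :=
    coord_rank (f := Prod.fst) injOn_fst (rightEnd_mem hd)
  simp only [Int.cast_le, ← hleft, ← hright]
  exact ⟨coord_mono injOn_fst hx₁ (hx₂.trans_lt hb₂), coord_mono injOn_fst hx₂ hb₂,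
    coord_mono injOn_fst hx₃ hb₃, coord_mono injOn_fst hx₄ (rightRank_lt hd)⟩

theorem mconnected_of_eq {Q : Set (ℝ × ℝ)} (hd : d ∈ I.D) (heq : d.1 = d.2) :
    MConnected (toPlane '' (I.P : Set (ℤ × ℤ)) ∪ Q) (toPlane d.1) (toPlane d.2) :=
  ⟨0, fun _ => toPlane d.1, rfl, by rw [heq], fun _ _ => Or.inl ⟨d.1, (I.demand_mem d hd).1, rfl⟩,
    by simp, by simp [heq, l1Dist]⟩

theorem feasible_of_forall_eq (h : ∀ d ∈ I.D, d.1 = d.2) (Q : Set (ℝ × ℝ)) : I.Feasible Q :=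
  fun d hd => mconnected_of_eq hd (h d hd)

theorem feasible_of_good {Z : Set (ℤ × ℤ)} (hds : ∀ d ∈ I.D, d ∈ ds) (hK : 0 ≤ K)
    (hw : ∀ u, 1 ≤ w u) (hgood : (I.problem ds).Good K w)
    (hZ : I.netPoints K w ∪ I.endPoints ⊆ Z) : I.Feasible (toPlane '' Z) := by
  intro d hd
  by_cases hne : d.1 = d.2
  · exact mconnected_of_eq hd hne
  · exact mconnected_iff_leftEnd_rightEnd.2 (mconnected_of_good (hds d hd) hd hne hK hw hgood hZ)

open Classical in
theorem exists_card_le_netPoints_subset (hK : 0 ≤ K) (hw : ∀ u, 1 ≤ w u) :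
    ∃ A : Finset (ℤ × ℤ), I.netPoints K w ⊆ A ∧ (A.card : ℤ) ≤ 8 * K * I.depth := by
  refine ⟨(((Finset.range I.size).filter (Jump I.size K w)) ×ˢ Finset.range I.depth).image
    fun c => (I.coord Prod.fst (I.boundary c.1 c.2), I.indexRow c.1), ?_, ?_⟩
  · rintro z ⟨u, hu, hJ, j, hj, -, rfl⟩
    exact Finset.mem_coe.2 (Finset.mem_image.2 ⟨(u, j), by simp [hu, hJ, hj], rfl⟩)
  · have hnet := card_jumps_le (N := I.size) hK fun u => zero_le_one.trans (hw u)
    refine (Nat.cast_le.2 Finset.card_image_le).trans ?_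
    rw [Finset.card_product, Finset.card_range, Nat.cast_mul]
    gcongr

theorem leftEnd_mem_ends (hd : d ∈ I.D) (hne : d.1 ≠ d.2) : leftEnd d ∈ I.ends :=
  Finset.mem_union_left _ (Finset.mem_image_of_mem _ (Finset.mem_filter.2 ⟨hd, hne⟩))

theorem rightEnd_mem_ends (hd : d ∈ I.D) (hne : d.1 ≠ d.2) : rightEnd d ∈ I.ends :=
  Finset.mem_union_right _ (Finset.mem_image_of_mem _ (Finset.mem_filter.2 ⟨hd, hne⟩))

/-- Several demands share an end, but the point next to it only depends on the level of the
demand. -/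
theorem exists_card_le_endPoints_subset :
    ∃ A : Finset (ℤ × ℤ), I.endPoints ⊆ A ∧ A.card ≤ 2 * (I.ends.card * I.depth) := by
  classical
  let boundaryAt (side : ℕ) (c : (ℤ × ℤ) × ℕ) : ℤ × ℤ :=
    (I.coord Prod.fst
      ((strip I.depth c.2 (I.rank Prod.fst c.1.1) + side) * 2 ^ (I.depth * c.2)), c.1.2)
  let pairs := I.ends ×ˢ Finset.range I.depth
  refine ⟨pairs.image (boundaryAt 1) ∪ pairs.image (boundaryAt 0), ?_, ?_⟩
  · rintro z ⟨d, hd, hne, rfl | rfl⟩ <;> have hl := (demandLevel_spec hd hne).1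
    · exact Finset.mem_union_left _ (Finset.mem_image.2 ⟨(leftEnd d, I.demandLevel d),
        Finset.mem_product.2 ⟨leftEnd_mem_ends hd hne, Finset.mem_range.2 hl⟩, rfl⟩)
    · exact Finset.mem_union_right _ (Finset.mem_image.2 ⟨(rightEnd d, I.demandLevel d),
        Finset.mem_product.2 ⟨rightEnd_mem_ends hd hne, Finset.mem_range.2 hl⟩, rfl⟩)
  · have hpairs : pairs.card = I.ends.card * I.depth := by simp [pairs]
    have hright : (pairs.image (boundaryAt 1)).card ≤ pairs.card := Finset.card_image_le
    have hleft : (pairs.image (boundaryAt 0)).card ≤ pairs.card := Finset.card_image_le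
    have hunion := Finset.card_union_le (pairs.image (boundaryAt 1)) (pairs.image (boundaryAt 0))
    omega

theorem card_le_of_subset {Z : Finset (ℤ × ℤ)} (hK : 0 ≤ K) (hw : ∀ u, 1 ≤ w u)
    (hZ : (Z : Set (ℤ × ℤ)) ⊆ insert 0 (I.netPoints K w ∪ I.endPoints)) :
    (Z.card : ℤ) ≤ 1 + 8 * K * I.depth + 2 * (I.ends.card * I.depth) := by
  classical
  obtain ⟨A, hA, hAcard⟩ := exists_card_le_netPoints_subset (I := I) hK hw
  obtain ⟨B, hB, hBcard⟩ := exists_card_le_endPoints_subset (I := I)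
  have hsub : Z ⊆ insert 0 (A ∪ B) := by
    rw [← Finset.coe_subset, Finset.coe_insert, Finset.coe_union]
    exact hZ.trans (Set.insert_subset_insert (Set.union_subset_union hA hB))
  have hZcard := (Finset.card_le_card hsub).trans
    ((Finset.card_insert_le _ _).trans (Nat.succ_le_succ (Finset.card_union_le A B)))
  zify at hZcard hBcard
  linarith

theorem depth_le (h : 2 ≤ I.P.card) : (I.depth : ℝ) ≤ 3 * √(Real.log I.P.card) := by
  have hlog : Real.log 2 ≤ Real.log I.P.card :=
    Real.log_le_log two_pos (by exact_mod_cast h)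
  have hlog_two := Real.log_two_gt_d9
  have hsq : (I.depth : ℝ) ^ 2 ≤ 9 * Real.log I.P.card := by
    rcases hdepth : I.depth with _ | m
    · norm_num
      linarith
    · have hpow : (2 : ℝ) ^ (m * m) ≤ I.P.card := by
        exact_mod_cast (I.depth_spec.2 m (by omega)).le
      have hm := Real.log_le_log (by positivity) hpow
      rw [Real.log_pow] at hm
      push_cast at hm ⊢
      nlinarith [sq_nonneg ((m : ℝ) - 1), mul_self_nonneg (m : ℝ)]
  calc (I.depth : ℝ) ≤ √(9 * Real.log I.P.card) := Real.le_sqrt_of_sq_le hsq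
    _ = 3 * √(Real.log I.P.card) := by
      rw [Real.sqrt_mul (by norm_num), show (9 : ℝ) = 3 ^ 2 by norm_num, Real.sqrt_sq (by norm_num)]

variable (I) in
/-- Bend every demand once. -/
theorem exists_feasible : ∃ Q : Finset (ℝ × ℝ), I.Feasible (Q : Set (ℝ × ℝ)) := by
  classical
  refine ⟨I.D.image fun d => toPlane (d.1.1, d.2.2), fun d hd => ?_⟩
  refine ⟨2, fun i => [toPlane d.1, toPlane (d.1.1, d.2.2), toPlane d.2].getD i 0, rfl, rfl,
    fun i hi => ?_, fun i hi => ?_, ?_⟩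
  · interval_cases i
    · exact Or.inl ⟨d.1, (I.demand_mem d hd).1, rfl⟩
    · exact Or.inr (by simpa using ⟨_, _, _, _, hd, rfl⟩)
    · exact Or.inl ⟨d.2, (I.demand_mem d hd).2, rfl⟩
  · interval_cases i <;> simp [Aligned, toPlane]
  · simp [Finset.sum_range_succ, l1Dist, toPlane, add_comm]

variable (I) in
theorem exists_feasible_card_eq_opt :
    ∃ Q : Finset (ℝ × ℝ), I.Feasible (Q : Set (ℝ × ℝ)) ∧ Q.card = I.opt :=
  Nat.sInf_mem (s := {k | ∃ Q : Finset (ℝ × ℝ), I.Feasible (Q : Set (ℝ × ℝ)) ∧ Q.card = k})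
    (I.exists_feasible.imp' Finset.card fun Q hQ => ⟨Q, hQ, rfl⟩)

theorem card_le_opt {Z : Finset (ℤ × ℤ)} (hd : d ∈ I.D) (hne : d.1 ≠ d.2) (hK : 0 ≤ K)
    (hw : ∀ u, 1 ≤ w u)
    (hKQ : ∀ Q : Finset (ℝ × ℝ), I.Feasible (Q : Set (ℝ × ℝ)) → K ≤ 8 * Q.card)
    (hZ : (Z : Set (ℤ × ℤ)) ⊆ insert 0 (I.netPoints K w ∪ I.endPoints)) :
    (Z.card : ℝ) ≤ 207 * √(Real.log I.P.card) * (I.opt : ℝ) := by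
  obtain ⟨Q, hQ, hopt⟩ := I.exists_feasible_card_eq_opt
  have hKopt := hKQ Q hQ
  have hends := card_ends_le hQ
  rw [hopt] at hKopt hends
  have hends_pos : 0 < I.ends.card := Finset.card_pos.2 ⟨_, leftEnd_mem_ends hd hne⟩
  have hdepth_pos : 0 < I.depth := (Nat.zero_le _).trans_lt (demandLevel_spec hd hne).1
  have hcard : 2 ≤ I.P.card := by
    have := leftRank_lt_rightRank hd hne
    have := rightRank_lt hd
    omega
  have hbound : (Z.card : ℤ) ≤ 69 * (I.depth * I.opt) := by
    have hnet : 8 * K * I.depth ≤ 8 * (8 * I.opt) * I.depth := by gcongr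
    have hend : (I.ends.card : ℤ) * I.depth ≤ 2 * I.opt * I.depth := by
      gcongr
      exact_mod_cast hends
    have hone : (1 : ℤ) ≤ I.depth * I.opt :=
      mod_cast Nat.mul_pos hdepth_pos (show 0 < I.opt by omega)
    linarith [card_le_of_subset hK hw hZ]
  calc (Z.card : ℝ) ≤ 69 * (I.depth * I.opt) := by exact_mod_cast hbound
    _ ≤ 69 * (3 * √(Real.log I.P.card) * I.opt) := by
      gcongr
      exact depth_le hcard
    _ = 207 * √(Real.log I.P.card) * I.opt := by ring

end Instance

/-! ### Terms -/

namespace Term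

instance : Add Term := ⟨.bin .add⟩
instance : Sub Term := ⟨.bin .sub⟩
instance : Mul Term := ⟨.bin .mul⟩
instance : Div Term := ⟨.bin .div⟩
instance (n : ℕ) : OfNat Term n := ⟨.const n⟩

/-- The test `t < u`. -/
def lt (t u : Term) : Term := u - t

/-- The test `t ≤ u`. -/
def le (t u : Term) : Term := u - t + 1

/-- The conjunction of two tests. -/
def and (t u : Term) : Term := .ite t u 0

/-- The disjunction of two tests. -/
def or (t u : Term) : Term := .ite t 1 u

/-- The negation of a test. -/
def not (t : Term) : Term := .ite t 0 1

/-- The test `t = u`. -/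
def eq (t u : Term) : Term := and (le t u) (le u t)

/-- The value `1` if the test succeeds, and `0` otherwise. -/
def ind (t : Term) : Term := .ite t 1 0

/-- The remainder. -/
def mod (t u : Term) : Term := t - u * (t / u)

variable (t u : Term) (s : Store)

@[simp] theorem eval_const (c : ℤ) : (const c).eval s = c := rfl

@[simp] theorem eval_zero : (0 : Term).eval s = 0 := rfl

@[simp] theorem eval_one : (1 : Term).eval s = 1 := rfl

@[simp] theorem eval_ofNat (n : ℕ) [n.AtLeastTwo] :
    (ofNat(n) : Term).eval s = (ofNat(n) : ℤ) := rfl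

@[simp] theorem eval_var (x : ℕ) : (var x).eval s = s.var x := rfl

@[simp] theorem eval_read (a : ℕ) : (read a t).eval s = s.arr a (t.eval s) := rfl

@[simp] theorem eval_add : (t + u).eval s = t.eval s + u.eval s := rfl

@[simp] theorem eval_sub : (t - u).eval s = t.eval s - u.eval s := rfl

@[simp] theorem eval_mul : (t * u).eval s = t.eval s * u.eval s := rfl

@[simp] theorem eval_div : (t / u).eval s = t.eval s / u.eval s := rfl

@[simp] theorem eval_ite (c : Term) :
    (ite c t u).eval s = if 0 < c.eval s then t.eval s else u.eval s := rfl

@[simp] theorem eval_sum (x r : ℕ) :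
    (agg .sum x r t).eval s = ∑ i ∈ Finset.range (s.var r).toNat, t.eval (s.setVar x i) :=
  Aggregation.eval_sum _ _

@[simp] theorem eval_prod (x r : ℕ) :
    (agg .prod x r t).eval s = ∏ i ∈ Finset.range (s.var r).toNat, t.eval (s.setVar x i) :=
  Aggregation.eval_prod _ _

@[simp] theorem lt_pos : 0 < (lt t u).eval s ↔ t.eval s < u.eval s := sub_pos

@[simp] theorem le_pos : 0 < (le t u).eval s ↔ t.eval s ≤ u.eval s := by
  simp only [le, eval_add, eval_sub, eval_one]
  omega

@[simp] theorem and_pos : 0 < (and t u).eval s ↔ 0 < t.eval s ∧ 0 < u.eval s := by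
  simp only [and, eval_ite, eval_zero]
  split_ifs <;> simp_all

@[simp] theorem or_pos : 0 < (or t u).eval s ↔ 0 < t.eval s ∨ 0 < u.eval s := by
  simp only [or, eval_ite, eval_one]
  split_ifs <;> simp_all

@[simp] theorem not_pos : 0 < (not t).eval s ↔ ¬ 0 < t.eval s := by
  simp only [not, eval_ite, eval_zero, eval_one]
  split_ifs <;> simp_all

@[simp] theorem eq_pos : 0 < (eq t u).eval s ↔ t.eval s = u.eval s := by
  simp only [eq, and_pos, le_pos]
  omega

@[simp] theorem eval_ind : (ind t).eval s = if 0 < t.eval s then 1 else 0 := rfl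

@[simp] theorem eval_mod : (mod t u).eval s = t.eval s % u.eval s := by
  simp only [mod, eval_sub, eval_mul, eval_div, Int.emod_def]

end Term

/-! ### Polynomial growth of bit lengths -/

theorem Stm.Safe.mono {S B B' : ℕ} (hB : B ≤ B') {c : Stm} {s : Store} (h : c.Safe S B s) :
    c.Safe S B' s := by
  induction c generalizing s with
  | set x t => exact ⟨h.1.mono hB, h.2.mono hB⟩
  | tab a x r t => exact ⟨h.1.mono hB, h.2.mono hB⟩
  | seq c d ihc ihd => exact ⟨ihc h.1, ihd h.2⟩
  | rep r c ih => exact ⟨h.1.mono hB, fun i hi => ih (h.2 i hi)⟩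

/-- The statement maps bounded stores to polynomially bounded stores, through polynomially bounded
ones. Straight-line statements have this property; repetitions in general do not, since iterated
squaring is one. -/
def Stm.Tame (S : ℕ) (c : Stm) : Prop :=
  ∃ q : Polynomial ℕ, ∀ B s, s.Bounded S B →
    B ≤ q.eval B ∧ c.Safe S (q.eval B) s ∧ Store.Bounded S (q.eval B) (c.eval s)

/-- The value of the term is polynomial in the bound of the store, so that it may be assigned to a
register; a general term may have exponentially large values, which only arrays may hold. -/
def Term.Small (S : ℕ) (t : Term) : Prop :=
  ∃ q : Polynomial ℕ, ∀ B s, s.Bounded S B → |t.eval s| ≤ q.eval B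

theorem Term.small_const (S : ℕ) (c : ℤ) : (Term.const c).Small S :=
  ⟨Polynomial.C c.natAbs, fun B s _ => by simp⟩

theorem Term.small_ofNat (S n : ℕ) : (OfNat.ofNat n : Term).Small S := Term.small_const S n

theorem Term.small_var {S x : ℕ} (hx : x < S) : (Term.var x).Small S :=
  ⟨Polynomial.X, fun B s h => by simpa using h.1 x hx⟩

theorem Term.Small.add {S : ℕ} {t u : Term} (ht : t.Small S) (hu : u.Small S) :
    (t + u).Small S := by
  obtain ⟨p, hp⟩ := ht
  obtain ⟨q, hq⟩ := hu
  refine ⟨p + q, fun B s h => ?_⟩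
  rw [Polynomial.eval_add]
  push_cast
  exact (abs_add_le _ _).trans (add_le_add (hp B s h) (hq B s h))

theorem Term.Small.mul {S : ℕ} {t u : Term} (ht : t.Small S) (hu : u.Small S) :
    (t * u).Small S := by
  obtain ⟨p, hp⟩ := ht
  obtain ⟨q, hq⟩ := hu
  refine ⟨p * q, fun B s h => ?_⟩
  rw [Polynomial.eval_mul, Term.eval_mul, abs_mul]
  push_cast
  exact mul_le_mul (hp B s h) (hq B s h) (abs_nonneg _) (Nat.cast_nonneg _)

theorem Term.Small.ite {S : ℕ} {c t u : Term} (ht : t.Small S) (hu : u.Small S) :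
    (Term.ite c t u).Small S := by
  obtain ⟨p, hp⟩ := ht
  obtain ⟨q, hq⟩ := hu
  refine ⟨p + q, fun B s h => ?_⟩
  rw [Polynomial.eval_add, Term.eval_ite]
  push_cast
  split_ifs
  · exact (hp B s h).trans (by simp)
  · exact (hq B s h).trans (by simp)

theorem Term.Small.sum {S x r : ℕ} {t : Term} (hr : r < S) (ht : t.Small S) :
    (Term.agg .sum x r t).Small S := by
  obtain ⟨p, hp⟩ := ht
  refine ⟨Polynomial.X * p, fun B s h => ?_⟩
  rw [Term.eval_sum, Polynomial.eval_mul, Polynomial.eval_X]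
  refine (Finset.abs_sum_le_sum_abs _ _).trans ?_
  refine (Finset.sum_le_card_nsmul _ _ ((p.eval B : ℕ) : ℤ) fun i hi => ?_).trans ?_
  · exact hp B _ (h.setVar_nat hr x (Finset.mem_range.1 hi).le)
  · rw [Finset.card_range, nsmul_eq_mul]
    push_cast
    gcongr
    exact h.toNat_le hr

theorem Stm.tame_set {S x : ℕ} {t : Term} (ht : t.Small S) : (Stm.set x t).Tame S := by
  obtain ⟨p, hp⟩ := ht
  refine ⟨Polynomial.X + p, fun B s h => ?_⟩
  simp only [Polynomial.eval_add, Polynomial.eval_X]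
  have h1 := h.mono (B' := B + p.eval B) (by omega)
  have h2 : Store.Bounded S (B + p.eval B) ((Stm.set x t).eval s) :=
    h1.setVar x ((hp B s h).trans (by push_cast; linarith))
  exact ⟨by omega, ⟨h1, h2⟩, h2⟩

theorem Stm.tame_tab {S a x r : ℕ} {t : Term} (hr : r < S) (ht : t.wf S) :
    (Stm.tab a x r t).Tame S := by
  obtain ⟨p, hp⟩ := t.exists_abs_eval_le ht
  refine ⟨Polynomial.X + p, fun B s h => ?_⟩
  simp only [Polynomial.eval_add, Polynomial.eval_X]
  have h1 := h.mono (B' := B + p.eval B) (by omega)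
  have h2 : Store.Bounded S (B + p.eval B) ((Stm.tab a x r t).eval s) := by
    refine h1.setCells a fun i hi hir => ?_
    have := hp B _ (h.setVar_nat hr x (i := i.toNat) (by omega))
    rw [Int.toNat_of_nonneg hi] at this
    exact this.trans (pow_le_pow_right₀ (by norm_num) (by omega))
  exact ⟨by omega, ⟨h1, h2⟩, h2⟩

theorem Stm.Tame.seq {S : ℕ} {c d : Stm} (hc : c.Tame S) (hd : d.Tame S) : (c.seq d).Tame S := by
  obtain ⟨p, hp⟩ := hc
  obtain ⟨q, hq⟩ := hd
  refine ⟨q.comp p, fun B s h => ?_⟩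
  rw [Polynomial.eval_comp]
  obtain ⟨h1, h2, h3⟩ := hp B s h
  obtain ⟨h4, h5, h6⟩ := hq _ _ h3
  exact ⟨h1.trans h4, ⟨h2.mono h4, h5⟩, h6⟩

/-! ### The algorithm

Registers: `0` the number of points, `1` the number of demands, `2` the number of output points, `3`
the depth of the tree, `4` the number of indices, `5` the number of cuts, `7` the number of rounds,
`8` the number of slots of the output, `10` the parameter `K`; `6` and `9` hold the contents of `4`
and `3` plus one, `11` a flag, and `20`, `21`, `22` are the bound variables.

Arrays: `0`-`5` the input, `6`, `7` the output, `8`-`18` the data of the demands, `19`, `20` the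
coordinates by rank, `21` the weights and `22` a copy of them, `23` the light cuts, `24` the first
light cut, `25` the jumps, `26`, `27` powers of two, `28` the ranks of the columns of the slots, and
`29` the slots that are in use. The slots are the pairs of an index and a boundary, followed by the
two ends of each demand; the unused ones output the origin. -/

namespace Algo

open Term

/-- The cell of the array `a` whose index is in register `20`. -/
def cell (a : ℕ) : Term := read a (var 20)

/-- The rank of the value of `e` in the array `a` of coordinates of the input points. -/
def rankT (a : ℕ) (e : Term) : Term := agg .sum 22 0 (ind (lt (read a (var 22)) e))

/-- The depth of the tree. -/
def depthT : Term := agg .sum 20 0 (ind (lt (agg .prod 21 20 (agg .prod 22 20 2)) (var 0)))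

/-- Compute the depth of the tree and the sizes. -/
def sizesStm : Stm :=
  .seq (.set 3 depthT) <|
  .seq (.set 4 (4 * var 3 * var 0 * var 0)) <|
  .seq (.set 5 (var 1 * (var 0 + 1))) <|
  .seq (.set 6 (var 4 + 1)) <|
  .seq (.set 7 (2 * var 4 * var 4 + 1)) <|
  .seq (.set 8 (var 4 * var 3 + 2 * var 1)) <|
  .set 9 (var 3 + 1)

/-- The coordinate in the array `a` whose rank is in register `20`. -/
def coordT (a : ℕ) : Term :=
  agg .sum 21 0 (ite (eq (rankT a (read a (var 21))) (var 20)) (read a (var 21)) 0)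

/-- Compute the powers of two and the coordinates by rank. -/
def coordsStm : Stm :=
  .seq (.tab 26 20 9 (agg .prod 21 20 (agg .prod 22 3 2))) <|
  .seq (.tab 27 20 9 (agg .prod 21 20 2)) <|
  .seq (.tab 19 20 0 (coordT 0)) <|
  .tab 20 20 0 (coordT 1)

/-- The test whether the two points of the demand are different. -/
def activeT : Term := or (not (eq (cell 2) (cell 4))) (not (eq (cell 3) (cell 5)))

/-- The cell of the array `a` if the first point of the demand is the left one, and that of `b`
otherwise. -/
def selectT (a b : ℕ) : Term := ite (lt (cell 2) (cell 4)) (cell a) (cell b)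

/-- The orientation of the demand. -/
def orientationT : Term := ind (lt (rankT 1 (cell 18)) (rankT 1 (cell 17)))

/-- The level of the demand. -/
def levelT : Term :=
  agg .sum 21 3 (ind (not (eq (cell 8 / read 26 (var 21 + 1)) (cell 9 / read 26 (var 21 + 1)))))

/-- The rank of the row in the array `a`, in the orientation of the demand. -/
def orientRowT (a : ℕ) : Term :=
  ite (cell 12) (var 0 - 1 - rankT 1 (cell a)) (rankT 1 (cell a))

/-- The offset of the strip, at the level of the demand, of the rank in the array `a`. -/
def offsetT (side a : ℕ) : Term :=
  (((cell 12 * 2 + const side) * var 3 + cell 13) * var 0 + cell a / read 26 (cell 13)) * var 0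

/-- Compute the data of the demands. -/
def demandsStm : Stm :=
  .seq (.tab 16 20 1 (ind activeT)) <|
  .seq (.tab 8 20 1 (rankT 0 (selectT 2 4))) <|
  .seq (.tab 9 20 1 (rankT 0 (selectT 4 2))) <|
  .seq (.tab 17 20 1 (selectT 3 5)) <|
  .seq (.tab 18 20 1 (selectT 5 3)) <|
  .seq (.tab 12 20 1 orientationT) <|
  .seq (.tab 13 20 1 levelT) <|
  .seq (.tab 10 20 1 (orientRowT 17)) <|
  .seq (.tab 11 20 1 (orientRowT 18)) <|
  .seq (.tab 14 20 1 (offsetT 0 8)) <|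
  .tab 15 20 1 (offsetT 1 9)

/-- Start with equal weights. -/
def weightsStm : Stm := .tab 21 21 4 1

/-- The preparations. -/
def prepareStm : Stm := .seq sizesStm <| .seq coordsStm <| .seq demandsStm weightsStm

/-- The demand of the cut in register `20`. -/
def cutDemandT : Term := var 20 / (var 0 + 1)

/-- The row of the cut in register `20`. -/
def cutRowT : Term := mod (var 20) (var 0 + 1)

/-- The test whether the set of the cut in register `20` contains the index in register `21`. -/
def memT : Term :=
  or (and (le (read 14 cutDemandT + read 10 cutDemandT) (var 21))
      (lt (var 21) (read 14 cutDemandT + cutRowT)))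
    (and (le (read 15 cutDemandT + cutRowT) (var 21))
      (le (var 21) (read 15 cutDemandT + read 11 cutDemandT)))

/-- The weight of the set of the cut in register `20`. -/
def cutWeightT : Term := agg .sum 21 4 (ite memT (read 21 (var 21)) 0)

/-- The total weight. -/
def totalWeightT : Term := agg .sum 21 4 (read 21 (var 21))

/-- The test whether the cut in register `20` is light. -/
def lightT : Term := and (read 16 cutDemandT) (lt (4 * var 10 * cutWeightT) totalWeightT)

/-- Mark the light cuts. -/
def lightStm : Stm := .tab 23 20 5 (ind lightT)

/-- The test whether the cut in register `20` is the first light one. -/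
def firstT : Term := and (read 23 (var 20)) (not (agg .sum 21 20 (read 23 (var 21))))

/-- The weight of the index in register `21`, doubled if the first light cut contains it. -/
def doubledT : Term :=
  read 21 (var 21) * (1 + agg .sum 20 5 (ite (read 24 (var 20)) (ind memT) 0))

/-- Double the weights of the first light cut. -/
def stepStm : Stm :=
  .seq lightStm <|
  .seq (.tab 24 20 5 (ind firstT)) <|
  .seq (.tab 22 21 4 doubledT) <|
  .tab 21 21 4 (read 22 (var 21))

/-- If there is a light cut, increase the parameter and return to equal weights. -/
def resetStm : Stm :=
  .seq lightStm <|
  .seq (.set 11 (ind (agg .sum 20 5 (read 23 (var 20))))) <|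
  .seq (.set 10 (var 10 + var 11)) <|
  .seq (.tab 22 21 4 (ite (var 11) 1 (read 21 (var 21)))) <|
  .tab 21 21 4 (read 22 (var 21))

/-- Pass on to the next parameter, unless the weights are good. -/
def advanceStm : Stm := .seq resetStm (.rep 7 stepStm)

/-- The search for good weights. -/
def searchStm : Stm := .rep 6 advanceStm

/-- The scaled weight of the indices before `u`, up to the term `extra`. -/
def scaledWeightT (extra : Term) : Term :=
  8 * var 10 * (agg .sum 22 21 (read 21 (var 22)) + extra) / agg .sum 22 4 (read 21 (var 22))

/-- The test whether there is a jump at the index in register `21`. -/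
def jumpT : Term := lt (scaledWeightT 0) (scaledWeightT (read 21 (var 21)))

/-- The test whether the slot in register `20` belongs to an index. -/
def isIndexT : Term := lt (var 20) (var 4 * var 3)

/-- The index of the slot in register `20`. -/
def slotIndexT : Term := var 20 / var 3

/-- The number of the boundary of the slot in register `20`. -/
def slotBoundaryT : Term := mod (var 20) (var 3)

/-- The rank of the boundary of the slot in register `20`. -/
def boundaryT : Term :=
  (mod (slotIndexT / var 0) (var 0) / read 27 slotBoundaryT
      + (1 - mod (slotIndexT / var 0 / var 0 / var 3) 2))
    * (read 26 (mod (slotIndexT / var 0 / var 0) (var 3)) * read 27 slotBoundaryT)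

/-- The row of the index of the slot in register `20`. -/
def indexRowT : Term :=
  read 20 (ite (slotIndexT / var 0 / var 0 / var 3 / 2)
    (var 0 - 1 - mod slotIndexT (var 0)) (mod slotIndexT (var 0)))

/-- The demand of the slot in register `20`. -/
def slotDemandT : Term := (var 20 - var 4 * var 3) / 2

/-- The test whether the slot in register `20` belongs to a left end. -/
def isLeftT : Term := eq (mod (var 20 - var 4 * var 3) 2) 0

/-- The rank of the left boundary of the strip, at the level of the demand of the slot in register
`20`, that lies `k` strips to the right of the rank in the array `a`. -/
def stripStartT (a : ℕ) (k : ℤ) : Term :=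
  (read a slotDemandT / read 26 (read 13 slotDemandT) + const k) * read 26 (read 13 slotDemandT)

/-- The rank of the column of the slot in register `20`. -/
def columnT : Term := ite isIndexT boundaryT (ite isLeftT (stripStartT 8 1) (stripStartT 9 0))

/-- The row of the slot in register `20`. -/
def rowT : Term := ite isIndexT indexRowT (ite isLeftT (read 17 slotDemandT) (read 18 slotDemandT))

/-- The test whether the slot in register `20` is in use. -/
def validT : Term :=
  ite isIndexT (and (read 25 slotIndexT) (lt (cell 28) (var 0))) (read 16 slotDemandT)

/-- Compute the jumps, the columns of the slots and the slots in use. -/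
def slotsStm : Stm :=
  .seq (.tab 25 21 4 (ind jumpT)) <|
  .seq (.tab 28 20 8 columnT) <|
  .tab 29 20 8 (ind validT)

/-- The output. -/
def outputStm : Stm :=
  .seq slotsStm <|
  .seq (.tab 6 20 8 (ite (cell 29) (read 19 (cell 28)) 0)) <|
  .seq (.tab 7 20 8 (ite (cell 29) rowT 0)) <|
  .set 2 (ite (agg .sum 20 1 (cell 16)) (var 8) 0)

/-- The algorithm. -/
def algorithm : Stm := .seq prepareStm <| .seq searchStm outputStm

theorem algorithm_wf : algorithm.wf 50 = true := by decide

theorem sizesStm_tame : sizesStm.Tame 50 := by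
  have hv : ∀ x < 50, (Term.var x).Small 50 := fun _ hx => small_var hx
  have hn : ∀ n : ℕ, [n.AtLeastTwo] → (OfNat.ofNat n : Term).Small 50 := fun n _ => small_ofNat 50 n
  have h1 : (1 : Term).Small 50 := small_ofNat 50 1
  have hdepth : depthT.Small 50 :=
    Small.sum (by norm_num) (Small.ite h1 (small_ofNat 50 0))
  exact (Stm.tame_set hdepth).seq <|
    (Stm.tame_set <| (((hn 4).mul (hv 3 (by norm_num))).mul (hv 0 (by norm_num))).mul
      (hv 0 (by norm_num))).seq <|
    (Stm.tame_set <| (hv 1 (by norm_num)).mul ((hv 0 (by norm_num)).add h1)).seq <|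
    (Stm.tame_set <| (hv 4 (by norm_num)).add h1).seq <|
    (Stm.tame_set <| (((hn 2).mul (hv 4 (by norm_num))).mul (hv 4 (by norm_num))).add h1).seq <|
    (Stm.tame_set <| ((hv 4 (by norm_num)).mul (hv 3 (by norm_num))).add
      ((hn 2).mul (hv 1 (by norm_num)))).seq <|
    Stm.tame_set <| (hv 3 (by norm_num)).add h1

theorem prepareStm_tame : prepareStm.Tame 50 := by
  refine sizesStm_tame.seq ?_
  unfold coordsStm demandsStm weightsStm
  repeat' first
    | exact Stm.tame_tab (by norm_num) (by decide)
    | apply Stm.Tame.seq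

theorem outputStm_tame : outputStm.Tame 50 := by
  unfold outputStm slotsStm
  repeat' first
    | exact Stm.tame_tab (by norm_num) (by decide)
    | exact Stm.tame_set (Small.ite (small_var (by norm_num)) (small_ofNat _ _))
    | apply Stm.Tame.seq

end Algo

/-! ### Correctness of the preparations -/

theorem sum_range_getD {α : Type*} (l : List α) (g : α → ℤ) (x : α) :
    ∑ i ∈ Finset.range l.length, g (l.getD i x) = (l.map g).sum := by
  induction l with
  | nil => simp
  | cons a l ih =>
    simp only [List.length_cons, Finset.sum_range_succ', List.getD_cons_succ, List.getD_cons_zero,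
      ih, List.map_cons, List.sum_cons, add_comm]

namespace Instance.ListedBy

variable {I : Instance} {ps : List (ℤ × ℤ)} {ds : List Demand}

theorem sum_points (h : I.ListedBy ps ds) (g : ℤ × ℤ → ℤ) :
    ∑ i ∈ Finset.range ps.length, g (ps.getD i 0) = ∑ p ∈ I.P, g p := by
  rw [sum_range_getD, ← List.sum_toFinset g h.nodup_points]
  exact Finset.sum_congr (by ext p; simp [h.mem_points]) fun _ _ => rfl

theorem length_points (h : I.ListedBy ps ds) : ps.length = I.P.card := by
  simpa using h.sum_points fun _ => 1

theorem sum_range_card (h : I.ListedBy ps ds) (g : ℤ × ℤ → ℤ) :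
    ∑ i ∈ Finset.range I.P.card, g (ps.getD i 0) = ∑ p ∈ I.P, g p := by
  rw [← h.length_points, h.sum_points]

theorem getD_mem (h : I.ListedBy ps ds) {i : ℕ} (hi : i < ds.length) : ds.getD i 0 ∈ I.D := by
  rw [List.getD_eq_getElem _ _ hi, ← h.mem_demands]
  exact List.getElem_mem hi

end Instance.ListedBy

namespace Algo

open Term Instance

variable (I : Instance) (ps : List (ℤ × ℤ)) (ds : List Demand)

/-- The values of the registers after the preparations. -/
def specVar : ℕ → ℤ
  | 0 => I.P.card
  | 1 => ds.length
  | 3 => I.depth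
  | 4 => I.size
  | 5 => (I.problem ds).M
  | 6 => I.size + 1
  | 7 => (I.problem ds).rounds
  | 8 => I.size * I.depth + 2 * ds.length
  | 9 => I.depth + 1
  | _ => 0

/-- The number of cells of the arrays that are used. -/
def specLen : ℕ → ℕ
  | 0 | 1 | 19 | 20 => I.P.card
  | 26 | 27 => I.depth + 1
  | _ => ds.length

open Classical in
/-- The contents of the arrays after the preparations. -/
noncomputable def specArr : ℕ → ℕ → ℤ
  | 0, i => (ps.getD i 0).1
  | 1, i => (ps.getD i 0).2
  | 2, i => (ds.getD i 0).1.1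
  | 3, i => (ds.getD i 0).1.2
  | 4, i => (ds.getD i 0).2.1
  | 5, i => (ds.getD i 0).2.2
  | 8, i => I.leftRank (ds.getD i 0)
  | 9, i => I.rightRank (ds.getD i 0)
  | 10, i => I.firstRow (ds.getD i 0)
  | 11, i => I.lastRow (ds.getD i 0)
  | 12, i => I.orientation (ds.getD i 0)
  | 13, i => I.demandLevel (ds.getD i 0)
  | 14, i => I.outOffset (ds.getD i 0)
  | 15, i => I.inOffset (ds.getD i 0)
  | 16, i => if (ds.getD i 0).1 ≠ (ds.getD i 0).2 then 1 else 0
  | 17, i => (leftEnd (ds.getD i 0)).2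
  | 18, i => (rightEnd (ds.getD i 0)).2
  | 19, i => I.coord Prod.fst i
  | 20, i => I.coord Prod.snd i
  | 26, i => 2 ^ (I.depth * i)
  | 27, i => 2 ^ i
  | _, _ => 0

/-- The registers below `10`, except that of the output, and the arrays in `L` have the specified
contents. -/
structure Known (L : List ℕ) (s : Store) : Prop where
  var_eq : ∀ x < 10, x ≠ 2 → s.var x = specVar I ds x
  arr_eq : ∀ a ∈ L, ∀ i < specLen I ds a, s.arr a i = specArr I ps ds a i

/-- The arrays of the input. -/
def inputArrays : List ℕ := [0, 1, 2, 3, 4, 5]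

/-- The arrays after the computation of the powers of two and of the coordinates. -/
def coordArrays : List ℕ := 20 :: 19 :: 27 :: 26 :: inputArrays

/-- The arrays after the preparations. -/
def preparedArrays : List ℕ := 15 :: 14 :: 11 :: 10 :: 13 :: 12 :: 18 :: 17 :: 9 :: 8 :: 16 ::
  coordArrays

variable {I ps ds} {L : List ℕ} {s : Store} {i : ℕ}

theorem demandLevel_lt_specLen (d : Demand) : I.demandLevel d < specLen I ds 26 := by
  have hle : I.demandLevel d ≤ I.depth := (Finset.card_filter_le _ _).trans (Finset.card_range _).le
  exact Nat.lt_succ_of_le hle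

theorem rank_eq_sum (hl : I.ListedBy ps ds) (f : ℤ × ℤ → ℤ) (z : ℤ) :
    (∑ i ∈ Finset.range I.P.card, if f (ps.getD i 0) < z then (1 : ℤ) else 0) = I.rank f z := by
  rw [hl.sum_range_card fun p => if f p < z then 1 else 0, Instance.rank]
  simp

theorem coord_eq_sum (hl : I.ListedBy ps ds) (f : ℤ × ℤ → ℤ) (m : ℕ) :
    (∑ i ∈ Finset.range I.P.card,
      if I.rank f (f (ps.getD i 0)) = m then f (ps.getD i 0) else 0) = I.coord f m :=
  hl.sum_range_card fun p => if I.rank f (f p) = m then f p else 0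

namespace Known

theorem var_zero (h : Known I ps ds L s) : s.var 0 = I.P.card :=
  h.var_eq 0 (by norm_num) (by norm_num)

theorem var_one (h : Known I ps ds L s) : s.var 1 = ds.length :=
  h.var_eq 1 (by norm_num) (by norm_num)

theorem var_three (h : Known I ps ds L s) : s.var 3 = I.depth :=
  h.var_eq 3 (by norm_num) (by norm_num)

theorem var_four (h : Known I ps ds L s) : s.var 4 = I.size :=
  h.var_eq 4 (by norm_num) (by norm_num)

theorem var_nine (h : Known I ps ds L s) : s.var 9 = ((I.depth + 1 : ℕ) : ℤ) := by
  rw [h.var_eq 9 (by norm_num) (by norm_num), Nat.cast_add_one, specVar]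

theorem of_eq {s' : Store} (h : Known I ps ds L s)
    (hv : ∀ x < 10, x ≠ 2 → s'.var x = s.var x) (ha : ∀ a ∈ L, s'.arr a = s.arr a) :
    Known I ps ds L s' :=
  ⟨fun x hx hx2 => (hv x hx hx2).trans (h.1 x hx hx2),
    fun a haL i hi => by rw [ha a haL]; exact h.2 a haL i hi⟩

theorem setVar (h : Known I ps ds L s) {x : ℕ} (hx : 10 ≤ x) (v : ℤ) :
    Known I ps ds L (s.setVar x v) :=
  h.of_eq (fun y hy _ => by rw [Store.setVar_var, if_neg (by omega)]) fun _ _ => rfl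

theorem tab (h : Known I ps ds L s) {a x r : ℕ} {t : Term} (hr : s.var r = specLen I ds a)
    (ht : ∀ i < specLen I ds a, t.eval (s.setVar x (i : ℤ)) = specArr I ps ds a i) :
    Known I ps ds (a :: L) ((Stm.tab a x r t).eval s) := by
  refine ⟨h.1, fun b hb i hi => ?_⟩
  simp only [Stm.eval, Store.setCells_arr]
  split_ifs with h1 h2
  · subst h1; exact ht i hi
  · subst h1; omega
  · exact h.2 b ((List.mem_cons.1 hb).resolve_left h1) i hi

theorem eval_cell (h : Known I ps ds L s) {a : ℕ} (ha : a ∈ L) (hi : i < specLen I ds a) :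
    (cell a).eval (s.setVar 20 i) = specArr I ps ds a i := by
  simpa [cell] using h.2 a ha i hi

theorem eval_rankT (h : Known I ps ds L s) (hl : I.ListedBy ps ds) {a : ℕ} {f : ℤ × ℤ → ℤ}
    (ha : a ∈ L) (hlen : specLen I ds a = I.P.card)
    (hf : ∀ i, specArr I ps ds a i = f (ps.getD i 0)) {e : Term} {z : ℤ}
    (he : ∀ j : ℕ, e.eval (s.setVar 22 j) = z) : (rankT a e).eval s = I.rank f z := by
  rw [← rank_eq_sum hl]
  simp only [rankT, eval_sum, h.var_zero, Int.toNat_natCast, eval_ind, lt_pos, eval_read, eval_var,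
    Store.setVar_var, if_true, Store.setVar_arr, he]
  refine Finset.sum_congr rfl fun i hi => ?_
  rw [h.2 a ha i (hlen ▸ Finset.mem_range.1 hi), hf]

theorem eval_coordT (h : Known I ps ds L s) (hl : I.ListedBy ps ds) {a : ℕ} {f : ℤ × ℤ → ℤ}
    (ha : a ∈ L) (hlen : specLen I ds a = I.P.card)
    (hf : ∀ i, specArr I ps ds a i = f (ps.getD i 0)) (m : ℕ) :
    (coordT a).eval (s.setVar 20 m) = I.coord f m := by
  rw [← coord_eq_sum hl, coordT, eval_sum, Store.setVar_var, if_neg (by norm_num), h.var_zero,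
    Int.toNat_natCast]
  refine Finset.sum_congr rfl fun i hi => ?_
  have hread : s.arr a i = f (ps.getD i 0) := by
    rw [h.2 a ha i (hlen ▸ Finset.mem_range.1 hi), hf]
  have hrank := ((h.setVar (x := 20) (by norm_num) m).setVar (x := 21) (by norm_num) i).eval_rankT
    hl ha hlen hf (e := read a (var 21)) (z := f (ps.getD i 0)) fun j => by simp [hread]
  simp [hrank, hread]

theorem coords (h : Known I ps ds inputArrays s) (hl : I.ListedBy ps ds) :
    Known I ps ds coordArrays (coordsStm.eval s) := by
  have k1 := h.tab (a := 26) (x := 20) (r := 9) (t := agg .prod 21 20 (agg .prod 22 3 2))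
    h.var_nine fun i _ => by simp [h.var_three, specArr, pow_mul]
  have k2 := k1.tab (a := 27) (x := 20) (r := 9) (t := agg .prod 21 20 2) k1.var_nine
    fun i _ => by simp [specArr]
  have k3 := k2.tab (a := 19) (x := 20) (r := 0) (t := coordT 0) k2.var_zero
    fun i _ => k2.eval_coordT hl (by decide) rfl (fun _ => rfl) i
  exact k3.tab (a := 20) (x := 20) (r := 0) (t := coordT 1) k3.var_zero
    fun i _ => k3.eval_coordT hl (by decide) rfl (fun _ => rfl) i

theorem eval_activeT (h : Known I ps ds L s) (h2 : 2 ∈ L) (h3 : 3 ∈ L) (h4 : 4 ∈ L) (h5 : 5 ∈ L)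
    (hi : i < ds.length) : (ind activeT).eval (s.setVar 20 i) = specArr I ps ds 16 i := by
  simp only [activeT, eval_ind, or_pos, not_pos, eq_pos, h.eval_cell h2 hi, h.eval_cell h3 hi,
    h.eval_cell h4 hi, h.eval_cell h5 hi, specArr, ne_eq, Prod.ext_iff, not_and_or]

theorem eval_selectT (h : Known I ps ds L s) (h2 : 2 ∈ L) (h4 : 4 ∈ L) (hi : i < ds.length)
    {a b : ℕ} (ha : a ∈ L) (hb : b ∈ L) (hai : i < specLen I ds a) (hbi : i < specLen I ds b) :
    (selectT a b).eval (s.setVar 20 i) = if (ds.getD i 0).1.1 < (ds.getD i 0).2.1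
      then specArr I ps ds a i else specArr I ps ds b i := by
  simp only [selectT, eval_ite, lt_pos, h.eval_cell h2 hi, h.eval_cell h4 hi, h.eval_cell ha hai,
    h.eval_cell hb hbi, specArr]

theorem eval_rankT_setVar (h : Known I ps ds L s) (hl : I.ListedBy ps ds) {a : ℕ}
    {f : ℤ × ℤ → ℤ} (ha : a ∈ L) (hlen : specLen I ds a = I.P.card)
    (hf : ∀ i, specArr I ps ds a i = f (ps.getD i 0)) {e : Term} {z : ℤ}
    (he : ∀ s', Known I ps ds L s' → e.eval (s'.setVar 20 i) = z) :
    (rankT a e).eval (s.setVar 20 i) = I.rank f z := by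
  refine (h.setVar (x := 20) (by norm_num) i).eval_rankT hl ha hlen hf fun j => ?_
  rw [Store.setVar_comm (x := 20) (y := 22) (by norm_num)]
  exact he _ (h.setVar (by norm_num) j)

theorem eval_leftRankT (h : Known I ps ds L s) (hl : I.ListedBy ps ds) (h0 : 0 ∈ L) (h2 : 2 ∈ L)
    (h4 : 4 ∈ L) (hi : i < ds.length) :
    (rankT 0 (selectT 2 4)).eval (s.setVar 20 i) = specArr I ps ds 8 i :=
  h.eval_rankT_setVar hl h0 rfl (fun _ => rfl) fun _ k =>
    (k.eval_selectT h2 h4 hi h2 h4 hi hi).trans (apply_ite Prod.fst _ _ _).symm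

theorem eval_rightRankT (h : Known I ps ds L s) (hl : I.ListedBy ps ds) (h0 : 0 ∈ L) (h2 : 2 ∈ L)
    (h4 : 4 ∈ L) (hi : i < ds.length) :
    (rankT 0 (selectT 4 2)).eval (s.setVar 20 i) = specArr I ps ds 9 i :=
  h.eval_rankT_setVar hl h0 rfl (fun _ => rfl) fun _ k =>
    (k.eval_selectT h2 h4 hi h4 h2 hi hi).trans (apply_ite Prod.fst _ _ _).symm

theorem eval_leftRowT (h : Known I ps ds L s) (h2 : 2 ∈ L) (h3 : 3 ∈ L) (h4 : 4 ∈ L) (h5 : 5 ∈ L)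
    (hi : i < ds.length) : (selectT 3 5).eval (s.setVar 20 i) = specArr I ps ds 17 i :=
  (h.eval_selectT h2 h4 hi h3 h5 hi hi).trans (apply_ite Prod.snd _ _ _).symm

theorem eval_rightRowT (h : Known I ps ds L s) (h2 : 2 ∈ L) (h3 : 3 ∈ L) (h4 : 4 ∈ L) (h5 : 5 ∈ L)
    (hi : i < ds.length) : (selectT 5 3).eval (s.setVar 20 i) = specArr I ps ds 18 i :=
  (h.eval_selectT h2 h4 hi h5 h3 hi hi).trans (apply_ite Prod.snd _ _ _).symm

theorem eval_rowRankT (h : Known I ps ds L s) (hl : I.ListedBy ps ds) (h1 : 1 ∈ L) {a : ℕ}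
    (ha : a ∈ L) (hi : i < specLen I ds a) :
    (rankT 1 (cell a)).eval (s.setVar 20 i) = I.rank Prod.snd (specArr I ps ds a i) :=
  h.eval_rankT_setVar hl h1 rfl (fun _ => rfl) fun _ k => k.eval_cell ha hi

theorem eval_orientationT (h : Known I ps ds L s) (hl : I.ListedBy ps ds) (h1 : 1 ∈ L)
    (h17 : 17 ∈ L) (h18 : 18 ∈ L) (hi : i < ds.length) :
    orientationT.eval (s.setVar 20 i) = specArr I ps ds 12 i := by
  simp only [orientationT, eval_ind, lt_pos, h.eval_rowRankT hl h1 h17 hi,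
    h.eval_rowRankT hl h1 h18 hi]
  simp [specArr, orientation]

theorem eval_levelT (h : Known I ps ds L s) (h8 : 8 ∈ L) (h9 : 9 ∈ L) (h26 : 26 ∈ L)
    (hi : i < ds.length) : levelT.eval (s.setVar 20 i) = specArr I ps ds 13 i := by
  simp only [levelT, eval_sum, Store.setVar_var, show (3 : ℕ) ≠ 20 by norm_num, if_false,
    h.var_three, Int.toNat_natCast, specArr, demandLevel, level, Finset.card_filter, Nat.cast_sum]
  refine Finset.sum_congr rfl fun l hl => ?_
  have hl' : l + 1 < I.depth + 1 := by simpa using hl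
  have hread (a : ℕ) (ha : a ∈ L) (hia : i < specLen I ds a) :
      (cell a).eval ((s.setVar 20 i).setVar 21 l) = specArr I ps ds a i := by
    rw [Store.setVar_comm (x := 20) (y := 21) (by norm_num)]
    exact (h.setVar (by norm_num) _).eval_cell ha hia
  have hpow : s.arr 26 (l + 1) = 2 ^ (I.depth * (l + 1)) := mod_cast h.2 26 h26 (l + 1) hl'
  simp only [eval_ind, not_pos, eq_pos, eval_div, hread 8 h8 hi, hread 9 h9 hi, eval_read, eval_add,
    eval_var, eval_one, Store.setVar_var, if_true, Store.setVar_arr, hpow, specArr, strip]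
  norm_cast

theorem eval_orientRowT (h : Known I ps ds L s) (hl : I.ListedBy ps ds) (h1 : 1 ∈ L) (h12 : 12 ∈ L)
    {a : ℕ} (ha : a ∈ L) (hi : i < ds.length) (hia : i < specLen I ds a) {p : ℤ × ℤ} (hp : p ∈ I.P)
    (hap : specArr I ps ds a i = p.2) : (orientRowT a).eval (s.setVar 20 i) =
      I.orientRow (I.orientation (ds.getD i 0)) (I.rank Prod.snd p.2) := by
  have hlt : I.rank Prod.snd p.2 < I.P.card := rank_lt_card (f := Prod.snd) hp
  have hor : I.orientation (ds.getD i 0) < 2 := orientation_lt _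
  have hrow := (h.eval_rowRankT hl h1 ha hia).trans (by rw [hap])
  simp only [orientRowT, eval_ite, eval_sub, h.eval_cell h12 hi, hrow,
    eval_var, Store.setVar_var, show (0 : ℕ) ≠ 20 by norm_num, if_false, h.var_zero, eval_one,
    specArr, orientRow]
  split_ifs <;> omega

theorem eval_offsetT (h : Known I ps ds L s) (h12 : 12 ∈ L) (h13 : 13 ∈ L) (h26 : 26 ∈ L) {a : ℕ}
    (ha : a ∈ L) (hi : i < ds.length) (hia : i < specLen I ds a) {r : ℕ}
    (har : specArr I ps ds a i = r) (side : ℕ) : (offsetT side a).eval (s.setVar 20 i) =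
      I.offset (I.orientation (ds.getD i 0)) side (I.demandLevel (ds.getD i 0))
        (strip I.depth (I.demandLevel (ds.getD i 0)) r) := by
  have hpow := h.2 26 h26 _ (demandLevel_lt_specLen (ds.getD i 0))
  simp only [specArr] at hpow
  have hrank := (h.eval_cell ha hia).trans har
  simp only [offsetT, eval_mul, eval_add, eval_div, eval_read, eval_const, eval_ofNat, eval_var,
    Store.setVar_var, Store.setVar_arr, show (0 : ℕ) ≠ 20 by norm_num,
    show (3 : ℕ) ≠ 20 by norm_num, if_false, h.eval_cell h12 hi, h.eval_cell h13 hi,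
    hrank, h.var_zero, h.var_three, specArr, hpow, offset, strip]
  push_cast
  ring

theorem demands (h : Known I ps ds coordArrays s) (hl : I.ListedBy ps ds) :
    Known I ps ds preparedArrays (demandsStm.eval s) := by
  have hleft {i : ℕ} (hi : i < ds.length) : leftEnd (ds.getD i 0) ∈ I.P :=
    leftEnd_mem (hl.getD_mem hi)
  have hright {i : ℕ} (hi : i < ds.length) : rightEnd (ds.getD i 0) ∈ I.P :=
    rightEnd_mem (hl.getD_mem hi)
  have k1 := h.tab (a := 16) h.var_one fun i hi =>
    h.eval_activeT (by decide) (by decide) (by decide) (by decide) hi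
  have k2 := k1.tab (a := 8) k1.var_one fun i hi =>
    k1.eval_leftRankT hl (by decide) (by decide) (by decide) hi
  have k3 := k2.tab (a := 9) k2.var_one fun i hi =>
    k2.eval_rightRankT hl (by decide) (by decide) (by decide) hi
  have k4 := k3.tab (a := 17) k3.var_one fun i hi =>
    k3.eval_leftRowT (by decide) (by decide) (by decide) (by decide) hi
  have k5 := k4.tab (a := 18) k4.var_one fun i hi =>
    k4.eval_rightRowT (by decide) (by decide) (by decide) (by decide) hi
  have k6 := k5.tab (a := 12) k5.var_one fun i hi =>
    k5.eval_orientationT hl (by decide) (by decide) (by decide) hi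
  have k7 := k6.tab (a := 13) k6.var_one fun i hi =>
    k6.eval_levelT (by decide) (by decide) (by decide) hi
  have k8 := k7.tab (a := 10) k7.var_one fun i hi =>
    k7.eval_orientRowT (a := 17) hl (by decide) (by decide) (by decide) hi hi (hleft hi) rfl
  have k9 := k8.tab (a := 11) k8.var_one fun i hi =>
    k8.eval_orientRowT (a := 18) hl (by decide) (by decide) (by decide) hi hi (hright hi) rfl
  have k10 := k9.tab (a := 14) k9.var_one fun i hi =>
    k9.eval_offsetT (a := 8) (by decide) (by decide) (by decide) (by decide) hi hi rfl 0
  exact k10.tab (a := 15) k10.var_one fun i hi =>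
    k10.eval_offsetT (a := 9) (by decide) (by decide) (by decide) (by decide) hi hi rfl 1

end Known

theorem eval_depthT (h0 : s.var 0 = I.P.card) : depthT.eval s = I.depth := by
  have hpow (i : ℕ) : ((2 : ℤ) ^ i) ^ i < I.P.card ↔ 2 ^ (i * i) < I.P.card := by
    rw [← pow_mul]; norm_cast
  simp [depthT, h0, Instance.depth, hpow]

theorem known_sizesStm (h0 : s.var 0 = I.P.card) (h1 : s.var 1 = ds.length)
    (hL : ∀ a ∈ L, ∀ i < specLen I ds a, s.arr a i = specArr I ps ds a i) :
    Known I ps ds L (sizesStm.eval s) := by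
  refine ⟨fun x hx hx2 => ?_, hL⟩
  simp only [sizesStm, Stm.eval, eval_depthT h0]
  interval_cases x <;>
    simp [h0, h1, specVar, Instance.size, Instance.problem, HitProblem.rounds] at *

end Algo

/-! ### Correctness of the search -/

theorem Stm.tab_arr {a x r : ℕ} {t : Term} {s : Store} {i : ℕ} (hi : (i : ℤ) < s.var r) :
    ((Stm.tab a x r t).eval s).arr a i = t.eval (s.setVar x i) := by
  simp [Stm.eval, Store.setCells_arr, hi]

theorem Stm.tab_arr_ne {a x r b : ℕ} {t : Term} {s : Store} (hb : b ≠ a) :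
    ((Stm.tab a x r t).eval s).arr b = s.arr b := by
  funext i
  simp [Stm.eval, Store.setCells_arr, hb]

theorem Store.Bounded.tab {S B a x r : ℕ} {t : Term} {s : Store} (h : s.Bounded S B)
    (ht : ∀ i : ℕ, (i : ℤ) < s.var r → |t.eval (s.setVar x i)| ≤ 2 ^ B) :
    ((Stm.tab a x r t).eval s).Bounded S B := by
  refine h.setCells a fun i hi hir => ?_
  lift i to ℕ using hi
  exact ht i hir

open Classical in
/-- The array `a` holds the indicator function of `p` on the numbers below `n`. -/
def Store.Indicates (s : Store) (a n : ℕ) (p : ℕ → Prop) : Prop :=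
  ∀ i < n, s.arr a i = if p i then 1 else 0

namespace Store.Indicates

variable {s : Store} {a n i m : ℕ} {p : ℕ → Prop}

theorem pos_iff (h : s.Indicates a n p) (hi : i < n) : 0 < s.arr a i ↔ p i := by
  rw [h i hi]
  split_ifs with hp <;> simp [hp]

theorem sum_pos_iff (h : s.Indicates a n p) (hm : m ≤ n) :
    0 < ∑ i ∈ Finset.range m, s.arr a i ↔ ∃ i < m, p i := by
  classical
  rw [Finset.sum_congr rfl fun i hi => h i ((Finset.mem_range.1 hi).trans_le hm)]
  simp [Finset.card_pos, Finset.Nonempty]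

end Store.Indicates

namespace Algo

open Term Instance

/-- Started in a store with `P`, the statement is safe, and it ends in a store with `Q`. -/
def Triple (B : ℕ) (P : Store → Prop) (c : Stm) (Q : Store → Prop) : Prop :=
  ∀ s, P s → c.Safe 50 B s ∧ Q (c.eval s)

theorem Triple.seq {B : ℕ} {P Q R : Store → Prop} {c d : Stm} (hc : Triple B P c Q)
    (hd : Triple B Q d R) : Triple B P (c.seq d) R := fun s hs =>
  ⟨⟨(hc s hs).1, (hd _ (hc s hs).2).1⟩, (hd _ (hc s hs).2).2⟩

theorem Triple.rep {B r n : ℕ} {P : ℕ → Store → Prop} {c : Stm}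
    (hr : ∀ s, P 0 s → s.Bounded 50 B ∧ s.var r = n)
    (hc : ∀ i < n, Triple B (P i) c (P (i + 1))) : Triple B (P 0) (.rep r c) (P n) := by
  intro s hs
  obtain ⟨hb, hn⟩ := hr s hs
  have hinv : ∀ i ≤ n, P i (c.eval^[i] s) := by
    intro i
    induction i with
    | zero => exact fun _ => hs
    | succ i ih =>
      intro hi
      rw [Function.iterate_succ_apply']
      exact (hc i hi _ (ih (by omega))).2
  simp only [Stm.Safe, Stm.eval, hn, Int.toNat_natCast]
  exact ⟨⟨hb, fun i hi => (hc i hi _ (hinv i hi.le)).1⟩, hinv n le_rfl⟩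

variable {I : Instance} {ps : List (ℤ × ℤ)} {ds : List Demand} {L : List ℕ} {B : ℕ} {K : ℤ}
  {w w' : ℕ → ℤ} {s : Store} {c u : ℕ}

namespace Known

theorem var_five (h : Known I ps ds L s) : s.var 5 = (I.problem ds).M :=
  h.var_eq 5 (by norm_num) (by norm_num)

theorem var_six (h : Known I ps ds L s) : s.var 6 = ((I.size + 1 : ℕ) : ℤ) := by
  rw [h.var_eq 6 (by norm_num) (by norm_num), Nat.cast_add_one, specVar]

theorem var_seven (h : Known I ps ds L s) : s.var 7 = (I.problem ds).rounds :=
  h.var_eq 7 (by norm_num) (by norm_num)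

theorem tab_of_notMem (h : Known I ps ds L s) {a x r : ℕ} {t : Term} (ha : a ∉ L) :
    Known I ps ds L ((Stm.tab a x r t).eval s) :=
  h.of_eq (fun _ _ _ => rfl) fun _ hb => Stm.tab_arr_ne fun e => ha (e ▸ hb)

theorem eval_cutDemandT (h : Known I ps ds L s) (h20 : s.var 20 = c) :
    cutDemandT.eval s = ((c / (I.P.card + 1) : ℕ) : ℤ) := by
  simp [cutDemandT, h20, h.var_zero]

theorem eval_cutRowT (h : Known I ps ds L s) (h20 : s.var 20 = c) :
    cutRowT.eval s = I.cutRow c := by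
  simp [cutRowT, h20, h.var_zero, cutRow]

theorem eval_read_cutDemandT (h : Known I ps ds L s) {a : ℕ} (ha : a ∈ L)
    (hlen : specLen I ds a = ds.length) (hc : c < (I.problem ds).M) (h20 : s.var 20 = c) :
    (read a cutDemandT).eval s = specArr I ps ds a (c / (I.P.card + 1)) := by
  rw [eval_read, h.eval_cutDemandT h20]
  exact h.arr_eq a ha _ (hlen ▸ Nat.div_lt_of_lt_mul (by rwa [mul_comm]))

theorem memT_pos (h : Known I ps ds preparedArrays s) (hc : c < (I.problem ds).M)
    (h20 : s.var 20 = c) (h21 : s.var 21 = u) : 0 < memT.eval s ↔ (I.problem ds).mem c u := by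
  simp only [memT, or_pos, and_pos, le_pos, lt_pos, eval_add, eval_var, h21, h.eval_cutRowT h20,
    h.eval_read_cutDemandT (a := 14) (by decide) rfl hc h20,
    h.eval_read_cutDemandT (a := 10) (by decide) rfl hc h20,
    h.eval_read_cutDemandT (a := 15) (by decide) rfl hc h20,
    h.eval_read_cutDemandT (a := 11) (by decide) rfl hc h20]
  simp only [specArr, problem, cutDemand]
  norm_cast

theorem activeT_pos (h : Known I ps ds preparedArrays s) (hc : c < (I.problem ds).M)
    (h20 : s.var 20 = c) : 0 < (read 16 cutDemandT).eval s ↔ (I.problem ds).act c := by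
  rw [h.eval_read_cutDemandT (by decide) rfl hc h20]
  simp only [specArr, problem, cutDemand]
  split_ifs with hne
  exacts [iff_of_true one_pos hne, iff_of_false (lt_irrefl 0) hne]

theorem eval_totalWeightT (h : Known I ps ds L s) (hw : ∀ u < I.size, s.arr 21 u = w u) :
    totalWeightT.eval s = (I.problem ds).total w := by
  simp only [totalWeightT, eval_sum, h.var_four, Int.toNat_natCast, HitProblem.total]
  exact Finset.sum_congr rfl fun u hu => by simpa using hw u (Finset.mem_range.1 hu)

theorem eval_cutWeightT (h : Known I ps ds preparedArrays s)
    (hw : ∀ u < I.size, s.arr 21 u = w u) (hc : c < (I.problem ds).M) (h20 : s.var 20 = c) :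
    cutWeightT.eval s = (I.problem ds).weight w c := by
  classical
  simp only [cutWeightT, eval_sum, h.var_four, Int.toNat_natCast, HitProblem.weight]
  refine Finset.sum_congr rfl fun u hu => ?_
  rw [eval_ite]
  refine if_congr ?_ (by simpa using hw u (Finset.mem_range.1 hu)) rfl
  exact (h.setVar (by norm_num) _).memT_pos hc (by simp [h20]) (by simp)

theorem lightT_pos (h : Known I ps ds preparedArrays s) (hK : s.var 10 = K)
    (hw : ∀ u < I.size, s.arr 21 u = w u) (hc : c < (I.problem ds).M) (h20 : s.var 20 = c) :
    0 < lightT.eval s ↔ (I.problem ds).Light K w c := by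
  rw [lightT, and_pos, h.activeT_pos hc h20, lt_pos, eval_mul, eval_mul, eval_ofNat, eval_var, hK,
    h.eval_cutWeightT hw hc h20, h.eval_totalWeightT hw]
  rfl

theorem eval_doubledT (h : Known I ps ds preparedArrays s) (hw : ∀ u < I.size, s.arr 21 u = w u)
    (h24 : s.Indicates 24 (I.problem ds).M ((I.problem ds).First K w)) (hu : u < I.size) :
    doubledT.eval (s.setVar 21 u) = (I.problem ds).step K w u := by
  classical
  have hmem (c : ℕ) (hc : c < (I.problem ds).M) :
      0 < memT.eval ((s.setVar 21 u).setVar 20 c) ↔ (I.problem ds).mem c u :=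
    ((h.setVar (by norm_num) _).setVar (by norm_num) _).memT_pos hc (by simp) (by simp)
  simp only [doubledT, eval_mul, eval_add, eval_one, eval_sum, eval_read, eval_var,
    Store.setVar_var, if_true, show (5 : ℕ) ≠ 21 by norm_num, if_false, h.var_five,
    Int.toNat_natCast, Store.setVar_arr, hw u hu, HitProblem.step]
  congr 2
  refine Finset.sum_congr rfl fun c hc => ?_
  have hc := Finset.mem_range.1 hc
  simp only [eval_ite, eval_read, eval_var, Store.setVar_var, if_true, Store.setVar_arr, eval_ind,
    eval_zero]
  exact if_congr (h24.pos_iff hc) (if_congr (hmem c hc) rfl rfl) rfl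

end Known

theorem firstT_pos (h23 : s.Indicates 23 (I.problem ds).M ((I.problem ds).Light K w))
    (hc : c < (I.problem ds).M) :
    0 < firstT.eval (s.setVar 20 c) ↔ (I.problem ds).First K w c := by
  simp only [firstT, and_pos, not_pos, eval_sum, eval_read, eval_var, Store.setVar_var, if_true,
    Store.setVar_arr, Int.toNat_natCast, h23.pos_iff hc, h23.sum_pos_iff hc.le, HitProblem.First]
  push Not
  rfl

/-- The state of the search with parameter `K` and weights `w`. -/
structure Search (I : Instance) (ps : List (ℤ × ℤ)) (ds : List Demand) (B : ℕ) (K : ℤ)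
    (w : ℕ → ℤ) (s : Store) : Prop where
  known : Known I ps ds preparedArrays s
  K_eq : s.var 10 = K
  w_eq : ∀ u < I.size, s.arr 21 u = w u
  bdd : s.Bounded 50 B

namespace Search

theorem tab (h : Search I ps ds B K w s) {a x r : ℕ} {t : Term} (ha : a ∉ 21 :: preparedArrays)
    (ht : ∀ i : ℕ, (i : ℤ) < s.var r → |t.eval (s.setVar x i)| ≤ 2 ^ B) :
    (Stm.tab a x r t).Safe 50 B s ∧ Search I ps ds B K w ((Stm.tab a x r t).eval s) := by
  rw [List.mem_cons, not_or] at ha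
  have hb := h.bdd.tab (a := a) ht
  refine ⟨⟨h.bdd, hb⟩, h.known.tab_of_notMem ha.2, h.K_eq, fun u hu => ?_, hb⟩
  rw [Stm.tab_arr_ne (Ne.symm ha.1), h.w_eq u hu]

theorem tab_weights (h : Search I ps ds B K w s) {t : Term}
    (hw : ∀ u < I.size, |w' u| ≤ 2 ^ B)
    (ht : ∀ u < I.size, t.eval (s.setVar 21 u) = w' u) :
    (Stm.tab 22 21 4 t).Safe 50 B s ∧ Search I ps ds B K w ((Stm.tab 22 21 4 t).eval s) ∧
      ∀ u < I.size, ((Stm.tab 22 21 4 t).eval s).arr 22 u = w' u := by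
  have hlt (u : ℕ) : (u : ℤ) < s.var 4 ↔ u < I.size := by rw [h.known.var_four, Nat.cast_lt]
  obtain ⟨hsafe, hsearch⟩ := h.tab (a := 22) (x := 21) (r := 4) (by decide) fun u hu =>
    (ht u ((hlt u).1 hu)).symm ▸ hw u ((hlt u).1 hu)
  exact ⟨hsafe, hsearch, fun u hu => (Stm.tab_arr ((hlt u).2 hu)).trans (ht u hu)⟩

theorem tab_ind (h : Search I ps ds B K w s) {a x r n : ℕ} {t : Term} {p : ℕ → Prop}
    (ha : a ∉ 21 :: preparedArrays) (hr : s.var r = n)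
    (ht : ∀ i < n, 0 < t.eval (s.setVar x i) ↔ p i) :
    (Stm.tab a x r (ind t)).Safe 50 B s ∧ Search I ps ds B K w ((Stm.tab a x r (ind t)).eval s) ∧
      ((Stm.tab a x r (ind t)).eval s).Indicates a n p := by
  classical
  obtain ⟨hsafe, hsearch⟩ := h.tab (a := a) (x := x) (r := r) (t := ind t) ha fun i _ => by
    rw [eval_ind]
    split_ifs <;> simp [one_le_pow₀]
  refine ⟨hsafe, hsearch, fun i hi => ?_⟩
  rw [Stm.tab_arr (by rw [hr]; exact_mod_cast hi), eval_ind]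
  exact if_congr (ht i hi) rfl rfl

end Search

theorem triple_copy : Triple B
    (fun s => Search I ps ds B K w s ∧ ∀ u < I.size, s.arr 22 u = w' u)
    (.tab 21 21 4 (read 22 (var 21))) (Search I ps ds B K w') := by
  rintro s ⟨h, hw⟩
  have hb := h.bdd.tab (a := 21) (x := 21) (r := 4) (t := read 22 (var 21))
    fun i _ => by simpa using h.bdd.arr_le 22 i
  refine ⟨⟨h.bdd, hb⟩, h.known.tab_of_notMem (by decide), h.K_eq, fun u hu => ?_, hb⟩
  rw [Stm.tab_arr (by rw [h.known.var_four]; exact_mod_cast hu)]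
  simpa using hw u hu

theorem triple_light (B : ℕ) (K : ℤ) (w : ℕ → ℤ) :
    Triple B (Search I ps ds B K w) lightStm fun s => Search I ps ds B K w s ∧
      s.Indicates 23 (I.problem ds).M ((I.problem ds).Light K w) :=
  fun s h => h.tab_ind (by decide) h.known.var_five fun c hc =>
    (h.known.setVar (by norm_num) c).lightT_pos (by simpa using h.K_eq) h.w_eq hc (by simp)

theorem triple_first (B : ℕ) (K : ℤ) (w : ℕ → ℤ) :
    Triple B (fun s => Search I ps ds B K w s ∧
      s.Indicates 23 (I.problem ds).M ((I.problem ds).Light K w)) (.tab 24 20 5 (ind firstT))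
      fun s => Search I ps ds B K w s ∧
        s.Indicates 24 (I.problem ds).M ((I.problem ds).First K w) :=
  fun s h => h.1.tab_ind (by decide) h.1.known.var_five fun c hc => firstT_pos h.2 hc

theorem triple_doubled (hw : ∀ u < I.size, |(I.problem ds).step K w u| ≤ 2 ^ B) :
    Triple B (fun s => Search I ps ds B K w s ∧
      s.Indicates 24 (I.problem ds).M ((I.problem ds).First K w)) (.tab 22 21 4 doubledT)
      fun s => Search I ps ds B K w s ∧ ∀ u < I.size, s.arr 22 u = (I.problem ds).step K w u :=
  fun _ h => h.1.tab_weights hw fun _ hu => h.1.known.eval_doubledT h.1.w_eq h.2 hu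

theorem triple_step (hw : ∀ u < I.size, |(I.problem ds).step K w u| ≤ 2 ^ B) :
    Triple B (Search I ps ds B K w) stepStm (Search I ps ds B K ((I.problem ds).step K w)) :=
  (triple_light B K w).seq <| (triple_first B K w).seq <| (triple_doubled hw).seq triple_copy

open Classical in
theorem triple_flag (hB : 1 ≤ B) : Triple B (fun s => Search I ps ds B K w s ∧
      s.Indicates 23 (I.problem ds).M ((I.problem ds).Light K w))
    (.set 11 (ind (agg .sum 20 5 (read 23 (var 20)))))
    fun s => Search I ps ds B K w s ∧ s.var 11 = if (I.problem ds).Good K w then 0 else 1 := by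
  rintro s ⟨h, h23⟩
  have hval : (ind (agg .sum 20 5 (read 23 (var 20)))).eval s =
      if (I.problem ds).Good K w then 0 else 1 := by
    simp only [eval_ind, eval_sum, eval_read, eval_var, Store.setVar_var, if_true, Store.setVar_arr,
      h.known.var_five, Int.toNat_natCast]
    rw [← ite_not]
    refine if_congr ((h23.sum_pos_iff le_rfl).not.trans ?_) rfl rfl
    simp only [HitProblem.Good, not_exists, not_and]
  have hb := h.bdd.setVar 11 (v := if (I.problem ds).Good K w then 0 else 1) (by
    split_ifs <;> simp [hB])
  rw [← hval] at hb ⊢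
  exact ⟨⟨h.bdd, hb⟩, ⟨h.known.setVar (by norm_num) _, by simpa [Stm.eval] using h.K_eq, h.w_eq,
    hb⟩, by simp [Stm.eval]⟩

theorem triple_parameter {b : ℤ} (hB : |K + b| ≤ B) :
    Triple B (fun s => Search I ps ds B K w s ∧ s.var 11 = b) (.set 10 (var 10 + var 11))
      fun s => Search I ps ds B (K + b) w s ∧ s.var 11 = b := by
  rintro s ⟨h, h11⟩
  have hval : (var 10 + var 11).eval s = K + b := by simp [h.K_eq, h11]
  have hb : ((Stm.set 10 (var 10 + var 11)).eval s).Bounded 50 B :=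
    h.bdd.setVar 10 (by rwa [hval])
  exact ⟨⟨h.bdd, hb⟩, ⟨h.known.setVar (by norm_num) _, by simp [Stm.eval, hval], h.w_eq, hb⟩,
    by simpa [Stm.eval] using h11⟩

open Classical in
theorem triple_resetWeights {K' : ℤ} (hw : ∀ u < I.size, |w u| ≤ 2 ^ B) :
    Triple B (fun s => Search I ps ds B K' w s ∧
        s.var 11 = if (I.problem ds).Good K w then 0 else 1)
      (.tab 22 21 4 (ite (var 11) 1 (read 21 (var 21))))
      fun s => Search I ps ds B K' w s ∧
        ∀ u < I.size, s.arr 22 u = if (I.problem ds).Good K w then w u else 1 := by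
  rintro s ⟨h, h11⟩
  refine h.tab_weights (fun u hu => ?_) fun u hu => ?_
  · split_ifs
    exacts [hw u hu, by simp [one_le_pow₀]]
  · simp only [eval_ite, eval_var, eval_one, eval_read, Store.setVar_var, Store.setVar_arr, if_true,
      show (11 : ℕ) ≠ 21 by norm_num, if_false, h11, h.w_eq u hu]
    split_ifs <;> simp_all

open Classical in
theorem triple_reset (hK : 0 ≤ K) (hKB : K + 1 ≤ B) (hw : ∀ u < I.size, |w u| ≤ 2 ^ B) :
    Triple B (Search I ps ds B K w) resetStm (Search I ps ds B
      (K + if (I.problem ds).Good K w then 0 else 1)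
      fun u => if (I.problem ds).Good K w then w u else 1) := by
  refine (triple_light B K w).seq <| (triple_flag (by omega)).seq <|
    (triple_parameter ?_).seq <| (triple_resetWeights hw).seq triple_copy
  split_ifs <;> rw [abs_of_nonneg] <;> omega

theorem triple_advance {z : ℤ × (ℕ → ℤ)} (hK : 0 ≤ z.1) (hKB : z.1 + 1 ≤ B)
    (hB : (I.problem ds).rounds ≤ B) (hw : ∀ u, 1 ≤ z.2 u ∧ z.2 u ≤ 2 ^ B) :
    Triple B (Search I ps ds B z.1 z.2) advanceStm
      (Search I ps ds B ((I.problem ds).advance z).1 ((I.problem ds).advance z).2) := by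
  classical
  have habs {v : ℤ} (hv : 1 ≤ v ∧ v ≤ 2 ^ B) : |v| ≤ 2 ^ B := by
    rw [abs_of_nonneg (by omega)]
    exact hv.2
  have hreset := triple_reset (ps := ps) (ds := ds) hK hKB fun u (_ : u < I.size) => habs (hw u)
  by_cases hg : (I.problem ds).Good z.1 z.2
  · simp only [HitProblem.advance, if_pos hg, add_zero] at hreset ⊢
    refine hreset.seq (Triple.rep (P := fun _ => Search I ps ds B z.1 z.2)
      (fun s h => ⟨h.bdd, h.known.var_seven⟩) fun i _ => ?_)
    have hstep := triple_step (I := I) (ps := ps) (ds := ds) (B := B) (K := z.1) (w := z.2)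
    rw [HitProblem.step_of_good hg] at hstep
    exact hstep fun u _ => habs (hw u)
  · simp only [HitProblem.advance, if_neg hg] at hreset ⊢
    refine hreset.seq (Triple.rep
      (P := fun i => Search I ps ds B (z.1 + 1) ((I.problem ds).weights (z.1 + 1) i))
      (fun s h => ⟨h.bdd, h.known.var_seven⟩) fun i hi => ?_)
    rw [HitProblem.weights_succ]
    refine triple_step fun u _ => habs ?_
    rw [← HitProblem.weights_succ]
    have hbounds := HitProblem.weights_bounds (X := I.problem ds) (K := z.1 + 1) (i + 1) u
    exact ⟨hbounds.1, hbounds.2.trans (pow_le_pow_right₀ (by norm_num) (by omega))⟩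

theorem triple_search (hB : (I.problem ds).rounds ≤ B) (hsize : I.size + 1 ≤ B) :
    let z := (I.problem ds).advance^[I.size + 1] (0, fun _ => 1)
    Triple B (Search I ps ds B 0 fun _ => 1) searchStm (Search I ps ds B z.1 z.2) := by
  refine Triple.rep (P := fun i =>
      let z := (I.problem ds).advance^[i] (0, fun _ => 1)
      Search I ps ds B z.1 z.2) (fun s h => ⟨h.bdd, h.known.var_six⟩) fun i hi => ?_
  rw [Function.iterate_succ_apply']
  obtain ⟨hK, hle, hw⟩ := HitProblem.iterate_advance_bounds (X := I.problem ds) i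
  refine triple_advance hK (by omega) hB fun u => ⟨(hw u).1, (hw u).2.trans ?_⟩
  exact pow_le_pow_right₀ (by norm_num) hB

end Algo

/-! ### Correctness of the output -/

namespace Algo

open Term Instance

variable (I : Instance) (ds : List Demand)

/-- The number of slots of the output. -/
def slotCount : ℕ := I.size * I.depth + 2 * ds.length

/-- The demand of a slot that does not belong to an index. -/
def slotDemand (z : ℕ) : Demand := ds.getD ((z - I.size * I.depth) / 2) 0

/-- The rank of the column of the point of a slot. -/
def slotRank (z : ℕ) : ℕ :=
  if z < I.size * I.depth then I.boundary (z / I.depth) (z % I.depth)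
  else if (z - I.size * I.depth) % 2 = 0 then I.exitRank (slotDemand I ds z)
  else I.entryRank (slotDemand I ds z)

/-- The row of the point of a slot. -/
def slotRow (z : ℕ) : ℤ :=
  if z < I.size * I.depth then I.indexRow (z / I.depth)
  else if (z - I.size * I.depth) % 2 = 0 then (leftEnd (slotDemand I ds z)).2
  else (rightEnd (slotDemand I ds z)).2

/-- The slot is in use. -/
def SlotValid (K : ℤ) (w : ℕ → ℤ) (z : ℕ) : Prop :=
  if z < I.size * I.depth then Jump I.size K w (z / I.depth) ∧ slotRank I ds z < I.P.card
  else (slotDemand I ds z).1 ≠ (slotDemand I ds z).2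

variable {I ds} {ps : List (ℤ × ℤ)} {B : ℕ} {K : ℤ} {w : ℕ → ℤ} {s : Store} {z : ℕ}

theorem div_two_lt_of_lt_slotCount (hz : z < slotCount I ds) (hzi : ¬ z < I.size * I.depth) :
    (z - I.size * I.depth) / 2 < ds.length := by
  unfold slotCount at hz
  omega

theorem slotDemand_mem (hl : I.ListedBy ps ds) (hz : z < slotCount I ds)
    (hzi : ¬ z < I.size * I.depth) : slotDemand I ds z ∈ I.D :=
  hl.getD_mem (div_two_lt_of_lt_slotCount hz hzi)

theorem entryRank_lt {d : Demand} (hd : d ∈ I.D) : I.entryRank d < I.P.card :=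
  (Nat.div_mul_le_self _ _).trans_lt (rightRank_lt hd)

theorem exitRank_lt {d : Demand} (hd : d ∈ I.D) (hne : d.1 ≠ d.2) : I.exitRank d < I.P.card :=
  (Nat.mul_le_mul_right _ (demandLevel_spec hd hne).2.1).trans_lt (entryRank_lt hd)

theorem slotRank_lt (hl : I.ListedBy ps ds) (hz : z < slotCount I ds)
    (hv : SlotValid I ds K w z) : slotRank I ds z < I.P.card := by
  unfold SlotValid at hv
  split_ifs at hv with hzi
  · exact hv.2
  · have hd := slotDemand_mem hl hz hzi
    rw [slotRank, if_neg hzi]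
    split_ifs
    exacts [exitRank_lt hd hv, entryRank_lt hd]

theorem depth_pos_of_lt (hzi : z < I.size * I.depth) : 0 < I.depth :=
  Nat.pos_of_ne_zero fun h => by simp [h] at hzi

theorem slotIndex_lt (hzi : z < I.size * I.depth) : z / I.depth < I.size :=
  Nat.div_lt_of_lt_mul (by rwa [mul_comm])

theorem indexOrientation_lt {u : ℕ} (hu : u < I.size) : I.indexOrientation u < 2 := by
  rw [indexOrientation, Nat.div_div_eq_div_mul, Nat.div_div_eq_div_mul, Nat.div_div_eq_div_mul]
  refine Nat.div_lt_of_lt_mul (hu.trans_eq ?_)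
  rw [size]
  ring

namespace Known

variable {L : List ℕ}

theorem var_eight (h : Known I ps ds L s) : s.var 8 = slotCount I ds := by
  rw [h.var_eq 8 (by norm_num) (by norm_num), slotCount]
  simp [specVar]

theorem isIndexT_pos (h : Known I ps ds L s) (h20 : s.var 20 = z) :
    0 < isIndexT.eval s ↔ z < I.size * I.depth := by
  simp only [isIndexT, lt_pos, eval_mul, eval_var, h20, h.var_three, h.var_four]
  norm_cast

theorem eval_slotIndexT (h : Known I ps ds L s) (h20 : s.var 20 = z) :
    slotIndexT.eval s = ((z / I.depth : ℕ) : ℤ) := by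
  simp [slotIndexT, h20, h.var_three]

theorem eval_slotDemandT (h : Known I ps ds L s) (h20 : s.var 20 = z)
    (hzi : ¬ z < I.size * I.depth) :
    slotDemandT.eval s = (((z - I.size * I.depth) / 2 : ℕ) : ℤ) := by
  simp only [slotDemandT, eval_div, eval_sub, eval_mul, eval_var, h20, h.var_three, h.var_four,
    eval_ofNat]
  push_cast [Nat.cast_sub (not_lt.1 hzi)]
  rfl

theorem isLeftT_pos (h : Known I ps ds L s) (h20 : s.var 20 = z) (hzi : ¬ z < I.size * I.depth) :
    0 < isLeftT.eval s ↔ (z - I.size * I.depth) % 2 = 0 := by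
  simp only [isLeftT, eq_pos, eval_mod, eval_sub, eval_mul, eval_var, h20, h.var_three, h.var_four,
    eval_ofNat, eval_zero]
  zify [not_lt.1 hzi]

theorem eval_boundaryT (h : Known I ps ds L s) (h26 : 26 ∈ L) (h27 : 27 ∈ L) (h20 : s.var 20 = z)
    (hzi : z < I.size * I.depth) :
    boundaryT.eval s = I.boundary (z / I.depth) (z % I.depth) := by
  have hd := depth_pos_of_lt hzi
  have hside : I.indexSide (z / I.depth) ≤ 1 := Nat.lt_succ_iff.1 (Nat.mod_lt _ two_pos)
  have hlt : I.indexLevel (z / I.depth) < specLen I ds 26 :=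
    (Nat.mod_lt _ hd).trans (Nat.lt_succ_self _)
  have hidx := h.eval_slotIndexT h20
  have hbit : slotBoundaryT.eval s = ((z % I.depth : ℕ) : ℤ) := by
    simp [slotBoundaryT, h20, h.var_three]
  have hlevel : (mod (slotIndexT / var 0 / var 0) (var 3)).eval s
      = (I.indexLevel (z / I.depth) : ℤ) := by
    simp [hidx, h.var_zero, h.var_three, indexLevel]
  have hstrip : (mod (slotIndexT / var 0) (var 0)).eval s = (I.indexStrip (z / I.depth) : ℤ) := by
    simp [hidx, h.var_zero, indexStrip]
  have hsideT : (mod (slotIndexT / var 0 / var 0 / var 3) 2).eval s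
      = (I.indexSide (z / I.depth) : ℤ) := by
    simp [hidx, h.var_zero, h.var_three, indexSide]
  rw [boundaryT, eval_mul, eval_mul, eval_add, eval_sub, eval_div, hstrip, hsideT, eval_read,
    eval_read, hbit, hlevel, h.arr_eq 27 h27 _ ((Nat.mod_lt _ hd).trans (Nat.lt_succ_self _)),
    h.arr_eq 26 h26 _ hlt, eval_one]
  simp only [specArr, boundary, pow_add]
  push_cast [Nat.cast_sub hside]
  rfl

theorem eval_indexRowT (h : Known I ps ds L s) (hr : 20 ∈ L) (h20 : s.var 20 = z)
    (hzi : z < I.size * I.depth) : indexRowT.eval s = I.indexRow (z / I.depth) := by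
  have hP : 0 < I.P.card := Nat.pos_of_ne_zero fun h => by simp [size, h] at hzi
  have hm := Nat.mod_lt (z / I.depth) hP
  have ho := indexOrientation_lt (slotIndex_lt hzi)
  have hidx := h.eval_slotIndexT h20
  have horientation : (slotIndexT / var 0 / var 0 / var 3 / 2).eval s
      = (I.indexOrientation (z / I.depth) : ℤ) := by
    simp [hidx, h.var_zero, h.var_three, indexOrientation]
  have hmod : (mod slotIndexT (var 0)).eval s = ((z / I.depth % I.P.card : ℕ) : ℤ) := by
    simp [hidx, h.var_zero]
  have hrow : (Term.ite (slotIndexT / var 0 / var 0 / var 3 / 2)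
      (var 0 - 1 - mod slotIndexT (var 0)) (mod slotIndexT (var 0))).eval s
      = (I.orientRow (I.indexOrientation (z / I.depth)) (z / I.depth % I.P.card) : ℤ) := by
    rw [eval_ite, horientation, eval_sub, eval_sub, hmod, eval_var, h.var_zero, eval_one, orientRow]
    split_ifs <;> omega
  rw [indexRowT, eval_read, hrow]
  exact h.arr_eq 20 hr _ (orientRow_lt hm)

theorem eval_read_slotDemandT (h : Known I ps ds L s) {a : ℕ} (ha : a ∈ L)
    (hlen : specLen I ds a = ds.length) (h20 : s.var 20 = z) (hz : z < slotCount I ds)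
    (hzi : ¬ z < I.size * I.depth) :
    (read a slotDemandT).eval s = specArr I ps ds a ((z - I.size * I.depth) / 2) := by
  rw [eval_read, h.eval_slotDemandT h20 hzi]
  exact h.arr_eq a ha _ (hlen ▸ div_two_lt_of_lt_slotCount hz hzi)

theorem eval_stripStartT (h : Known I ps ds L s) (h13 : 13 ∈ L) (h26 : 26 ∈ L) {a r : ℕ}
    (har : (read a slotDemandT).eval s = r) (h20 : s.var 20 = z) (hz : z < slotCount I ds)
    (hzi : ¬ z < I.size * I.depth) (k : ℤ) :
    (stripStartT a k).eval s = (strip I.depth (I.demandLevel (slotDemand I ds z)) r + k) *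
      ((2 ^ (I.depth * I.demandLevel (slotDemand I ds z)) : ℕ) : ℤ) := by
  have hpow : (read 26 (read 13 slotDemandT)).eval s
      = ((2 ^ (I.depth * I.demandLevel (slotDemand I ds z)) : ℕ) : ℤ) := by
    rw [eval_read, h.eval_read_slotDemandT h13 rfl h20 hz hzi]
    exact (h.arr_eq 26 h26 _ (demandLevel_lt_specLen _)).trans (by push_cast; rfl)
  rw [stripStartT, eval_mul, eval_add, eval_div, har, hpow, eval_const, strip, Int.natCast_ediv]

theorem eval_columnT (h : Known I ps ds preparedArrays s) (h20 : s.var 20 = z)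
    (hz : z < slotCount I ds) : columnT.eval s = slotRank I ds z := by
  rw [columnT, slotRank, eval_ite, Nat.cast_ite]
  by_cases hzi : z < I.size * I.depth
  · rw [if_pos ((h.isIndexT_pos h20).2 hzi), if_pos hzi,
      h.eval_boundaryT (by decide) (by decide) h20 hzi]
  rw [if_neg (by rwa [h.isIndexT_pos h20]), if_neg hzi, eval_ite, Nat.cast_ite]
  refine if_congr (h.isLeftT_pos h20 hzi) ?_ ?_
  · rw [h.eval_stripStartT (by decide) (by decide)
      (h.eval_read_slotDemandT (a := 8) (by decide) rfl h20 hz hzi) h20 hz hzi, exitRank]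
    push_cast
    rfl
  · rw [h.eval_stripStartT (by decide) (by decide)
      (h.eval_read_slotDemandT (a := 9) (by decide) rfl h20 hz hzi) h20 hz hzi, entryRank, add_zero]
    push_cast
    rfl

theorem eval_rowT (h : Known I ps ds preparedArrays s) (h20 : s.var 20 = z)
    (hz : z < slotCount I ds) : rowT.eval s = slotRow I ds z := by
  rw [rowT, slotRow, eval_ite]
  by_cases hzi : z < I.size * I.depth
  · rw [if_pos ((h.isIndexT_pos h20).2 hzi), if_pos hzi, h.eval_indexRowT (by decide) h20 hzi]
  rw [if_neg (by rwa [h.isIndexT_pos h20]), if_neg hzi, eval_ite,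
    h.eval_read_slotDemandT (a := 17) (by decide) rfl h20 hz hzi,
    h.eval_read_slotDemandT (a := 18) (by decide) rfl h20 hz hzi]
  exact if_congr (h.isLeftT_pos h20 hzi) rfl rfl

theorem validT_pos (h : Known I ps ds preparedArrays s) (h20 : s.var 20 = z)
    (hz : z < slotCount I ds) (h25 : s.Indicates 25 I.size (Jump I.size K w))
    (h28 : s.arr 28 z = slotRank I ds z) : 0 < validT.eval s ↔ SlotValid I ds K w z := by
  rw [validT, eval_ite, SlotValid]
  by_cases hzi : z < I.size * I.depth
  · rw [if_pos ((h.isIndexT_pos h20).2 hzi), if_pos hzi, and_pos, lt_pos, eval_read,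
      h.eval_slotIndexT h20, h25.pos_iff (slotIndex_lt hzi), cell, eval_read, eval_var, eval_var,
      h20, h28, h.var_zero, Nat.cast_lt]
  · have hne : specArr I ps ds 16 ((z - I.size * I.depth) / 2)
        = if (slotDemand I ds z).1 ≠ (slotDemand I ds z).2 then 1 else 0 := rfl
    rw [if_neg (by rwa [h.isIndexT_pos h20]), if_neg hzi,
      h.eval_read_slotDemandT (by decide) rfl h20 hz hzi, hne]
    split_ifs with hd
    exacts [iff_of_true one_pos hd, iff_of_false (lt_irrefl 0) hd]

theorem sum_active_pos (h : Known I ps ds preparedArrays s) (hl : I.ListedBy ps ds) :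
    0 < (agg .sum 20 1 (cell 16)).eval s ↔ ∃ d ∈ I.D, d.1 ≠ d.2 := by
  have hactive : s.Indicates 16 ds.length fun i => (ds.getD i 0).1 ≠ (ds.getD i 0).2 :=
    fun i hi => by convert h.arr_eq 16 (by decide) i hi using 1; simp only [specArr]; congr
  have hsum : (agg .sum 20 1 (cell 16)).eval s
      = ∑ i ∈ Finset.range ds.length, s.arr 16 i := by
    simp [cell, h.var_one]
  rw [hsum, hactive.sum_pos_iff le_rfl]
  constructor
  · rintro ⟨i, hi, hne⟩
    exact ⟨_, hl.getD_mem hi, hne⟩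
  · rintro ⟨d, hd, hne⟩
    obtain ⟨i, hi, rfl⟩ := List.getElem_of_mem ((hl.mem_demands d).2 hd)
    exact ⟨i, hi, by rwa [List.getD_eq_getElem _ _ hi]⟩

end Known

theorem Search.jumpT_pos (h : Search I ps ds B K w s) {u : ℕ} (hu : u < I.size) :
    0 < jumpT.eval (s.setVar 21 u) ↔ Jump I.size K w u := by
  have hsum (m : ℕ) (hm : m ≤ I.size) :
      ∑ v ∈ Finset.range m, s.arr 21 (v : ℤ) = ∑ v ∈ Finset.range m, w v :=
    Finset.sum_congr rfl fun v hv => h.w_eq v ((Finset.mem_range.1 hv).trans_le hm)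
  rw [jumpT, lt_pos, Jump, scaledWeight, scaledWeight, Finset.sum_range_succ _ u]
  simp [scaledWeightT, h.K_eq, h.known.var_four, hsum u hu.le, hsum _ le_rfl, h.w_eq u hu]

theorem tab_ind_arr {a x r n : ℕ} {t : Term} {p : ℕ → Prop} (hr : s.var r = n)
    (ht : ∀ i < n, 0 < t.eval (s.setVar x i) ↔ p i) :
    ((Stm.tab a x r (ind t)).eval s).Indicates a n p := by
  classical
  intro i hi
  rw [Stm.tab_arr (by rw [hr]; exact mod_cast hi), eval_ind]
  exact if_congr (ht i hi) rfl rfl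

open Classical in
theorem tab_ite_arr {a r n : ℕ} {t : Term} {p : ℕ → Prop} {f : ℕ → ℤ}
    (hv : s.Indicates 29 n p) (hr : s.var r = n)
    (ht : ∀ i < n, p i → t.eval (s.setVar 20 i) = f i) {i : ℕ} (hi : i < n) :
    ((Stm.tab a 20 r (ite (cell 29) t 0)).eval s).arr a i = if p i then f i else 0 := by
  have hpos : 0 < (cell 29).eval (s.setVar 20 i) ↔ p i := by simpa [cell] using hv.pos_iff hi
  rw [Stm.tab_arr (by rw [hr]; exact mod_cast hi), eval_ite, if_congr hpos rfl rfl, eval_zero]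
  split_ifs with hp
  exacts [ht i hi hp, rfl]

/-- The point of a slot; the slots that are not in use hold the origin. -/
noncomputable def slotPoint (I : Instance) (ds : List Demand) (K : ℤ) (w : ℕ → ℤ) (z : ℕ) : ℤ × ℤ :=
  open Classical in
  if SlotValid I ds K w z then (I.coord Prod.fst (slotRank I ds z), slotRow I ds z) else 0

theorem Search.eval_slotsStm (h : Search I ps ds B K w s) :
    Known I ps ds preparedArrays (slotsStm.eval s) ∧
      (∀ z < slotCount I ds, (slotsStm.eval s).arr 28 z = slotRank I ds z) ∧
      (slotsStm.eval s).Indicates 29 (slotCount I ds) (SlotValid I ds K w) := by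
  have k₁ := h.known.tab_of_notMem (a := 25) (x := 21) (r := 4) (t := ind jumpT) (by decide)
  have hjump := tab_ind_arr (a := 25) h.known.var_four fun u hu => h.jumpT_pos hu
  set s₁ := (Stm.tab 25 21 4 (ind jumpT)).eval s
  have k₂ := k₁.tab_of_notMem (a := 28) (x := 20) (r := 8) (t := columnT) (by decide)
  have hcolumn {z : ℕ} (hz : z < slotCount I ds) :
      ((Stm.tab 28 20 8 columnT).eval s₁).arr 28 z = slotRank I ds z := by
    rw [Stm.tab_arr (by rw [k₁.var_eight]; exact mod_cast hz)]
    exact (k₁.setVar (by norm_num) _).eval_columnT (by simp) hz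
  have hjump₂ : ((Stm.tab 28 20 8 columnT).eval s₁).Indicates 25 I.size (Jump I.size K w) :=
    fun u hu => (congrFun (Stm.tab_arr_ne (by norm_num)) _).trans (hjump u hu)
  refine ⟨k₂.tab_of_notMem (by decide), fun z hz => ?_, tab_ind_arr k₂.var_eight fun z hz => ?_⟩
  · exact (congrFun (Stm.tab_arr_ne (by norm_num)) _).trans (hcolumn hz)
  · exact (k₂.setVar (by norm_num) _).validT_pos (by simp) hz hjump₂ (hcolumn hz)

theorem Search.arr_outputStm (h : Search I ps ds B K w s) (hl : I.ListedBy ps ds)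
    (hz : z < slotCount I ds) :
    ((outputStm.eval s).arr 6 z, (outputStm.eval s).arr 7 z) = slotPoint I ds K w z := by
  obtain ⟨k, hcolumn, hvalid⟩ := h.eval_slotsStm
  have k₁ := k.tab_of_notMem (a := 6) (x := 20) (r := 8)
    (t := ite (cell 29) (read 19 (cell 28)) 0) (by decide)
  have hx := tab_ite_arr (a := 6) (t := read 19 (cell 28))
    (f := fun z => I.coord Prod.fst (slotRank I ds z)) hvalid k.var_eight
    (fun i hi hv => by
      simpa [cell, hcolumn i hi, specArr] using k.arr_eq 19 (by decide) _ (slotRank_lt hl hi hv)) hz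
  have hy := tab_ite_arr (a := 7) (t := rowT) (f := slotRow I ds)
    (fun i hi => (congrFun (Stm.tab_arr_ne (a := 6) (by norm_num)) _).trans (hvalid i hi))
    k₁.var_eight (fun i hi _ => (k₁.setVar (by norm_num) _).eval_rowT (by simp) hi) hz
  have hx' := (congrFun (Stm.tab_arr_ne (a := 7) (x := 20) (r := 8) (t := ite (cell 29) rowT 0)
    (by norm_num)) _).trans hx
  refine (congrArg₂ Prod.mk hx' hy).trans ?_
  rw [slotPoint]
  split_ifs <;> rfl

open Classical in
theorem Search.var_outputStm (h : Search I ps ds B K w s) (hl : I.ListedBy ps ds) :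
    (outputStm.eval s).var 2 = if ∃ d ∈ I.D, d.1 ≠ d.2 then (slotCount I ds : ℤ) else 0 := by
  have k := (h.eval_slotsStm.1.tab_of_notMem (a := 6) (x := 20) (r := 8)
    (t := ite (cell 29) (read 19 (cell 28)) 0) (by decide)).tab_of_notMem (a := 7) (x := 20)
    (r := 8) (t := ite (cell 29) rowT 0) (by decide)
  change (Term.ite (agg .sum 20 1 (cell 16)) (var 8) 0).eval _ = _
  rw [eval_ite, if_congr (k.sum_active_pos hl) rfl rfl, eval_var, k.var_eight, eval_zero]

end Algo

/-! ### The input -/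

theorem abs_le_two_pow_bitLength (x : ℤ) : |x| ≤ 2 ^ bitLength x := by
  have hsize : x.natAbs ≤ 2 ^ Nat.size x.natAbs := (Nat.lt_size_self x.natAbs).le
  rw [Int.abs_eq_natAbs]
  calc (x.natAbs : ℤ) ≤ 2 ^ Nat.size x.natAbs := mod_cast hsize
    _ ≤ 2 ^ bitLength x := pow_le_pow_right₀ one_le_two (Nat.le_add_left _ _)

section List

variable {α : Type*} {l : List α} {f : α → ℤ} {g : α → ℕ} {B : ℕ}

theorem arrayOf_map [Zero α] {i : ℕ} (hi : i < l.length) :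
    arrayOf (l.map f) i = f (l.getD i 0) := by
  simp [arrayOf, hi]

theorem abs_arrayOf_map_le (hg : ∀ x, bitLength (f x) ≤ g x) (hB : (l.map g).sum ≤ B) (i : ℤ) :
    |arrayOf (l.map f) i| ≤ 2 ^ B := by
  unfold arrayOf
  split_ifs
  · rcases lt_or_ge i.toNat (l.map f).length with hi | hi
    · rw [List.getD_eq_getElem _ _ hi]
      obtain ⟨x, hx, hfx⟩ := List.mem_map.1 (List.getElem_mem hi)
      rw [← hfx]
      refine (abs_le_two_pow_bitLength _).trans (pow_le_pow_right₀ one_le_two ?_)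
      exact (hg x).trans ((List.le_sum_of_mem (List.mem_map_of_mem hx)).trans hB)
    · rw [List.getD_eq_default _ _ hi]
      simp
  · simp

theorem length_le_sum_map (hg : ∀ x, 1 ≤ g x) : l.length ≤ (l.map g).sum := by
  have h := List.card_nsmul_le_sum (l.map g) 1 fun n hn => by
    obtain ⟨x, -, rfl⟩ := List.mem_map.1 hn
    exact hg x
  simpa using h

end List

theorem bounded_inputStore (ps : List (ℤ × ℤ)) (ds : List Demand) :
    (inputStore ps ds).Bounded 50 (inputSize ps ds) := by
  have hps : (ps.map fun p => bitLength p.1 + bitLength p.2).sum ≤ inputSize ps ds := by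
    unfold inputSize
    omega
  have hds : (ds.map fun d => bitLength d.1.1 + bitLength d.1.2 + bitLength d.2.1
      + bitLength d.2.2).sum ≤ inputSize ps ds := Nat.le_add_left _ _
  have hpos (z : ℤ) : 1 ≤ bitLength z := Nat.le_add_right 1 _
  have hps_length : ps.length ≤ inputSize ps ds :=
    (length_le_sum_map fun p => (hpos p.1).trans (by omega)).trans hps
  have hds_length : ds.length ≤ inputSize ps ds :=
    (length_le_sum_map fun d => (hpos d.1.1).trans (by omega)).trans hds
  refine ⟨fun x _ => ?_, fun a i => ?_⟩
  · match x with
    | 0 => simpa [inputStore] using hps_length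
    | 1 => simpa [inputStore] using hds_length
    | x + 2 => simp [inputStore]
  · match a with
    | 0 | 1 => exact abs_arrayOf_map_le (fun p => by omega) hps i
    | 2 | 3 | 4 | 5 => exact abs_arrayOf_map_le (fun d => by omega) hds i
    | a + 6 => simp [inputStore]

namespace Algo

open Term Instance

variable {I : Instance} {ps : List (ℤ × ℤ)} {ds : List Demand} {B : ℕ} {K : ℤ} {w : ℕ → ℤ}
  {s : Store} {p : ℤ × ℤ}

theorem search_prepareStm (hl : I.ListedBy ps ds)
    (hb : (prepareStm.eval (inputStore ps ds)).Bounded 50 B) :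
    Search I ps ds B 0 (fun _ => 1) (prepareStm.eval (inputStore ps ds)) := by
  have hinput : ∀ a ∈ inputArrays, ∀ i < specLen I ds a,
      (inputStore ps ds).arr a i = specArr I ps ds a i := by
    intro a ha i hi
    have hps (h : i < I.P.card) : i < ps.length := hl.length_points ▸ h
    simp only [inputArrays, List.mem_cons, List.not_mem_nil, or_false] at ha
    rcases ha with rfl | rfl | rfl | rfl | rfl | rfl
    exacts [arrayOf_map (hps hi), arrayOf_map (hps hi), arrayOf_map hi, arrayOf_map hi,
      arrayOf_map hi, arrayOf_map hi]
  have hsizes := known_sizesStm (s := inputStore ps ds)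
    (by simp [inputStore, hl.length_points]) rfl hinput
  have hdemands := (hsizes.coords hl).demands hl
  refine ⟨hdemands.tab_of_notMem (by decide), rfl, fun u hu => ?_, hb⟩
  exact Stm.tab_arr (by rw [hdemands.var_four]; exact mod_cast hu)

/-! ### The output -/

theorem slotPoint_index {u j : ℕ} (hu : u < I.size) (hJ : Jump I.size K w u) (hj : j < I.depth)
    (hrank : I.boundary u j < I.P.card) : slotPoint I ds K w (u * I.depth + j) =
      (I.coord Prod.fst (I.boundary u j), I.indexRow u) := by
  have hz : u * I.depth + j < I.size * I.depth := by nlinarith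
  have hdiv : (u * I.depth + j) / I.depth = u := by
    rw [mul_comm, Nat.mul_add_div (by omega), Nat.div_eq_of_lt hj, add_zero]
  have hmod : (u * I.depth + j) % I.depth = j := by
    rw [mul_comm, Nat.mul_add_mod, Nat.mod_eq_of_lt hj]
  have hslot : slotRank I ds (u * I.depth + j) = I.boundary u j := by
    rw [slotRank, if_pos hz, hdiv, hmod]
  have hvalid : SlotValid I ds K w (u * I.depth + j) := by
    rw [SlotValid, if_pos hz, hdiv, hslot]
    exact ⟨hJ, hrank⟩
  rw [slotPoint, if_pos hvalid, hslot, slotRow, if_pos hz, hdiv]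

theorem slotPoint_leftExit {e : ℕ} (hne : (ds.getD e 0).1 ≠ (ds.getD e 0).2) :
    slotPoint I ds K w (I.size * I.depth + 2 * e) = I.leftExit (ds.getD e 0) := by
  have hz : ¬ I.size * I.depth + 2 * e < I.size * I.depth := by omega
  have hdemand : slotDemand I ds (I.size * I.depth + 2 * e) = ds.getD e 0 := by
    rw [slotDemand]
    congr 1
    omega
  have hparity : (I.size * I.depth + 2 * e - I.size * I.depth) % 2 = 0 := by omega
  have hvalid : SlotValid I ds K w (I.size * I.depth + 2 * e) := by
    rwa [SlotValid, if_neg hz, hdemand]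
  rw [slotPoint, if_pos hvalid, slotRank, slotRow, if_neg hz, if_neg hz, if_pos hparity,
    if_pos hparity, hdemand, leftExit]

theorem slotPoint_rightEntry {e : ℕ} (hne : (ds.getD e 0).1 ≠ (ds.getD e 0).2) :
    slotPoint I ds K w (I.size * I.depth + (2 * e + 1)) = I.rightEntry (ds.getD e 0) := by
  have hz : ¬ I.size * I.depth + (2 * e + 1) < I.size * I.depth := by omega
  have hdemand : slotDemand I ds (I.size * I.depth + (2 * e + 1)) = ds.getD e 0 := by
    rw [slotDemand]
    congr 1
    omega
  have hparity : ¬ (I.size * I.depth + (2 * e + 1) - I.size * I.depth) % 2 = 0 := by omega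
  have hvalid : SlotValid I ds K w (I.size * I.depth + (2 * e + 1)) := by
    rwa [SlotValid, if_neg hz, hdemand]
  rw [slotPoint, if_pos hvalid, slotRank, slotRow, if_neg hz, if_neg hz, if_neg hparity,
    if_neg hparity, hdemand, rightEntry]

theorem slotPoint_mem (hl : I.ListedBy ps ds) {z : ℕ} (hz : z < slotCount I ds) :
    slotPoint I ds K w z ∈ insert 0 (I.netPoints K w ∪ I.endPoints) := by
  rw [slotPoint]
  split_ifs with hv
  swap
  · exact Or.inl rfl
  right
  rw [SlotValid] at hv
  rw [slotRank, slotRow] at *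
  split_ifs at hv ⊢ with hzi hparity
  · exact Or.inl ⟨_, slotIndex_lt hzi, hv.1, _, Nat.mod_lt _ (depth_pos_of_lt hzi), hv.2, rfl⟩
  · exact Or.inr ⟨_, slotDemand_mem hl hz hzi, hv, Or.inl rfl⟩
  · exact Or.inr ⟨_, slotDemand_mem hl hz hzi, hv, Or.inr rfl⟩

namespace Search

theorem mem_outputPoints (h : Search I ps ds B K w s) (hl : I.ListedBy ps ds)
    (hne : ∃ d ∈ I.D, d.1 ≠ d.2) :
    p ∈ outputPoints (outputStm.eval s) ↔ ∃ z < slotCount I ds, slotPoint I ds K w z = p := by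
  simp only [outputPoints, h.var_outputStm hl, if_pos hne, Int.toNat_natCast, Finset.mem_image,
    Finset.mem_range]
  exact exists_congr fun z => and_congr_right fun hz => by rw [h.arr_outputStm hl hz]

theorem outputPoints_eq_empty (h : Search I ps ds B K w s) (hl : I.ListedBy ps ds)
    (hne : ¬ ∃ d ∈ I.D, d.1 ≠ d.2) : outputPoints (outputStm.eval s) = ∅ := by
  rw [outputPoints, h.var_outputStm hl, if_neg hne]
  simp

theorem union_subset_outputPoints (h : Search I ps ds B K w s) (hl : I.ListedBy ps ds)
    (hne : ∃ d ∈ I.D, d.1 ≠ d.2) :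
    I.netPoints K w ∪ I.endPoints ⊆ outputPoints (outputStm.eval s) := by
  intro p hp
  rw [Finset.mem_coe, h.mem_outputPoints hl hne]
  simp only [slotCount]
  rcases hp with ⟨u, hu, hJ, j, hj, hrank, rfl⟩ | ⟨d, hd, hdne, hp⟩
  · have hz : u * I.depth + j < I.size * I.depth := by nlinarith
    exact ⟨_, by omega, slotPoint_index hu hJ hj hrank⟩
  obtain ⟨e, he, rfl⟩ := List.getElem_of_mem ((hl.mem_demands d).2 hd)
  rw [← List.getD_eq_getElem _ 0 he] at hdne hp
  rcases hp with rfl | rfl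
  · exact ⟨_, by omega, slotPoint_leftExit hdne⟩
  · exact ⟨_, by omega, slotPoint_rightEntry hdne⟩

theorem feasible_outputPoints (h : Search I ps ds B K w s) (hl : I.ListedBy ps ds) (hK : 0 ≤ K)
    (hw : ∀ u, 1 ≤ w u) (hgood : (I.problem ds).Good K w) :
    I.Feasible (toPlane '' (outputPoints (outputStm.eval s) : Set (ℤ × ℤ))) := by
  by_cases hne : ∃ d ∈ I.D, d.1 ≠ d.2
  · exact feasible_of_good (fun d hd => (hl.mem_demands d).2 hd) hK hw hgood
      (h.union_subset_outputPoints hl hne)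
  · push Not at hne
    exact feasible_of_forall_eq hne _

theorem card_outputPoints_le (h : Search I ps ds B K w s) (hl : I.ListedBy ps ds) (hK : 0 ≤ K)
    (hw : ∀ u, 1 ≤ w u)
    (hKQ : ∀ Q : Finset (ℝ × ℝ), I.Feasible (Q : Set (ℝ × ℝ)) → K ≤ 8 * Q.card) :
    ((outputPoints (outputStm.eval s)).card : ℝ) ≤ 207 * √(Real.log I.P.card) * (I.opt : ℝ) := by
  by_cases hne : ∃ d ∈ I.D, d.1 ≠ d.2
  · have hsub : (outputPoints (outputStm.eval s) : Set (ℤ × ℤ)) ⊆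
        insert 0 (I.netPoints K w ∪ I.endPoints) := by
      intro p hp
      obtain ⟨z, hz, rfl⟩ := (h.mem_outputPoints hl hne).1 hp
      exact slotPoint_mem hl hz
    obtain ⟨d, hd, hdne⟩ := hne
    exact card_le_opt hd hdne hK hw hKQ hsub
  · rw [h.outputPoints_eq_empty hl hne, Finset.card_empty, Nat.cast_zero]
    positivity

end Search

/-! ### The approximation algorithm -/

theorem exists_search_searchStm : ∃ q : Polynomial ℕ, ∀ (I : Instance) (ps : List (ℤ × ℤ))
    (ds : List Demand), I.ListedBy ps ds →
      let B := q.eval (inputSize ps ds)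
      let z := (I.problem ds).advance^[I.size + 1] (0, fun _ => 1)
      prepareStm.Safe 50 B (inputStore ps ds) ∧
        searchStm.Safe 50 B (prepareStm.eval (inputStore ps ds)) ∧
        Search I ps ds B z.1 z.2 (searchStm.eval (prepareStm.eval (inputStore ps ds))) := by
  obtain ⟨q, hq⟩ := prepareStm_tame
  refine ⟨q, fun I ps ds hl => ?_⟩
  intro B
  obtain ⟨-, hsafe, hbdd⟩ := hq _ _ (bounded_inputStore ps ds)
  have h := search_prepareStm hl hbdd
  have hrounds : (I.problem ds).rounds ≤ B := by
    simpa [h.known.var_seven] using h.bdd.var_le 7 (by norm_num)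
  have hsize : I.size + 1 ≤ B := by
    have hvar := h.bdd.var_le 6 (by norm_num)
    rw [h.known.var_six, Nat.abs_cast] at hvar
    exact mod_cast hvar
  exact ⟨hsafe, triple_search hrounds hsize _ h⟩

theorem algorithm_safe : ∃ q : Polynomial ℕ, ∀ (I : Instance) (ps : List (ℤ × ℤ))
    (ds : List Demand), I.ListedBy ps ds →
      algorithm.Safe 50 (q.eval (inputSize ps ds)) (inputStore ps ds) := by
  obtain ⟨q, hq⟩ := exists_search_searchStm
  obtain ⟨q', hq'⟩ := outputStm_tame
  refine ⟨q'.comp q, fun I ps ds hl => ?_⟩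
  obtain ⟨hprepare, hsearch, h⟩ := hq I ps ds hl
  obtain ⟨hle, houtput, -⟩ := hq' _ _ h.bdd
  rw [Polynomial.eval_comp]
  exact ⟨hprepare.mono hle, hsearch.mono hle, houtput⟩

theorem algorithm_approximates (hl : I.ListedBy ps ds) :
    let Z := outputPoints (algorithm.eval (inputStore ps ds))
    I.Feasible (toPlane '' (Z : Set (ℤ × ℤ))) ∧
      (Z.card : ℝ) ≤ 207 * √(Real.log I.P.card) * (I.opt : ℝ) := by
  obtain ⟨q, hq⟩ := exists_search_searchStm
  obtain ⟨-, -, h⟩ := hq I ps ds hl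
  set z := (I.problem ds).advance^[I.size + 1] (0, fun _ => 1)
  have hz (Q : Finset (ℝ × ℝ)) (hQ : I.Feasible (Q : Set (ℝ × ℝ))) :
      (I.problem ds).Good z.1 z.2 ∧ z.1 ≤ 8 * Q.card := by
    obtain ⟨H, hH, hcard⟩ := exists_isHittingSet (fun d hd => (hl.mem_demands d).1 hd) hQ
    obtain ⟨hgood, -, hle⟩ := HitProblem.good_iterate_advance hH
    exact ⟨hgood, hle.trans (mod_cast hcard)⟩
  obtain ⟨Q, hQ⟩ := I.exists_feasible
  obtain ⟨hK, -, hw⟩ := HitProblem.iterate_advance_bounds (X := I.problem ds) (I.size + 1)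
  exact ⟨h.feasible_outputPoints hl hK (fun u => (hw u).1) (hz Q hQ).1,
    h.card_outputPoints_le hl hK (fun u => (hw u).1) fun Q hQ => (hz Q hQ).2⟩

theorem isPolyTimeApproximation_algorithm : IsPolyTimeApproximation (algorithm.comp 50)
    fun n : ℕ => 207 * √(Real.log n) := by
  obtain ⟨p, hp⟩ := Stm.runsInPolyTime algorithm algorithm_wf
  obtain ⟨q, hq⟩ := algorithm_safe
  refine ⟨p.comp q, fun I ps ds hl => ?_⟩
  obtain ⟨t, s, hexec, ht, hagree, -⟩ := hp _ _ _ 50 le_rfl (hq I ps ds hl) (.refl 50 _)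
  have hout : outputPoints s = outputPoints (algorithm.eval (inputStore ps ds)) := by
    rw [outputPoints, outputPoints, hagree.arr_eq, hagree.var_eq 2 (by norm_num)]
  refine ⟨t, s, hexec, ?_, ?_⟩
  · rwa [Polynomial.eval_comp]
  · rw [hout]
    exact algorithm_approximates hl

end Algo

end MinGMConn

theorem theorem3 :
    ∃ (prog : MinGMConn.Program) (C : ℝ),
      MinGMConn.IsPolyTimeApproximation prog (fun n : ℕ => C * Real.sqrt (Real.log (n : ℝ))) :=
  ⟨_, 207, MinGMConn.Algo.isPolyTimeApproximation_algorithm⟩
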